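/- Let $p$ be a prime and let $A$ be a complete discrete valuation ring with maximal ideal $\mathfrak p_A$ and residue field $\bar A$ of characteristic $p$. An $\mathbf F_p$-algebra is *perfect* if its Frobenius endomorphism $x\mapsto x^p$ is bijective; $R^{\mathrm{pf}}$ denotes the perfection (the universal perfect algebra under $R$), and $\mathrm{PAlg}_R$ the category of perfect $R$-algebras. Let $\mathrm{CRP}_A$ (*complete residual perfections* of $A$) be the full subcategory of the category of $A$-algebras consisting of those $B$ that are flat over $A$, complete (and separated) for the ideal $\mathfrak p_B=\mathfrak p_AB$, and such that $\bar B=B/\mathfrak p_B$ is perfect. For such $B$ let $s_B:\bar B\to B$ be the unique multiplicative section of $B\to\bar B$. Fix a uniformizer $\pi$ of $A$ and a subset $T\subset A$ that lifts a $p$-basis of $\bar A$. Every element $x$ of an object $B$ of $\mathrm{CRP}_A$ is uniquely $\sum_{j\ge 0}s_B(x_j)\pi^j$ with $x_j\in\bar B$, its *coefficients*. Let $R_T=\bar A[u_{t,j}\mid t\in T,\ j\ge 1]$. *The functor $U:\mathrm{CRP}_A\to\mathrm{PAlg}_{R_T^{\mathrm{pf}}}$.* $U(B)$ is $\bar B$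 with the unique $R_T^{\mathrm{pf}}$-algebra structure that extends its $\bar A$-algebra structure and sends $u_{t,j}$ to the $j$-th coefficient of the image of $t$ in $B$. *The functor $V:\mathrm{PAlg}_{R_T^{\mathrm{pf}}}\to\mathrm{CRP}_A$.* (a) If $A$ has equal characteristic, then for every perfect $R_T^{\mathrm{pf}}$-algebra $S$ there is a unique ring map $A\to S[\![\tilde\pi]\!]$ with $\pi\mapsto\tilde\pi$, with $t\mapsto\bar t+\sum_{j\ge1}u_{t,j}\tilde\pi^j$ for all $t\in T$, and whose reduction modulo $\tilde\pi$ is $A\to\bar A\to S$. Let $V(S)=S[\![\tilde\pi]\!]$ with this $A$-algebra structure. (b) If $A$ has mixed characteristic, there is a unique subring $C\subset A$ that contains $T$, is a complete discrete valuation ring with maximal ideal $pC$, and maps onto $\bar A$ (the Cohen subring determined by $T$). For every perfect $R_T^{\mathrm{pf}}$-algebra $S$, with Witt vectors $W=W(S)$ and Teichmüller map $s_W:S\to W$, there is a unique ring map $C[X]\to W[\![\tilde\pi]\!]$ with $X\mapsto\tilde\pi$, with $t\mapsto s_W(\bar t)+\sum_{j\ge1}s_W(u_{t,j})\tilde\pi^j$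 for all $t\in T$, and whose restriction to $C$ reduces modulo $(p,\tilde\pi)$ to $C\to\bar A\to S$. Let $V(S)=A\otimes_{C[X]}W[\![\tilde\pi]\!]$, where $A$ is a $C[X]$-algebra by $X\mapsto\pi$. In both cases $V(S)$ is an object of $\mathrm{CRP}_A$, and $\langle V,U;\eta,\varepsilon\rangle$ is an adjoint equivalence between $\mathrm{PAlg}_{R_T^{\mathrm{pf}}}$ and $\mathrm{CRP}_A$ ($V$ is left adjoint to $U$, with unit $\eta:1\to UV$ and counit $\varepsilon:VU\to1$ both isomorphisms). Here $\eta(S):S\to UV(S)$ sends $x$ to the class of the constant series $x$ in case (a), and of $1\otimes s_W(x)$ in case (b). In case (a), $\varepsilon(B):\bar B[\![\tilde\pi]\!]\to B$ is $\sum b_j\tilde\pi^j\mapsto\sum s_B(b_j)\pi^j$. In case (b), $\varepsilon(B)$ is the $A$-linear map with $1\otimes\sum w_j\tilde\pi^j\mapsto\sum\theta(w_j)\pi^j$, where $\theta:W(\bar B)\to B$ is the unique ring map that reduces to the identity of $\bar B$. Consequently: (i) $\mathrm{CRP}_A$ has an initial object $A^{\mathrm u}$ (the universal residual perfection), and the unique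 morphism $A^{\mathrm u}\to V(R_T^{\mathrm{pf}})$ is an isomorphism. (ii) $\overline{A^{\mathrm u}}$ is a domain. The generic residual perfection $A^{\mathrm g}$, that is, the object of $\mathrm{CRP}_A$ for which $\overline{A^{\mathrm u}}\to\overline{A^{\mathrm g}}$ is a fraction field of $\overline{A^{\mathrm u}}$, exists and is isomorphic to $V(\mathrm{Fr}(R_T^{\mathrm{pf}}))$ by a unique isomorphism of $A$-algebras. -/

import Mathlib

open CategoryTheory
open scoped TensorProduct

universe u

namespace ResidualPerfection

noncomputable section

/-! ### Perfect algebras and `p`-bases -/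

/-- `S` is a perfect `𝔽_p`-algebra: `p = 0` in `S` and `x ↦ x ^ p` is bijective.
(The zero ring is allowed, so Mathlib's `PerfectRing`, which excludes it, is not used.) -/
def IsPerfect (p : ℕ) (S : Type*) [CommRing S] : Prop :=
  (p : S) = 0 ∧ Function.Bijective (fun x : S => x ^ p)

/-- The property of an `R`-algebra of being perfect. -/
def isPerfectAlg (p : ℕ) (R : Type u) [CommRing R] : ObjectProperty (CommAlgCat.{u} R) :=
  fun S => IsPerfect p S

/-- The full subcategory of the category of `R`-algebras whose objects are perfect. -/
abbrev PAlg (p : ℕ) (R : Type u) [CommRing R] := (isPerfectAlg p R).FullSubcategory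

/-- A family `b` in a field `k` of characteristic `p` is a `p`-basis if the monomials in `b` with
all exponents `< p` form a basis of `k` over its subfield `k ^ p` of `p`-th powers. -/
structure IsPBasis (p : ℕ) {k : Type*} [Field k] [ExpChar k p] {ι : Type*} (b : ι → k) :
    Prop where
  linearIndependent : LinearIndependent (frobenius k p).fieldRange
    (fun α : {α : ι →₀ ℕ // ∀ i, α i < p} => α.1.prod fun i e => b i ^ e)
  span_eq_top : Submodule.span (frobenius k p).fieldRange
    (Set.range fun α : {α : ι →₀ ℕ // ∀ i, α i < p} => α.1.prod fun i e => b i ^ e) = ⊤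

/-- A ring map from a ring of characteristic `p` to a perfect `𝔽_p`-algebra extends uniquely to
the perfection. -/
theorem existsUnique_perfectClosure_lift (p : ℕ) [Fact p.Prime] {R : Type*} [CommRing R]
    [CharP R p] {S : Type*} [CommRing S] (hS : IsPerfect p S) (f : R →+* S) :
    ∃! g : PerfectClosure R p →+* S, g.comp (PerfectClosure.of R p) = f := by
  rcases subsingleton_or_nontrivial S with h | h
  · refine ⟨⟨⟨⟨fun _ => 0, Subsingleton.elim _ _⟩, fun _ _ => Subsingleton.elim _ _⟩,
      Subsingleton.elim _ _, fun _ _ => Subsingleton.elim _ _⟩, ?_, ?_⟩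
    · ext; exact Subsingleton.elim _ _
    · intro g _; ext; exact Subsingleton.elim _ _
  · have : CharP S p := by
      rcases CharP.exists S with ⟨q, hq⟩
      have h1 : q ∣ p := (CharP.cast_eq_zero_iff S q p).1 hS.1
      rcases (Nat.dvd_prime Fact.out).1 h1 with rfl | rfl
      · exact absurd rfl (CharP.char_ne_one S 1)
      · exact hq
    have : PerfectRing S p := ⟨hS.2⟩
    refine ⟨PerfectClosure.lift R p S f, (PerfectClosure.lift R p S).symm_apply_apply f, ?_⟩
    intro g hg
    rw [← hg]
    exact ((PerfectClosure.lift R p S).apply_symm_apply g).symm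

/-- The extension of a ring map to the perfection. -/
def perfectLift (p : ℕ) [Fact p.Prime] {R : Type*} [CommRing R] [CharP R p] {S : Type*}
    [CommRing S] (hS : IsPerfect p S) (f : R →+* S) : PerfectClosure R p →+* S :=
  (existsUnique_perfectClosure_lift p hS f).choose

theorem perfectLift_comp_of (p : ℕ) [Fact p.Prime] {R : Type*} [CommRing R] [CharP R p]
    {S : Type*} [CommRing S] (hS : IsPerfect p S) (f : R →+* S) :
    (perfectLift p hS f).comp (PerfectClosure.of R p) = f :=
  (existsUnique_perfectClosure_lift p hS f).choose_spec.1

theorem perfectClosure_hom_ext (p : ℕ) [Fact p.Prime] {R : Type*} [CommRing R] [CharP R p]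
    {S : Type*} [CommRing S] (hS : IsPerfect p S) {g g' : PerfectClosure R p →+* S}
    (h : g.comp (PerfectClosure.of R p) = g'.comp (PerfectClosure.of R p)) : g = g' :=
  (existsUnique_perfectClosure_lift p hS (g'.comp (PerfectClosure.of R p))).unique h rfl

theorem isPerfect_perfectClosure (p : ℕ) [Fact p.Prime] (R : Type*) [CommRing R] [CharP R p] :
    IsPerfect p (PerfectClosure R p) :=
  ⟨CharP.cast_eq_zero _ _, PerfectRing.bijective_frobenius (p := p)⟩

instance isDomain_perfectClosure (p : ℕ) [Fact p.Prime] (R : Type*) [CommRing R] [CharP R p]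
    [IsDomain R] : IsDomain (PerfectClosure R p) := by
  have : NoZeroDivisors (PerfectClosure R p) := ⟨by
    intro a b hab
    induction a using PerfectClosure.induction_on with
    | _ x =>
      induction b using PerfectClosure.induction_on with
      | _ y =>
        obtain ⟨m, x⟩ := x
        obtain ⟨n, y⟩ := y
        rw [PerfectClosure.mk_mul_mk, ← PerfectClosure.mk_zero_right R p 0,
          PerfectClosure.eq_iff] at hab
        simp only [← coe_iterateFrobenius, map_mul, map_zero, mul_eq_zero,
          iterateFrobenius_def] at hab
        rcases hab with h | h
        · left
          rw [eq_zero_of_pow_eq_zero (eq_zero_of_pow_eq_zero h), PerfectClosure.mk_zero_right]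
        · right
          rw [eq_zero_of_pow_eq_zero (eq_zero_of_pow_eq_zero h), PerfectClosure.mk_zero_right]⟩
  exact NoZeroDivisors.to_isDomain _

theorem isPerfect_fractionRing (p : ℕ) [Fact p.Prime] {D : Type*} [CommRing D] [IsDomain D]
    (hD : IsPerfect p D) : IsPerfect p (FractionRing D) := by
  have h0 : (p : FractionRing D) = 0 := by
    rw [← map_natCast (algebraMap D (FractionRing D)), hD.1, map_zero]
  have : CharP (FractionRing D) p := by
    rcases CharP.exists (FractionRing D) with ⟨q, hq⟩
    have h1 : q ∣ p := (CharP.cast_eq_zero_iff (FractionRing D) q p).1 h0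
    rcases (Nat.dvd_prime Fact.out).1 h1 with rfl | rfl
    · exact absurd rfl (CharP.char_ne_one (FractionRing D) 1)
    · exact hq
  refine ⟨h0, frobenius_inj (FractionRing D) p, fun x => ?_⟩
  obtain ⟨a, b, hb, rfl⟩ := IsFractionRing.div_surjective (A := D) x
  obtain ⟨a, rfl⟩ := hD.2.2 a
  obtain ⟨b, rfl⟩ := hD.2.2 b
  exact ⟨algebraMap D _ a / algebraMap D _ b, by simp [div_pow]⟩

/-! ### Algebras given by ring maps -/

/-- The target of a ring map `R → S`, as an `R`-algebra. -/
def algOfRingHom {R S : Type u} [CommRing R] [CommRing S] (f : R →+* S) : CommAlgCat.{u} R :=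
  letI := f.toAlgebra
  CommAlgCat.of R S

/-- A ring map compatible with the maps from `R`, as a morphism of `R`-algebras. -/
def algHomOfRingHom {R S S' : Type u} [CommRing R] [CommRing S] [CommRing S'] {f : R →+* S}
    {f' : R →+* S'} (h : S →+* S') (hh : h.comp f = f') : algOfRingHom f ⟶ algOfRingHom f' :=
  letI := f.toAlgebra
  letI := f'.toAlgebra
  CommAlgCat.ofHom (R := R) (X := S) (Y := S')
    { toRingHom := h, commutes' := fun r => RingHom.congr_fun hh r }

/-- The tensor product `A ⊗_P D` of the targets of two ring maps `P → A` and `P → D`. -/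
def TensorRing {P A D : Type u} [CommRing P] [CommRing A] [CommRing D] (f : P →+* A)
    (g : P →+* D) : Type u :=
  letI := f.toAlgebra
  letI := g.toAlgebra
  TensorProduct P A D

namespace TensorRing

variable {P A D D' : Type u} [CommRing P] [CommRing A] [CommRing D] [CommRing D']

instance (f : P →+* A) (g : P →+* D) : CommRing (TensorRing f g) :=
  letI := f.toAlgebra
  letI := g.toAlgebra
  (inferInstance : CommRing (TensorProduct P A D))

instance (f : P →+* A) (g : P →+* D) : Algebra A (TensorRing f g) :=
  letI := f.toAlgebra
  letI := g.toAlgebra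
  (inferInstance : Algebra A (TensorProduct P A D))

/-- The map `d ↦ 1 ⊗ d`. -/
def inr (f : P →+* A) (g : P →+* D) : D →+* TensorRing f g :=
  letI := f.toAlgebra
  letI := g.toAlgebra
  (Algebra.TensorProduct.includeRight : D →ₐ[P] TensorProduct P A D).toRingHom

/-- The map `A ⊗_P D → A ⊗_P D'` induced by a map `D → D'` compatible with the maps from `P`. -/
def map (f : P →+* A) {g : P →+* D} {g' : P →+* D'} (h : D →+* D') (hh : h.comp g = g') :
    TensorRing f g →ₐ[A] TensorRing f g' :=
  letI := f.toAlgebra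
  letI := g.toAlgebra
  letI := g'.toAlgebra
  (Algebra.TensorProduct.map (AlgHom.id A A)
    ({ toRingHom := h, commutes' := fun r => RingHom.congr_fun hh r } : D →ₐ[P] D') :
    TensorProduct P A D →ₐ[A] TensorProduct P A D')

theorem map_inr (f : P →+* A) {g : P →+* D} {g' : P →+* D'} (h : D →+* D')
    (hh : h.comp g = g') (d : D) : map f h hh (inr f g d) = inr f g' (h d) := by
  let := f.toAlgebra
  let := g.toAlgebra
  let := g'.toAlgebra
  exact Algebra.TensorProduct.map_tmul (R := P) (S := A) (AlgHom.id A A)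
    ({ toRingHom := h, commutes' := fun r => RingHom.congr_fun hh r } : D →ₐ[P] D') 1 d

theorem algHom_ext {f : P →+* A} {g : P →+* D} {E : Type u} [CommRing E] [Algebra A E]
    {k k' : TensorRing f g →ₐ[A] E} (h : ∀ d, k (inr f g d) = k' (inr f g d)) : k = k' := by
  let := f.toAlgebra
  let := g.toAlgebra
  refine AlgHom.ext fun x => ?_
  induction x using TensorProduct.induction_on with
  | zero => exact (map_zero k).trans (map_zero k').symm
  | tmul a d =>
    have e : (a ⊗ₜ[P] d : TensorProduct P A D) = a • (1 ⊗ₜ[P] d : TensorProduct P A D) := by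
      rw [TensorProduct.smul_tmul', smul_eq_mul, mul_one]
    rw [e]
    exact (map_smul k a (inr f g d)).trans ((congrArg (a • ·) (h d)).trans
      (map_smul k' a (inr f g d)).symm)
  | add x y hx hy => exact (map_add k x y).trans ((congrArg₂ (· + ·) hx hy).trans
      (map_add k' x y).symm)

end TensorRing

/-! ### Expansions and multiplicative sections -/

/-- The series `∑ cᵢ ϖ ^ i` converges to `x` in the `I`-adic topology of `B`
(for `ϖ ∈ I`). -/
def IsAdicSum {B : Type*} [CommRing B] (I : Ideal B) (ϖ : B) (c : ℕ → B) (x : B) : Prop :=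
  ∀ n : ℕ, x - ∑ i ∈ Finset.range n, c i * ϖ ^ i ∈ I ^ n

theorem eq_of_forall_sub_mem {B : Type*} [CommRing B] (I : Ideal B) [IsHausdorff I B] {x y : B}
    (h : ∀ n, x - y ∈ I ^ n) : x = y := by
  rw [IsHausdorff.eq_iff_smodEq (I := I)]
  intro n
  rw [SModEq.sub_mem]
  simpa using h n

theorem pow_sub_pow_mem {p : ℕ} {B : Type*} [CommRing B] {I : Ideal B} (hp : (p : B) ∈ I)
    {x y : B} (h : x - y ∈ I) (n : ℕ) : x ^ p ^ n - y ^ p ^ n ∈ I ^ (n + 1) := by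
  have h' : x ≡ y [SMOD I ^ 1] := by
    rw [SModEq.sub_mem]; simpa using h
  exact (SModEq.sub_mem).1 (SModEq.pow_pow_add_one hp (m := n) (by simpa using h'))

/-- Two multiplicative maps out of a perfect ring that agree modulo `I` are equal. -/
theorem multiplicative_ext {p : ℕ} {B : Type*} [CommRing B] {I : Ideal B} [IsHausdorff I B]
    (hp : (p : B) ∈ I) {S : Type*} [CommRing S] (hS : IsPerfect p S) {s s' : S →* B}
    (h : ∀ x, s x - s' x ∈ I) : s = s' := by
  ext x
  refine eq_of_forall_sub_mem I fun n => ?_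
  have hx : ∃ y, y ^ p ^ n = x := by
    induction n generalizing x with
    | zero => exact ⟨x, by simp⟩
    | succ n ih =>
      obtain ⟨z, rfl⟩ := hS.2.2 x
      obtain ⟨y, rfl⟩ := ih z
      exact ⟨y, by rw [pow_succ, pow_mul]⟩
  obtain ⟨y, rfl⟩ := hx
  rw [map_pow, map_pow]
  exact Ideal.pow_le_pow_right (Nat.le_succ n) (pow_sub_pow_mem hp (h y) n)

theorem existsUnique_multSection {p : ℕ} [Fact p.Prime] {B : Type*} [CommRing B] (I : Ideal B)
    [IsAdicComplete I B] (hI : IsPerfect p (B ⧸ I)) :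
    ∃! s : (B ⧸ I) →* B, ∀ x, Ideal.Quotient.mk I (s x) = x := by
  have hp : (p : B) ∈ I := by
    rw [← Ideal.Quotient.eq_zero_iff_mem, map_natCast]; exact hI.1
  refine existsUnique_of_exists_of_unique ?_ ?_
  · rcases subsingleton_or_nontrivial (B ⧸ I) with h | h
    · exact ⟨1, fun x => Subsingleton.elim _ _⟩
    · have : CharP (B ⧸ I) p := by
        rcases CharP.exists (B ⧸ I) with ⟨q, hq⟩
        have h1 : q ∣ p := (CharP.cast_eq_zero_iff (B ⧸ I) q p).1 hI.1
        rcases (Nat.dvd_prime Fact.out).1 h1 with rfl | rfl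
        · exact absurd rfl (CharP.char_ne_one (B ⧸ I) 1)
        · exact hq
      have : PerfectRing (B ⧸ I) p := ⟨hI.2⟩
      let l := Perfection.lift p (B ⧸ I) (B ⧸ I) (RingHom.id _)
      refine ⟨(Perfection.teichmuller p I).comp l.toMonoidHom, fun x => ?_⟩
      have h2 : Ideal.Quotient.mk I (Perfection.teichmuller p I (l x)) =
          Perfection.coeff (B ⧸ I) p 0 (l x) := by
        obtain ⟨y, hy⟩ := Ideal.Quotient.mk_surjective (Perfection.coeff (B ⧸ I) p 0 (l x))
        have := Perfection.teichmuller_sModEq (n := 0) hy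
        rw [← hy, Ideal.Quotient.eq]
        rw [SModEq.sub_mem] at this
        simpa using this
      change Ideal.Quotient.mk I (Perfection.teichmuller p I (l x)) = x
      rw [h2]
      exact RingHom.congr_fun ((Perfection.lift p (B ⧸ I) (B ⧸ I)).symm_apply_apply
        (RingHom.id _)) x
  · intro s s' hs hs'
    refine multiplicative_ext hp hI fun x => ?_
    rw [← Ideal.Quotient.eq_zero_iff_mem, map_sub, hs, hs', sub_self]

theorem existsUnique_coeffs {B : Type*} [CommRing B] {I : Ideal B} {ϖ : B}
    (hI : I = Ideal.span {ϖ}) (hϖ : ∀ x y : B, ϖ * x = ϖ * y → x = y)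
    {s : B ⧸ I → B} (hs : ∀ x, Ideal.Quotient.mk I (s x) = x) (x : B) :
    ∃! c : ℕ → B ⧸ I, IsAdicSum I ϖ (fun i => s (c i)) x := by
  have hdiv : ∀ y : B, ∃ z : B, y = s (Ideal.Quotient.mk I y) + ϖ * z := by
    intro y
    have : y - s (Ideal.Quotient.mk I y) ∈ I := by
      rw [← Ideal.Quotient.eq_zero_iff_mem, map_sub, hs, sub_self]
    have := Ideal.mem_span_singleton'.1 (hI.le this)
    obtain ⟨z, hz⟩ := this
    exact ⟨z, by rw [mul_comm, hz]; ring⟩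
  have hpow : ∀ n : ℕ, I ^ n = Ideal.span {ϖ ^ n} := by
    intro n
    rw [hI, Ideal.span_singleton_pow]
  have hcancel : ∀ (n : ℕ) (a b : B), ϖ ^ n * a = ϖ ^ n * b → a = b := by
    intro n
    induction n with
    | zero => intro a b h; simpa using h
    | succ n ih =>
      intro a b h
      exact hϖ _ _ (ih _ _ (by rw [← mul_assoc, ← mul_assoc, ← pow_succ, h]))
  refine existsUnique_of_exists_of_unique ?_ ?_
  · choose r hr using hdiv
    let q : ℕ → B := fun n => r^[n] x
    refine ⟨fun n => Ideal.Quotient.mk I (q n), fun n => ?_⟩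
    have key : x - ∑ i ∈ Finset.range n, s (Ideal.Quotient.mk I (q i)) * ϖ ^ i = ϖ ^ n * q n := by
      induction n with
      | zero => simp [q]
      | succ n ih =>
        rw [Finset.sum_range_succ, ← sub_sub, ih]
        have h1 : q (n + 1) = r (q n) := Function.iterate_succ_apply' r n x
        have h2 := hr (q n)
        rw [h1]
        calc _ = ϖ ^ n * (q n - s (Ideal.Quotient.mk I (q n))) := by ring
          _ = ϖ ^ n * (ϖ * r (q n)) := by congr 1; exact sub_eq_iff_eq_add'.2 h2
          _ = _ := by ring
    rw [key, hpow]
    exact Ideal.mul_mem_right _ _ (Ideal.mem_span_singleton_self _)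
  · intro c c' hc hc'
    funext n
    induction n using Nat.strong_induction_on with
    | _ n ih =>
      have h1 := sub_mem (hc' (n + 1)) (hc (n + 1))
      have h2 : ∑ i ∈ Finset.range n, s (c i) * ϖ ^ i =
          ∑ i ∈ Finset.range n, s (c' i) * ϖ ^ i :=
        Finset.sum_congr rfl fun i hi => by rw [ih i (Finset.mem_range.1 hi)]
      rw [Finset.sum_range_succ, Finset.sum_range_succ, h2, hpow,
        Ideal.mem_span_singleton'] at h1
      obtain ⟨z, hz⟩ := h1
      have h3 : s (c n) - s (c' n) = ϖ * z := by
        apply hcancel n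
        rw [pow_succ] at hz
        linear_combination -hz
      rw [← hs (c n), ← hs (c' n), Ideal.Quotient.eq, h3, hI]
      exact Ideal.mul_mem_right _ _ (Ideal.mem_span_singleton_self _)

/-! ### Complete residual perfections -/

section CRP

variable (p : ℕ) {A : Type u} [CommRing A] [IsLocalRing A]

/-- The ideal `𝔭_B = 𝔭_A B` of an `A`-algebra `B`. -/
abbrev pIdeal (A : Type*) [CommRing A] [IsLocalRing A] (B : Type*) [CommRing B] [Algebra A B] :
    Ideal B :=
  (IsLocalRing.maximalIdeal A).map (algebraMap A B)

/-- The reduction `B / 𝔭_B` of an `A`-algebra `B`. -/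
abbrev Red (A : Type*) [CommRing A] [IsLocalRing A] (B : Type*) [CommRing B] [Algebra A B] :
    Type _ :=
  B ⧸ pIdeal A B

/-- The reduction of a map of `A`-algebras. -/
def redMap {B C : Type*} [CommRing B] [Algebra A B] [CommRing C] [Algebra A C] (f : B →ₐ[A] C) :
    Red A B →+* Red A C :=
  Ideal.quotientMap (pIdeal A C) f.toRingHom (by
    rw [← Ideal.map_le_iff_le_comap, Ideal.map_map]
    exact le_of_eq (congrArg (Ideal.map · _) f.comp_algebraMap))

@[simp]
theorem redMap_mk {B C : Type*} [CommRing B] [Algebra A B] [CommRing C] [Algebra A C]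
    (f : B →ₐ[A] C) (b : B) :
    redMap f (Ideal.Quotient.mk (pIdeal A B) b) = Ideal.Quotient.mk (pIdeal A C) (f b) := rfl

/-- The map from the residue field of `A` to the reduction of an `A`-algebra. -/
def resToRed (A : Type*) [CommRing A] [IsLocalRing A] (B : Type*) [CommRing B] [Algebra A B] :
    IsLocalRing.ResidueField A →+* Red A B :=
  Ideal.quotientMap (pIdeal A B) (algebraMap A B) Ideal.le_comap_map

/-- An `A`-algebra `B` is a complete residual perfection of `A` if it is flat over `A`, complete
with respect to `𝔭_A B`, and `B / 𝔭_A B` is perfect. -/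
structure IsCRP (B : CommAlgCat.{u} A) : Prop where
  flat : Module.Flat A B
  complete : IsAdicComplete (pIdeal A B) B
  perfect : IsPerfect p (Red A B)

/-- Being a complete residual perfection, as a property of objects. -/
def isCRP (A : Type u) [CommRing A] [IsLocalRing A] : ObjectProperty (CommAlgCat.{u} A) :=
  fun B => IsCRP p B

/-- The category of complete residual perfections of `A`, a full subcategory of the category of
`A`-algebras. -/
abbrev CRP (A : Type u) [CommRing A] [IsLocalRing A] := (isCRP p A).FullSubcategory

variable {p}

/-- The map of `A`-algebras underlying a morphism of complete residual perfections. -/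
abbrev CRP.toAlgHom {B C : CRP p A} (f : B ⟶ C) : B.obj →ₐ[A] C.obj := f.hom.hom

theorem CRP.p_mem (B : CRP p A) : (p : B.obj) ∈ pIdeal A B.obj := by
  rw [← Ideal.Quotient.eq_zero_iff_mem, map_natCast]
  exact B.property.perfect.1

variable [Fact p.Prime]

theorem CRP.existsUnique_section (B : CRP p A) :
    ∃! s : Red A B.obj →* B.obj, ∀ x, Ideal.Quotient.mk (pIdeal A B.obj) (s x) = x :=
  have := B.property.complete
  existsUnique_multSection (pIdeal A B.obj) B.property.perfect

/-- The unique multiplicative section `s_B` of the reduction map `B → B / 𝔭_B`. -/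
def CRP.sec (B : CRP p A) : Red A B.obj →* B.obj := B.existsUnique_section.choose

theorem CRP.mk_sec (B : CRP p A) (x : Red A B.obj) :
    Ideal.Quotient.mk (pIdeal A B.obj) (B.sec x) = x :=
  B.existsUnique_section.choose_spec.1 x

theorem CRP.map_sec {B C : CRP p A} (f : B ⟶ C) (x : Red A B.obj) :
    toAlgHom f (B.sec x) = C.sec (redMap (toAlgHom f) x) := by
  have := C.property.complete
  refine DFunLike.congr_fun (multiplicative_ext C.p_mem B.property.perfect
    (s := ((toAlgHom f : B.obj →* C.obj)).comp B.sec)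
    (s' := C.sec.comp (redMap (toAlgHom f) : Red A B.obj →* Red A C.obj)) fun y => ?_) x
  rw [← Ideal.Quotient.eq_zero_iff_mem, map_sub, sub_eq_zero]
  change Ideal.Quotient.mk _ (toAlgHom f (B.sec y)) =
    Ideal.Quotient.mk _ (C.sec (redMap (toAlgHom f) y))
  rw [C.mk_sec, ← redMap_mk, B.mk_sec]

end CRP

section Coeffs

variable {p : ℕ} [Fact p.Prime] {A : Type u} [CommRing A] [IsDomain A]
  [IsDiscreteValuationRing A] {π : A}

theorem pIdeal_eq_span (hπ : Irreducible π) (B : Type*) [CommRing B] [Algebra A B] :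
    pIdeal A B = Ideal.span {algebraMap A B π} := by
  rw [pIdeal, hπ.maximalIdeal_eq, Ideal.map_span, Set.image_singleton]

theorem CRP.existsUnique_coeff (B : CRP p A) (hπ : Irreducible π) (x : B.obj) :
    ∃! c : ℕ → Red A B.obj,
      IsAdicSum (pIdeal A B.obj) (algebraMap A B.obj π) (fun i => B.sec (c i)) x := by
  refine existsUnique_coeffs (pIdeal_eq_span hπ _) (fun a b hab => ?_) B.mk_sec x
  have := B.property.flat
  have h : IsSMulRegular B.obj π :=
    Module.Flat.isSMulRegular_of_isRegular (IsRegular.of_ne_zero hπ.ne_zero)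
  exact h (by simpa [Algebra.smul_def] using hab)

/-- The coefficients of `x ∈ B` with respect to the uniformizer `π`: the unique sequence `(xᵢ)` in
`B / 𝔭_B` such that `x = ∑ s_B(xᵢ) π ^ i`. -/
def CRP.coeff (B : CRP p A) (hπ : Irreducible π) (x : B.obj) : ℕ → Red A B.obj :=
  (B.existsUnique_coeff hπ x).choose

theorem CRP.isAdicSum_coeff (B : CRP p A) (hπ : Irreducible π) (x : B.obj) :
    IsAdicSum (pIdeal A B.obj) (algebraMap A B.obj π) (fun i => B.sec (B.coeff hπ x i)) x :=
  (B.existsUnique_coeff hπ x).choose_spec.1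

theorem CRP.redMap_coeff {B C : CRP p A} (f : B ⟶ C) (hπ : Irreducible π) (x : B.obj) (i : ℕ) :
    redMap (toAlgHom f) (B.coeff hπ x i) = C.coeff hπ (toAlgHom f x) i := by
  have h : IsAdicSum (pIdeal A C.obj) (algebraMap A C.obj π)
      (fun i => C.sec (redMap (toAlgHom f) (B.coeff hπ x i))) (toAlgHom f x) := by
    intro n
    have h1 := Ideal.mem_map_of_mem (toAlgHom f).toRingHom (B.isAdicSum_coeff hπ x n)
    rw [Ideal.map_pow, Ideal.map_map] at h1
    have h2 : (toAlgHom f).toRingHom.comp (algebraMap A B.obj) = algebraMap A C.obj :=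
      (toAlgHom f).comp_algebraMap
    rw [h2] at h1
    simpa [CRP.map_sec] using h1
  exact congrFun ((C.existsUnique_coeff hπ _).unique h (C.isAdicSum_coeff hπ _)) i

end Coeffs

/-! ### The ring `R_T^pf` and the functor `U` -/

section Explicit

variable (p : ℕ) [Fact p.Prime] {A : Type u} [CommRing A] [IsDomain A]
  [IsDiscreteValuationRing A] [CharP (IsLocalRing.ResidueField A) p]

/-- The polynomial ring over the residue field of `A` in the variables `u_{t,j}`, for `t ∈ T` and
`j > 0`. -/
abbrev RT (T : Set A) : Type u := MvPolynomial (T × ℕ+) (IsLocalRing.ResidueField A)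

/-- The perfection of `R_T`. -/
abbrev RTpf (T : Set A) : Type u := PerfectClosure (RT T) p

/-- The inclusion of the residue field of `A` in `R_T^pf`. -/
def resToRTpf (T : Set A) : IsLocalRing.ResidueField A →+* RTpf p T :=
  (PerfectClosure.of (RT T) p).comp MvPolynomial.C

/-- The elements `t̄, u_{t,1}, u_{t,2}, …` of `R_T^pf`. -/
def uCoeff (T : Set A) (t : T) (j : ℕ) : RTpf p T :=
  if hj : 0 < j then PerfectClosure.of (RT T) p (MvPolynomial.X (t, ⟨j, hj⟩))
  else resToRTpf p T (IsLocalRing.residue A t)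

/-- `R_T^pf` as a perfect algebra over itself. -/
def RTpfObj (T : Set A) : PAlg p (RTpf p T) :=
  ⟨CommAlgCat.of (RTpf p T) (RTpf p T), isPerfect_perfectClosure p (RT T)⟩

/-- The fraction field of `R_T^pf` as a perfect `R_T^pf`-algebra. -/
def FrRTpfObj (T : Set A) : PAlg p (RTpf p T) :=
  ⟨CommAlgCat.of (RTpf p T) (FractionRing (RTpf p T)),
    isPerfect_fractionRing p (isPerfect_perfectClosure p (RT T))⟩

variable {p} {π : A}

/-- The map `R_T^pf → B / 𝔭_B` that on the residue field of `A` is the canonical one and sends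
`u_{t,j}` to the `j`-th coefficient of the image of `t` in `B`. -/
def CRP.structureMap (hπ : Irreducible π) (T : Set A) (B : CRP p A) :
    RTpf p T →+* Red A B.obj :=
  perfectLift p B.property.perfect
    (MvPolynomial.eval₂Hom (resToRed A B.obj)
      (fun tj : T × ℕ+ => B.coeff hπ (algebraMap A B.obj tj.1) tj.2))

theorem CRP.redMap_comp_structureMap (hπ : Irreducible π) (T : Set A) {B C : CRP p A}
    (f : B ⟶ C) :
    (redMap (toAlgHom f)).comp (B.structureMap hπ T) = C.structureMap hπ T := by
  refine perfectClosure_hom_ext p C.property.perfect ?_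
  rw [RingHom.comp_assoc, structureMap, structureMap, perfectLift_comp_of, perfectLift_comp_of]
  refine MvPolynomial.ringHom_ext (fun r => ?_) (fun tj => ?_)
  · obtain ⟨a, rfl⟩ := IsLocalRing.residue_surjective r
    simp only [RingHom.comp_apply, MvPolynomial.coe_eval₂Hom, MvPolynomial.eval₂_C]
    exact congrArg (Ideal.Quotient.mk (pIdeal A C.obj)) ((toAlgHom f).commutes a)
  · simp [CRP.redMap_coeff]

/-- The functor `U`: it sends `B` to `B / 𝔭_B` with the above structure of an `R_T^pf`-algebra. -/
def U (hπ : Irreducible π) (T : Set A) : CRP p A ⥤ PAlg p (RTpf p T) where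
  obj B := ⟨algOfRingHom (B.structureMap hπ T), B.property.perfect⟩
  map f := ObjectProperty.homMk
    (algHomOfRingHom (redMap (CRP.toAlgHom f)) (CRP.redMap_comp_structureMap hπ T f))
  map_id B := ObjectProperty.hom_ext _ (CommAlgCat.hom_ext (AlgHom.ext fun x => by
    obtain ⟨x, rfl⟩ := Ideal.Quotient.mk_surjective x
    rfl))
  map_comp f g := ObjectProperty.hom_ext _ (CommAlgCat.hom_ext (AlgHom.ext fun x => by
    obtain ⟨x, rfl⟩ := Ideal.Quotient.mk_surjective x
    rfl))

/-- The identification of the ring underlying `U(B)` with `B / 𝔭_B`. -/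
def U.toRed (hπ : Irreducible π) (T : Set A) (B : CRP p A) :
    ((U hπ T).obj B).obj ≃+* Red A B.obj :=
  RingEquiv.refl (Red A B.obj)

/-! ### The functor `V` in equal characteristic -/

variable (p)

/-- The conditions on the structure map `A → S⟦π̃⟧` in equal characteristic: it sends `π` to `π̃`,
it reduces modulo `π̃` to the given map from the residue field of `A` to `S`, and it sends every
`t ∈ T` to `t̄ + ∑ u_{t,j} π̃ ^ j`. -/
structure IsEqualMap (π : A) (T : Set A) (S : Type u) [CommRing S] [Algebra (RTpf p T) S]
    (φ : A →+* PowerSeries S) : Prop where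
  map_uniformizer : φ π = PowerSeries.X
  reduction : ∀ a : A, PowerSeries.constantCoeff (φ a) =
    algebraMap (RTpf p T) S (resToRTpf p T (IsLocalRing.residue A a))
  map_lift : ∀ t : T, φ t = PowerSeries.mk fun j => algebraMap (RTpf p T) S (uCoeff p T t j)

/-- There is exactly one such map for every perfect `R_T^pf`-algebra. -/
def EqualMapsExistUnique (π : A) (T : Set A) : Prop :=
  ∀ S : PAlg p (RTpf p T), ∃! φ : A →+* PowerSeries S.obj, IsEqualMap p π T S.obj φ

variable {p}

theorem IsEqualMap.map {T : Set A} {S S' : Type u} [CommRing S] [Algebra (RTpf p T) S]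
    [CommRing S'] [Algebra (RTpf p T) S'] {φ : A →+* PowerSeries S}
    (h : IsEqualMap p π T S φ) (f : S →ₐ[RTpf p T] S') :
    IsEqualMap p π T S' ((PowerSeries.map f.toRingHom).comp φ) where
  map_uniformizer := by simp [h.map_uniformizer]
  reduction a := by
    have := congrArg f (h.reduction a)
    rw [f.commutes] at this
    rw [← this, RingHom.comp_apply, ← PowerSeries.coeff_zero_eq_constantCoeff_apply,
      PowerSeries.coeff_map, PowerSeries.coeff_zero_eq_constantCoeff_apply]
    rfl
  map_lift t := by
    ext j
    simp [h.map_lift]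

/-- The structure map `A → S⟦π̃⟧`. -/
def equalMap {T : Set A} (h : EqualMapsExistUnique p π T) (S : PAlg p (RTpf p T)) :
    A →+* PowerSeries S.obj := (h S).choose

theorem map_comp_equalMap {T : Set A} (h : EqualMapsExistUnique p π T) {S S' : PAlg p (RTpf p T)}
    (f : S ⟶ S') :
    (PowerSeries.map f.hom.hom.toRingHom).comp (equalMap h S) = equalMap h S' :=
  (h S').unique ((h S).choose_spec.1.map f.hom.hom) (h S').choose_spec.1

/-- The functor `V` in equal characteristic, with values in the category of `A`-algebras:
`V(S) = S⟦π̃⟧` with the above structure map. -/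
def VEqual {T : Set A} (h : EqualMapsExistUnique p π T) :
    PAlg p (RTpf p T) ⥤ CommAlgCat.{u} A where
  obj S := algOfRingHom (equalMap h S)
  map f := algHomOfRingHom (PowerSeries.map f.hom.hom.toRingHom) (map_comp_equalMap h f)
  map_id S := CommAlgCat.hom_ext (AlgHom.ext fun x =>
    PowerSeries.ext (R := S.obj) fun n => PowerSeries.coeff_map _ n _)
  map_comp {S S' S''} f g := CommAlgCat.hom_ext (AlgHom.ext fun x =>
    PowerSeries.ext (R := S''.obj) fun n => by
      refine (PowerSeries.coeff_map _ n _).trans (Eq.symm ?_)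
      refine (PowerSeries.coeff_map _ n _).trans ?_
      exact congrArg g.hom.hom (PowerSeries.coeff_map _ n _))

/-- The identification of `S⟦π̃⟧` with `V(S)` in equal characteristic. -/
def VEqual.ofSeries {T : Set A} (h : EqualMapsExistUnique p π T) (S : PAlg p (RTpf p T)) :
    PowerSeries S.obj ≃+* (VEqual h).obj S :=
  RingEquiv.refl (PowerSeries S.obj)

/-! ### The functor `V` in mixed characteristic -/

variable (p)

/-- The Cohen subring of `A` determined by `T`: a subring of `A` that contains `T`, is a complete
discrete valuation ring with maximal ideal generated by `p`, and has the same residue field as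
`A`. -/
structure IsCohenSubring (T : Set A) (C : Subring A) : Prop where
  subset : T ⊆ C
  [isDVR : IsDiscreteValuationRing C]
  maximalIdeal_eq : IsLocalRing.maximalIdeal C = Ideal.span {(p : C)}
  complete : IsAdicComplete (IsLocalRing.maximalIdeal C) C
  residue_surjective : ∀ x : IsLocalRing.ResidueField A, ∃ c : C, IsLocalRing.residue A c = x

/-- The map `C[X] → A` that is the inclusion on `C` and sends `X` to `π`. -/
def polyToA (π : A) (C : Subring A) : Polynomial C →+* A :=
  Polynomial.eval₂RingHom C.subtype π

/-- The conditions on the map `C[X] → W(S)⟦π̃⟧` in mixed characteristic: it sends `X` to `π̃`, it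
reduces modulo `(p, π̃)` to the given map from the residue field of `A` to `S`, and it sends every
`t ∈ T` to `s_W(t̄) + ∑ s_W(u_{t,j}) π̃ ^ j`, where `s_W` is the Teichmüller map. -/
structure IsMixedMap {T : Set A} {C : Subring A} (hC : IsCohenSubring p T C) (S : Type u)
    [CommRing S] [Algebra (RTpf p T) S] (χ : Polynomial C →+* PowerSeries (WittVector p S)) :
    Prop where
  map_X : χ Polynomial.X = PowerSeries.X
  reduction : ∀ c : C,
    WittVector.constantCoeff (PowerSeries.constantCoeff (χ (Polynomial.C c))) =
      algebraMap (RTpf p T) S (resToRTpf p T (IsLocalRing.residue A c))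
  map_lift : ∀ t : T, χ (Polynomial.C ⟨t, hC.subset t.2⟩) =
    PowerSeries.mk fun j => WittVector.teichmuller p (algebraMap (RTpf p T) S (uCoeff p T t j))

variable {p}

/-- There is exactly one such map for every perfect `R_T^pf`-algebra. -/
def MixedMapsExistUnique {T : Set A} {C : Subring A} (hC : IsCohenSubring p T C) : Prop :=
  ∀ S : PAlg p (RTpf p T), ∃! χ : Polynomial C →+* PowerSeries (WittVector p S.obj),
    IsMixedMap p hC S.obj χ

theorem IsMixedMap.map {T : Set A} {C : Subring A} {hC : IsCohenSubring p T C} {S S' : Type u}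
    [CommRing S] [Algebra (RTpf p T) S] [CommRing S'] [Algebra (RTpf p T) S']
    {χ : Polynomial C →+* PowerSeries (WittVector p S)} (h : IsMixedMap p hC S χ)
    (f : S →ₐ[RTpf p T] S') :
    IsMixedMap p hC S' ((PowerSeries.map (WittVector.map f.toRingHom)).comp χ) where
  map_X := by simp [h.map_X]
  reduction c := by
    have := congrArg f (h.reduction c)
    rw [f.commutes] at this
    rw [← this, RingHom.comp_apply, ← PowerSeries.coeff_zero_eq_constantCoeff_apply,
      PowerSeries.coeff_map, PowerSeries.coeff_zero_eq_constantCoeff_apply]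
    exact WittVector.map_coeff _ _ _
  map_lift t := by
    ext1 j
    rw [RingHom.comp_apply, h.map_lift, PowerSeries.coeff_map, PowerSeries.coeff_mk,
      PowerSeries.coeff_mk, WittVector.map_teichmuller]
    exact congrArg _ (f.commutes _)

/-- The map `C[X] → W(S)⟦π̃⟧`. -/
def mixedMap {T : Set A} {C : Subring A} {hC : IsCohenSubring p T C}
    (h : MixedMapsExistUnique hC) (S : PAlg p (RTpf p T)) :
    Polynomial C →+* PowerSeries (WittVector p S.obj) := (h S).choose

theorem map_comp_mixedMap {T : Set A} {C : Subring A} {hC : IsCohenSubring p T C}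
    (h : MixedMapsExistUnique hC) {S S' : PAlg p (RTpf p T)} (f : S ⟶ S') :
    (PowerSeries.map (WittVector.map f.hom.hom.toRingHom)).comp (mixedMap h S) = mixedMap h S' :=
  (h S').unique ((h S).choose_spec.1.map f.hom.hom) (h S').choose_spec.1

/-- The functor `V` in mixed characteristic, with values in the category of `A`-algebras:
`V(S) = A ⊗_{C[X]} W(S)⟦π̃⟧`, where `A` is a `C[X]`-algebra via `X ↦ π`. -/
def VMixed (π : A) {T : Set A} {C : Subring A} {hC : IsCohenSubring p T C}
    (h : MixedMapsExistUnique hC) : PAlg p (RTpf p T) ⥤ CommAlgCat.{u} A where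
  obj S := CommAlgCat.of A (TensorRing (polyToA π C) (mixedMap h S))
  map f := CommAlgCat.ofHom (TensorRing.map (polyToA π C)
    (PowerSeries.map (WittVector.map f.hom.hom.toRingHom)) (map_comp_mixedMap h f))
  map_id S := CommAlgCat.hom_ext (TensorRing.algHom_ext fun x => by
    refine (TensorRing.map_inr _ _ (map_comp_mixedMap h (𝟙 S)) x).trans ?_
    refine congrArg (TensorRing.inr _ _) (PowerSeries.ext fun n => ?_)
    refine (PowerSeries.coeff_map _ n _).trans (WittVector.ext fun m => ?_)
    exact WittVector.map_coeff _ _ _)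
  map_comp f g := CommAlgCat.hom_ext (TensorRing.algHom_ext fun x => by
    refine (TensorRing.map_inr _ _ (map_comp_mixedMap h (f ≫ g)) x).trans (Eq.symm ?_)
    refine (congrArg (TensorRing.map _ _ (map_comp_mixedMap h g))
      (TensorRing.map_inr _ _ (map_comp_mixedMap h f) x)).trans ?_
    refine (TensorRing.map_inr _ _ (map_comp_mixedMap h g) _).trans ?_
    refine congrArg (TensorRing.inr _ _) (PowerSeries.ext fun n => ?_)
    simp only [PowerSeries.coeff_map]
    refine WittVector.ext fun m => ?_
    simp only [WittVector.map_coeff]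
    rfl)

/-- The map `W(S)⟦π̃⟧ → V(S) = A ⊗_{C[X]} W(S)⟦π̃⟧`, `f ↦ 1 ⊗ f`, in mixed characteristic. -/
def VMixed.ofSeries (π : A) {T : Set A} {C : Subring A} {hC : IsCohenSubring p T C}
    (h : MixedMapsExistUnique hC) (S : PAlg p (RTpf p T)) :
    PowerSeries (WittVector p S.obj) →+* (VMixed π h).obj S :=
  TensorRing.inr (polyToA π C) (mixedMap h S)

/-- `θ : W(B / 𝔭_B) → B` reduces to the identity of `B / 𝔭_B`. -/
def IsWittLift (B : CRP p A) (θ : WittVector p (Red A B.obj) →+* B.obj) : Prop :=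
  ∀ w, Ideal.Quotient.mk (pIdeal A B.obj) (θ w) = WittVector.constantCoeff w

/-! ### Universal and generic residual perfections -/

/-- Let `Au` be an initial object of the category of complete residual perfections of `A`. An
object `Ag` is a generic residual perfection if the reduction of `Au` is a domain and the reduction
of the unique morphism `Au → Ag` makes the reduction of `Ag` a fraction field of that of `Au`. -/
def IsGenericPerfection {Au : CRP p A} (hAu : Limits.IsInitial Au) (Ag : CRP p A) : Prop :=
  IsDomain (Red A Au.obj) ∧
    @IsFractionRing (Red A Au.obj) _ (Red A Ag.obj) _
      (redMap (CRP.toAlgHom (hAu.to Ag))).toAlgebra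

/-- A functor `V` from perfect `R_T^pf`-algebras to complete residual perfections of `A` describes
the universal and the generic residual perfection: an initial object `Au` (a universal residual
perfection) exists; for every such `Au`, the unique morphism `Au → V(R_T^pf)` is an isomorphism,
`V(Fr(R_T^pf))` is a generic residual perfection, and every generic residual perfection is
isomorphic to it by a unique isomorphism. -/
def DescribesUniversalAndGeneric (T : Set A) (V : PAlg p (RTpf p T) ⥤ CRP p A) : Prop :=
  (∃ Au : CRP p A, Nonempty (Limits.IsInitial Au)) ∧
  ∀ (Au : CRP p A) (hAu : Limits.IsInitial Au),
    IsIso (hAu.to (V.obj (RTpfObj p T))) ∧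
    IsGenericPerfection hAu (V.obj (FrRTpfObj p T)) ∧
    ∀ Ag : CRP p A, IsGenericPerfection hAu Ag →
      Nonempty (Unique (Ag ≅ V.obj (FrRTpfObj p T)))

end Explicit

end

end ResidualPerfection

open ResidualPerfection

/-! ### Lifting ring maps along p-bases -/

namespace ResidualPerfection

noncomputable section

/-! ### Monomials and Frobenius bases -/

/-! Everything rests on one lifting principle. Let `C` be a ring with `C / p = k`, let `t` in `C`
lift a p-basis `b` of `k`, and let `D` be complete for a filtration `J` with `p ∈ J 1`. Suppose that
`p` is regular in `C` or zero in `D`. Then every ring map `k → D / J 1` lifts to a ring map `C → D`,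
and the lift is determined by its values on `t`, which may be any lifts of the images of `b`.

Uniqueness (`ringHom_ext_of_isFrobBasis`) holds because each element of `C` is a combination of
monomials in `t` with p-th powers as coefficients, up to a multiple of `p`, and both p-th powers and
multiplication by `p` sharpen a congruence by one degree. For existence (`exists_ringHom_lift`), the
graph of the lift is cut out of a fibre product of `C` and `D` as the intersection of a decreasing
`tower` of subrings. The key is `exists_eq_p_mul_of_mem_tower`: independence of the reduced
monomials forces an element of the tower with zero residue to be `p` times an element one level
higher, up to filtration.

A perfect ring has the empty p-basis, so the principle also gives the Witt lift `θ` and, in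
characteristic `p`, ring sections of perfect reductions. Over `A` it gives the coefficient field and
the structure maps of `V`; the tower in `A` itself gives the Cohen subring.

The expansions `∑ s_B(x_j) π ^ j` are natural in `B`. Hence a morphism of complete residual
perfections is determined by its reduction, and is invertible if its reduction is bijective. The
adjoint equivalence therefore needs little: `V(S)` is a complete residual perfection, there is a
multiplicative map `S → V(S)` reducing to an isomorphism and giving the expansions of the elements
of `T` (`IsCoefficientSystem`), and there is an `A`-linear map `VU(B) → B` with the right reduction.
Its `A`-linearity is again uniqueness of lifts.

In mixed characteristic `A` is a quotient of `C[X]`, and `V(S)` is `W(S)⟦π̃⟧` modulo a series `ψ`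
whose constant coefficient is `p` times a unit. Since `p` is regular in `W(S)`, `ψ` is regular
modulo `π̃`; this gives flatness, completeness and the reduction `W(S) / p = S`. Finally, the left
adjoint `V` preserves the initial object `R_T^pf`, which yields the universal and the generic
residual perfections. -/

/-- The monomial `∏ (b i) ^ (α i)`. -/
def mono {R ι : Type*} [CommRing R] (b : ι → R) (α : ι →₀ ℕ) : R := α.prod fun i e => b i ^ e

section Mono

variable {R R' ι : Type*} [CommRing R] [CommRing R'] (b : ι → R)

@[simp]
theorem mono_zero : mono b 0 = 1 := Finsupp.prod_zero_index

theorem mono_add (α β : ι →₀ ℕ) : mono b (α + β) = mono b α * mono b β :=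
  Finsupp.prod_add_index' (fun _ => pow_zero _) (fun _ _ _ => pow_add _ _ _)

theorem mono_single (i : ι) : mono b (Finsupp.single i 1) = b i := by
  simp [mono]

theorem map_mono (f : R →+* R') (α : ι →₀ ℕ) : f (mono b α) = mono (fun i => f (b i)) α := by
  simp [mono, Finsupp.prod, map_prod]

theorem mono_nsmul (n : ℕ) (α : ι →₀ ℕ) : mono b (n • α) = mono b α ^ n := by
  induction n with
  | zero => simp
  | succ n ih => rw [succ_nsmul, mono_add, ih, pow_succ]

theorem mono_mem {G : Subring R} (h : ∀ i, b i ∈ G) (α : ι →₀ ℕ) : mono b α ∈ G :=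
  G.prod_mem fun i _ => G.pow_mem (h i) _

end Mono

/-- Multi-exponents with all entries `< p`. -/
abbrev RedExp (p : ℕ) (ι : Type*) := {α : ι →₀ ℕ // ∀ i, α i < p}

/-- The combination `∑ b ^ β c_β ^ p` of the reduced monomials in `b`. -/
def frobSum {p : ℕ} {R ι : Type*} [CommRing R] (b : ι → R) (c : RedExp p ι →₀ R) : R :=
  c.sum fun β y => mono b β.1 * y ^ p

theorem map_frobSum {p : ℕ} (hp : p ≠ 0) {R R' ι : Type*} [CommRing R] [CommRing R']
    (b : ι → R) (f : R →+* R')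
    (c : RedExp p ι →₀ R) :
    f (frobSum b c) = frobSum (fun i => f (b i)) (c.mapRange f (map_zero f)) := by
  rw [frobSum, frobSum, Finsupp.sum_mapRange_index (fun _ => by rw [zero_pow hp, mul_zero]),
    Finsupp.sum, map_sum]
  simp [Finsupp.sum, map_mono]

/-- A family `b` in a ring `k` such that every element of `k` is uniquely a combination of the
reduced monomials in `b` with `p`-th powers as coefficients. -/
structure IsFrobBasis (p : ℕ) {k ι : Type*} [CommRing k] (b : ι → k) : Prop where
  exists_eq : ∀ x, ∃ c : RedExp p ι →₀ k, x = frobSum b c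
  eq_zero : ∀ c : RedExp p ι →₀ k, frobSum b c = 0 → c = 0

/-- Frobenius is injective on a field, so a coefficient in `k ^ p` amounts to its p-th root.
Recording roots instead of powers gives a notion that also makes sense for perfect rings that are
not fields. -/
theorem IsPBasis.isFrobBasis {p : ℕ} {k ι : Type*} [Field k] [ExpChar k p] (hp : p ≠ 0)
    {b : ι → k} (h : IsPBasis p b) : IsFrobBasis p b where
  exists_eq x := by
    have hx : x ∈ Submodule.span (frobenius k p).fieldRange
      (Set.range fun α : {α : ι →₀ ℕ // ∀ i, α i < p} => α.1.prod fun i e => b i ^ e) := by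
      rw [h.span_eq_top]; trivial
    obtain ⟨c, rfl⟩ := Finsupp.mem_span_range_iff_exists_finsupp.1 hx
    choose r hr using fun y : (frobenius k p).fieldRange => y.2
    have h0 : r 0 = 0 := by
      have := hr 0
      rw [frobenius_def] at this
      exact eq_zero_of_pow_eq_zero this
    refine ⟨c.mapRange r h0, ?_⟩
    rw [frobSum, Finsupp.sum_mapRange_index (fun _ => by rw [zero_pow hp, mul_zero])]
    refine Finsupp.sum_congr fun β _ => ?_
    rw [Subfield.smul_def, smul_eq_mul, mul_comm, ← hr (c β), frobenius_def]
    rfl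
  eq_zero c hc := by
    let F : k → (frobenius k p).fieldRange := fun y => ⟨frobenius k p y, y, rfl⟩
    have hF : F 0 = 0 := Subtype.ext (map_zero (frobenius k p))
    have h1 := linearIndependent_iff.1 h.linearIndependent (c.mapRange F hF) (by
      rw [Finsupp.linearCombination_apply, Finsupp.sum_mapRange_index (by simp)]
      refine Eq.trans (Finsupp.sum_congr fun β _ => ?_) hc
      rw [Subfield.smul_def, smul_eq_mul, mul_comm]
      rfl)
    ext β
    have h2 := congrArg Subtype.val (DFunLike.congr_fun h1 β)
    rw [Finsupp.mapRange_apply] at h2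
    exact eq_zero_of_pow_eq_zero h2

/-- The empty family is a Frobenius basis of a perfect ring. -/
theorem IsPerfect.isFrobBasis {p : ℕ} [Fact p.Prime] {S : Type*} [CommRing S] (hS : IsPerfect p S) :
    IsFrobBasis p (PEmpty.elim : PEmpty.{1} → S) where
  exists_eq x := by
    obtain ⟨y, rfl⟩ := hS.2.2 x
    refine ⟨Finsupp.single ⟨0, fun i => i.elim⟩ y, ?_⟩
    rw [frobSum, Finsupp.sum_single_index]
    · simp
    · rw [zero_pow (Fact.out : p.Prime).ne_zero, mul_zero]
  eq_zero c hc := by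
    have hsub : Subsingleton (RedExp p PEmpty.{1}) :=
      ⟨fun a b => Subtype.ext (Subsingleton.elim _ _)⟩
    have hp := (Fact.out : p.Prime).ne_zero
    obtain ⟨β, y, rfl⟩ : ∃ (β : RedExp p PEmpty.{1}) (y : S), c = Finsupp.single β y := by
      refine ⟨⟨0, fun i => i.elim⟩, c ⟨0, fun i => i.elim⟩, ?_⟩
      ext γ
      rw [Subsingleton.elim γ ⟨0, fun i => i.elim⟩, Finsupp.single_eq_same]
    rw [frobSum, Finsupp.sum_single_index (by rw [zero_pow hp, mul_zero])] at hc
    have h1 : β.1 = 0 := Subsingleton.elim _ _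
    rw [h1, mono_zero, one_mul] at hc
    have : y = 0 := hS.2.1 (by simpa [zero_pow hp] using hc)
    rw [this, Finsupp.single_zero]

/-! ### Filtrations -/

/-- A decreasing multiplicative filtration by ideals, with `p` in filtration degree one. -/
structure IsFiltration (p : ℕ) {D : Type*} [CommRing D] (J : ℕ → Ideal D) : Prop where
  anti : Antitone J
  mul_mem : ∀ {m n x y}, x ∈ J m → y ∈ J n → x * y ∈ J (m + n)
  p_mem : (p : D) ∈ J 1

/-- A filtration for which the ring is complete and separated. -/
structure IsCompleteFiltration (p : ℕ) {D : Type*} [CommRing D] (J : ℕ → Ideal D) : Prop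
    extends IsFiltration p J where
  eq_zero : ∀ x, (∀ n, x ∈ J n) → x = 0
  exists_limit : ∀ x : ℕ → D, (∀ n, x (n + 1) - x n ∈ J n) → ∃ L, ∀ n, L - x n ∈ J n

section Filtration

variable {p : ℕ} {D : Type*} [CommRing D] {J : ℕ → Ideal D}

theorem IsFiltration.p_mul_mem (hJ : IsFiltration p J) {n : ℕ} {x : D} (hx : x ∈ J n) :
    (p : D) * x ∈ J (n + 1) := by
  rw [add_comm]; exact hJ.mul_mem hJ.p_mem hx

theorem IsFiltration.pow_p_mem [Fact p.Prime] (hJ : IsFiltration p J) {n : ℕ} {x : D}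
    (hx : x ∈ J (n + 1)) : x ^ p ∈ J (n + 2) := by
  obtain ⟨q, hq⟩ := Nat.exists_eq_add_of_le (Fact.out : p.Prime).two_le
  rw [hq, pow_add, sq]
  exact Ideal.mul_mem_right _ _ (hJ.anti (by omega) (hJ.mul_mem hx hx))

/-- The difference is `(x - y) ^ p` plus a multiple of `p * (x - y)`, and both terms gain a degree.
-/
theorem IsFiltration.pow_sub_pow_mem [Fact p.Prime] (hJ : IsFiltration p J) {n : ℕ}
    {x y : D} (h : x - y ∈ J (n + 1)) : x ^ p - y ^ p ∈ J (n + 2) := by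
  obtain ⟨r, hr⟩ := exists_add_pow_prime_eq (Fact.out : p.Prime) y (x - y)
  have e : x ^ p - y ^ p = (x - y) ^ p + p * (x - y) * (y * r) := by
    rw [add_sub_cancel] at hr
    linear_combination hr
  rw [e]
  exact add_mem (hJ.pow_p_mem h) (Ideal.mul_mem_right _ _ (hJ.p_mul_mem h))

/-- The `I`-adic filtration of an `I`-adically complete ring. -/
theorem isCompleteFiltration_pow {I : Ideal D} (hI : IsAdicComplete I D) (hp : (p : D) ∈ I) :
    IsCompleteFiltration p (fun n => I ^ n) where
  anti := fun _ _ h => Ideal.pow_le_pow_right h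
  mul_mem hx hy := by rw [pow_add]; exact Ideal.mul_mem_mul hx hy
  p_mem := by simpa using hp
  eq_zero x h := eq_of_forall_sub_mem I fun n => by simpa using h n
  exists_limit x hx := by
    obtain ⟨L, hL⟩ := IsPrecomplete.prec (I := I) (M := D) inferInstance (f := x) (by
      intro m n hmn
      induction n, hmn using Nat.le_induction with
      | base => rfl
      | succ n hmn ih =>
        refine ih.trans (SModEq.symm (SModEq.sub_mem.2 ?_))
        simpa using Ideal.pow_le_pow_right hmn (hx n))
    refine ⟨L, fun n => ?_⟩
    have := SModEq.sub_mem.1 (hL n).symm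
    simpa using this

/-- A ring whose `I`-adic filtration is complete is `I`-adically complete. -/
theorem isAdicComplete_of_pow {I : Ideal D} (h : ∀ x, (∀ n, x ∈ I ^ n) → x = 0)
    (h' : ∀ x : ℕ → D, (∀ n, x (n + 1) - x n ∈ I ^ n) → ∃ L, ∀ n, L - x n ∈ I ^ n) :
    IsAdicComplete I D where
  haus' x hx := h x fun n => by simpa using SModEq.sub_mem.1 (hx n)
  prec' f hf := by
    obtain ⟨L, hL⟩ := h' f fun n => by
      simpa using SModEq.sub_mem.1 (hf (Nat.le_succ n)).symm
    refine ⟨L, fun n => SModEq.symm (SModEq.sub_mem.2 ?_)⟩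
    simpa using hL n

end Filtration

/-! ### The tower of subrings cut out by a lift of a Frobenius basis -/

section Tower

variable (p : ℕ) {E ι : Type*} [CommRing E] (J : ℕ → Ideal E) (τ : ι → E)

/-- The subrings `E = G₀ ⊇ G₁ ⊇ …` where `Gₙ₊₁` is generated by the monomials in `τ`, the `p`-th
powers of elements of `Gₙ`, and `p Gₙ`, up to filtration degree `n + 2`. -/
def tower : ℕ → Subring E
  | 0 => ⊤
  | n + 1 => Subring.closure {x | ∃ α, ∃ g ∈ tower n, ∃ h ∈ tower n,
      x - mono τ α * (g ^ p + p * h) ∈ J (n + 2)}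

variable {p J τ}

theorem tower_zero (x : E) : x ∈ tower p J τ 0 := Subring.mem_top x

theorem mem_tower_succ {n : ℕ} {x g h : E} (α : ι →₀ ℕ) (hg : g ∈ tower p J τ n)
    (hh : h ∈ tower p J τ n) (hx : x - mono τ α * (g ^ p + p * h) ∈ J (n + 2)) :
    x ∈ tower p J τ (n + 1) :=
  Subring.subset_closure ⟨α, g, hg, h, hh, hx⟩

variable [Fact p.Prime]

/-- Modulo `J (n + 2)` the generators are closed under multiplication, since `(g ^ p + p h)(g' ^ p +
p h')` is `(g g') ^ p` plus `p` times an element of the same subring. The subring is therefore the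
additive span of the generators, and products need no separate treatment. -/
theorem tower_succ_induction {n : ℕ} {P : E → Prop}
    (gen : ∀ α, ∀ g ∈ tower p J τ n, ∀ h ∈ tower p J τ n, ∀ x,
      x - mono τ α * (g ^ p + p * h) ∈ J (n + 2) → P x)
    (hadd : ∀ x y, P x → P y → P (x + y)) (hneg : ∀ x, P x → P (-x)) {x : E}
    (hx : x ∈ tower p J τ (n + 1)) : P x := by
  have hp := (Fact.out : p.Prime).ne_zero
  let M : Submonoid E :=
    { carrier := {x | ∃ α, ∃ g ∈ tower p J τ n, ∃ h ∈ tower p J τ n,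
        x - mono τ α * (g ^ p + p * h) ∈ J (n + 2)}
      one_mem' := ⟨0, 1, one_mem _, 0, zero_mem _, by simp⟩
      mul_mem' := by
        rintro x y ⟨α, g, hg, h, hh, hx⟩ ⟨β, g', hg', h', hh', hy⟩
        refine ⟨α + β, g * g', mul_mem hg hg', g ^ p * h' + h * g' ^ p + p * h * h',
          add_mem (add_mem (mul_mem (pow_mem hg _) hh') (mul_mem hh (pow_mem hg' _)))
            (mul_mem (mul_mem (natCast_mem _ _) hh) hh'), ?_⟩
        have e : x * y - mono τ (α + β) * ((g * g') ^ p +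
            p * (g ^ p * h' + h * g' ^ p + p * h * h')) =
            y * (x - mono τ α * (g ^ p + p * h)) +
            (mono τ α * (g ^ p + p * h)) * (y - mono τ β * (g' ^ p + p * h')) := by
          rw [mono_add]; ring
        rw [e]
        exact add_mem (Ideal.mul_mem_left _ _ hx) (Ideal.mul_mem_left _ _ hy) }
  have hx' : x ∈ Subring.closure (M : Set E) := hx
  rw [Subring.mem_closure_iff, Submonoid.closure_eq] at hx'
  clear hx
  induction hx' using AddSubgroup.closure_induction with
  | mem x hx => obtain ⟨α, g, hg, h, hh, hx⟩ := hx; exact gen α g hg h hh x hx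
  | zero => exact gen 0 0 (zero_mem _) 0 (zero_mem _) 0 (by simp [zero_pow hp])
  | add x y _ _ h1 h2 => exact hadd x y h1 h2
  | neg x _ h1 => exact hneg x h1

/-- The tolerance built into the generators makes each subring open (take `g = h = 0`), hence
closed. This is what allows passing to limits in the intersection of the tower. -/
theorem mem_tower_of_mem {n : ℕ} {x : E} (hx : x ∈ J (n + 1)) : x ∈ tower p J τ n := by
  have hp := (Fact.out : p.Prime).ne_zero
  cases n with
  | zero => exact tower_zero x
  | succ n => exact mem_tower_succ 0 (zero_mem _) (zero_mem _) (by simpa [zero_pow hp] using hx)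

theorem p_mul_mem_tower {n : ℕ} {x : E} (hx : x ∈ tower p J τ n) :
    (p : E) * x ∈ tower p J τ (n + 1) := by
  have hp := (Fact.out : p.Prime).ne_zero
  exact mem_tower_succ 0 (zero_mem _) hx (by simp [zero_pow hp])

theorem pow_mem_tower {n : ℕ} {x : E} (hx : x ∈ tower p J τ n) :
    x ^ p ∈ tower p J τ (n + 1) :=
  mem_tower_succ 0 hx (zero_mem _) (by simp)

theorem pow_pow_mem_tower (x : E) (n : ℕ) : x ^ p ^ n ∈ tower p J τ n := by
  induction n with
  | zero => exact tower_zero _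
  | succ n ih => rw [pow_succ, pow_mul]; exact pow_mem_tower ih

theorem lift_mem_tower (n : ℕ) (i : ι) : τ i ∈ tower p J τ n := by
  cases n with
  | zero => exact tower_zero _
  | succ n =>
    exact mem_tower_succ (Finsupp.single i 1) (one_mem _) (zero_mem _) (by simp [mono_single])

theorem tower_succ_le (hJ : IsFiltration p J) (n : ℕ) :
    tower p J τ (n + 1) ≤ tower p J τ n := by
  induction n with
  | zero => exact fun x _ => tower_zero x
  | succ n ih =>
    refine Subring.closure_le.2 ?_
    rintro x ⟨α, g, hg, h, hh, hx⟩
    exact mem_tower_succ α (ih hg) (ih hh) (hJ.anti (by omega) hx)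

theorem tower_antitone (hJ : IsFiltration p J) : Antitone (tower p J τ) :=
  antitone_nat_of_succ_le (tower_succ_le hJ)

theorem exists_add_pow_eq_of_mem (G : Subring E) {x y : E} (hx : x ∈ G) (hy : y ∈ G) :
    ∃ r ∈ G, (x + y) ^ p = x ^ p + y ^ p + p * r := by
  obtain ⟨r, hr⟩ := exists_add_pow_prime_eq (Fact.out : p.Prime) (⟨x, hx⟩ : G) ⟨y, hy⟩
  refine ⟨x * y * r, mul_mem (mul_mem hx hy) r.2, ?_⟩
  have := congrArg Subtype.val hr
  push_cast at this
  rw [this]; ring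

/-- The p-th power is additive up to `p` times a polynomial in the entries, so these combinations
are closed under addition once a term `p * r` is allowed. -/
theorem exists_frobSum_add {G : Subring E} (hτ : ∀ i, τ i ∈ G) (c c' : RedExp p ι →₀ E)
    (hc : ∀ β, c β ∈ G) (hc' : ∀ β, c' β ∈ G) :
    ∃ r ∈ G, frobSum τ (c + c') = frobSum τ c + frobSum τ c' + p * r := by
  classical
  have hp := (Fact.out : p.Prime).ne_zero
  choose r hr hr' using fun β => exists_add_pow_eq_of_mem (p := p) G (hc β) (hc' β)
  have hz : ∀ β ∈ c.support ∪ c'.support, mono τ β.1 * (0 : E) ^ p = 0 := fun _ _ => by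
    rw [zero_pow hp, mul_zero]
  refine ⟨∑ β ∈ c.support ∪ c'.support, mono τ β.1 * r β,
    sum_mem fun β _ => mul_mem (mono_mem τ hτ _) (hr β), ?_⟩
  rw [frobSum, frobSum, frobSum, Finsupp.sum_of_support_subset _ Finsupp.support_add _ hz,
    Finsupp.sum_of_support_subset c Finset.subset_union_left _ hz,
    Finsupp.sum_of_support_subset c' Finset.subset_union_right _ hz, Finset.mul_sum,
    ← Finset.sum_add_distrib, ← Finset.sum_add_distrib]
  refine Finset.sum_congr rfl fun β _ => ?_
  rw [Finsupp.add_apply, hr' β]; ring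

/-- Dividing exponents by `p` with remainder turns any monomial into a reduced one times a p-th
power, and the failure of additivity goes into `p * h`. The result is a normal form to which
independence of the reduced monomials applies. -/
theorem exists_frobSum_of_mem_tower {n : ℕ} {x : E}
    (hx : x ∈ tower p J τ (n + 1)) :
    ∃ c : RedExp p ι →₀ E, (∀ β, c β ∈ tower p J τ n) ∧ ∃ h ∈ tower p J τ n,
      x - (frobSum τ c + p * h) ∈ J (n + 2) := by
  have hp := (Fact.out : p.Prime)
  refine tower_succ_induction (P := fun x => ∃ c : RedExp p ι →₀ E,
    (∀ β, c β ∈ tower p J τ n) ∧ ∃ h ∈ tower p J τ n, x - (frobSum τ c + p * h) ∈ J (n + 2))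
    ?_ ?_ ?_ hx
  · intro α g hg h hh x hx
    let β : RedExp p ι := ⟨α.mapRange (· % p) (Nat.zero_mod p), fun i => by
      rw [Finsupp.mapRange_apply]; exact Nat.mod_lt _ hp.pos⟩
    let γ : ι →₀ ℕ := α.mapRange (· / p) (Nat.zero_div p)
    have hα : α = β.1 + p • γ := by
      ext i
      simp [β, γ, Nat.mod_add_div]
    have hm : ∀ δ, mono τ δ ∈ tower p J τ n := mono_mem τ (lift_mem_tower n)
    refine ⟨Finsupp.single β (mono τ γ * g), fun δ => ?_, mono τ α * h, mul_mem (hm _) hh, ?_⟩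
    · classical
      rw [Finsupp.single_apply]
      split_ifs
      · exact mul_mem (hm _) hg
      · exact zero_mem _
    · rw [frobSum, Finsupp.sum_single_index (by rw [zero_pow hp.ne_zero, mul_zero])]
      convert hx using 1
      conv_rhs => rw [mul_add, hα, mono_add, mono_nsmul, ← mono_nsmul, ← mono_add, ← hα]
      nth_rewrite 2 [hα]
      rw [mono_add, mono_nsmul]
      ring
  · rintro x y hx hy
    obtain ⟨c, hc, h, hh, hx⟩ := hx
    obtain ⟨c', hc', h', hh', hy⟩ := hy
    obtain ⟨r, hr, hr'⟩ := exists_frobSum_add (lift_mem_tower n) c c' hc hc'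
    refine ⟨c + c', fun β => add_mem (hc β) (hc' β), h + h' - r,
      sub_mem (add_mem hh hh') hr, ?_⟩
    convert add_mem hx hy using 1
    rw [hr']; ring
  · rintro x hx
    obtain ⟨c, hc, h, hh, hx⟩ := hx
    -- For `p = 2` the sign does not pass through the p-th power, so negation is deduced from
    -- additivity applied to `c + (-c) = 0`.
    obtain ⟨r, hr, hr'⟩ := exists_frobSum_add (lift_mem_tower n) c (-c) hc
      (fun β => neg_mem (hc β))
    refine ⟨-c, fun β => neg_mem (hc β), r - h, sub_mem hr hh, ?_⟩
    rw [add_neg_cancel] at hr'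
    have h0 : frobSum τ (0 : RedExp p ι →₀ E) = 0 := Finsupp.sum_zero_index
    convert neg_mem hx using 1
    linear_combination hr' - h0

variable {k : Type*} [CommRing k] {ρ : E →+* k} {b : ι → k}

theorem exists_mem_tower_one (hρ : Function.Surjective ρ) (hker : ∀ x, ρ x = 0 → x ∈ J 1)
    (hb : IsFrobBasis p b) (hτ : ∀ i, ρ (τ i) = b i) (x : E) :
    ∃ y ∈ tower p J τ 1, x - y ∈ J 1 := by
  obtain ⟨c, hc⟩ := hb.exists_eq (ρ x)
  choose s hs using hρ
  refine ⟨∑ β ∈ c.support, mono τ β.1 * s (c β) ^ p, sum_mem fun β _ =>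
    mul_mem (mono_mem τ (lift_mem_tower 1) _) (pow_mem_tower (tower_zero _)), hker _ ?_⟩
  rw [map_sub, hc, map_sum, frobSum, Finsupp.sum, sub_eq_zero]
  refine Finset.sum_congr rfl fun β _ => ?_
  simp [map_mono, hs, hτ]

/-- Replacing `g` and `h` in a generator by elements one level further down that agree with them in
some degree changes `g ^ p + p h` only in the next degree. The induction starts from spanning by the
reduced monomials. -/
theorem exists_mem_tower_succ (hJ : IsFiltration p J) (hρ : Function.Surjective ρ)
    (hker : ∀ x, ρ x = 0 → x ∈ J 1) (hb : IsFrobBasis p b) (hτ : ∀ i, ρ (τ i) = b i) {n : ℕ}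
    {x : E} (hx : x ∈ tower p J τ n) : ∃ y ∈ tower p J τ (n + 1), x - y ∈ J (n + 1) := by
  induction n generalizing x with
  | zero => exact exists_mem_tower_one hρ hker hb hτ x
  | succ n ih =>
    refine tower_succ_induction (P := fun x => ∃ y ∈ tower p J τ (n + 2), x - y ∈ J (n + 2))
      ?_ ?_ ?_ hx
    · intro α g hg h hh x hx
      obtain ⟨g', hg', hg⟩ := ih hg
      obtain ⟨h', hh', hh⟩ := ih hh
      refine ⟨mono τ α * (g' ^ p + p * h'), mem_tower_succ α hg' hh' (by simp), ?_⟩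
      have e : x - mono τ α * (g' ^ p + p * h') = (x - mono τ α * (g ^ p + p * h)) +
          mono τ α * ((g ^ p - g' ^ p) + p * (h - h')) := by ring
      rw [e]
      exact add_mem hx (Ideal.mul_mem_left _ _ (add_mem (hJ.pow_sub_pow_mem hg)
        (hJ.p_mul_mem hh)))
    · rintro x y hx hy
      obtain ⟨x', hx', hx⟩ := hx
      obtain ⟨y', hy', hy⟩ := hy
      refine ⟨x' + y', add_mem hx' hy', ?_⟩
      convert add_mem hx hy using 1; ring
    · rintro x hx
      obtain ⟨x', hx', hx⟩ := hx
      refine ⟨-x', neg_mem hx', ?_⟩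
      convert neg_mem hx using 1; ring

theorem exists_mem_tower (hJ : IsFiltration p J) (hρ : Function.Surjective ρ)
    (hker : ∀ x, ρ x = 0 → x ∈ J 1) (hb : IsFrobBasis p b) (hτ : ∀ i, ρ (τ i) = b i) (n : ℕ)
    (x : E) : ∃ y ∈ tower p J τ n, x - y ∈ J 1 := by
  induction n with
  | zero => exact ⟨x, tower_zero x, by simp⟩
  | succ n ih =>
    obtain ⟨y, hy, h⟩ := ih
    obtain ⟨z, hz, h'⟩ := exists_mem_tower_succ hJ hρ hker hb hτ hy
    refine ⟨z, hz, ?_⟩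
    convert add_mem h (hJ.anti (by omega) h') using 1; ring

/-- In the normal form `∑ τ ^ β c_β ^ p + p h`, zero residue forces every `c_β` to have zero
residue. By induction `c_β` is then `p` times an element of the tower up to filtration, so `c_β ^ p`
is divisible by `p` within the tower, up to one degree more. -/
theorem exists_eq_p_mul_of_mem_tower (hJ : IsFiltration p J) 
    (hker : ∀ x, ρ x = 0 ↔ x ∈ J 1) (hb : IsFrobBasis p b) (hτ : ∀ i, ρ (τ i) = b i) {n : ℕ}
    {x : E} (hx : x ∈ tower p J τ (n + 1)) (h0 : ρ x = 0) :
    ∃ h ∈ tower p J τ n, x - p * h ∈ J (n + 2) := by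
  have hp := (Fact.out : p.Prime)
  have key : ∀ y ∈ tower p J τ n, ρ y = 0 → ∃ g ∈ tower p J τ n, y ^ p - p * g ∈ J (n + 2) := by
    intro y hy hy0
    cases n with
    | zero => exact ⟨0, zero_mem _, by simpa using hJ.pow_p_mem ((hker y).1 hy0)⟩
    | succ n =>
      obtain ⟨h, hh, hyh⟩ := exists_eq_p_mul_of_mem_tower hJ hker hb hτ hy hy0
      obtain ⟨r, hr⟩ := Nat.exists_eq_add_of_le hp.two_le
      -- `p ^ p` has at least two factors `p`: one is the factor to be extracted, the other moves
      -- the cofactor one level down the tower.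
      refine ⟨p * (p ^ r * h ^ p), p_mul_mem_tower (mul_mem (pow_mem (natCast_mem _ _) _)
        (pow_mem hh _)), ?_⟩
      have e : (p : E) * (p * (p ^ r * h ^ p)) = (p * h) ^ p := by
        have : (p : E) ^ p = p * (p * p ^ r) := by
          nth_rewrite 2 [hr]
          ring
        rw [mul_pow, this]; ring
      rw [e]
      exact hJ.pow_sub_pow_mem hyh
  obtain ⟨c, hc, h, hh, hx⟩ := exists_frobSum_of_mem_tower hx
  have hρp : ρ (p : E) = 0 := (hker _).2 hJ.p_mem
  have h1 : ρ (frobSum τ c) = 0 := by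
    have h2 : ρ (x - (frobSum τ c + p * h)) = 0 := (hker _).2 (hJ.anti (by omega) hx)
    rwa [map_sub, map_add, map_mul, h0, hρp, zero_mul, add_zero, zero_sub, neg_eq_zero] at h2
  rw [map_frobSum hp.ne_zero] at h1
  simp only [hτ] at h1
  -- Independence of the reduced monomials of `b` enters here.
  have h2 : ∀ β, ρ (c β) = 0 := fun β => DFunLike.congr_fun (hb.eq_zero _ h1) β
  choose g hg hg' using fun β => key (c β) (hc β) (h2 β)
  refine ⟨∑ β ∈ c.support, mono τ β.1 * g β + h,
    add_mem (sum_mem fun β _ => mul_mem (mono_mem τ (lift_mem_tower n) _) (hg β)) hh, ?_⟩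
  have e : x - p * (∑ β ∈ c.support, mono τ β.1 * g β + h) = (x - (frobSum τ c + p * h)) +
      ∑ β ∈ c.support, mono τ β.1 * (c β ^ p - p * g β) := by
    simp only [mul_sub, Finset.sum_sub_distrib, mul_add, Finset.mul_sum, frobSum, Finsupp.sum]
    have : ∀ β : RedExp p ι, (p : E) * (mono τ β.1 * g β) = mono τ β.1 * (p * g β) :=
      fun β => by ring
    simp only [this]
    ring
  rw [e]
  exact add_mem hx (sum_mem fun β _ => Ideal.mul_mem_left _ _ (hg' β))
termination_by n

end Tower

/-! ### Lifting ring maps along complete filtrations -/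

section Lifting

variable {p : ℕ} [Fact p.Prime] {k ι C D S : Type*} [CommRing k] [CommRing C] [CommRing D]
  [CommRing S] {b : ι → k} {ρ : C →+* k} {t : ι → C}

/-- Two ring maps that agree to first order and on a lift of a Frobenius basis are equal. -/
theorem ringHom_ext_of_isFrobBasis (hb : IsFrobBasis p b) (hρ : Function.Surjective ρ)
    (hker : ∀ c, ρ c = 0 → (p : C) ∣ c) (ht : ∀ i, ρ (t i) = b i) {J : ℕ → Ideal D}
    (hJ : IsFiltration p J) (hJ0 : ∀ x, (∀ n, x ∈ J n) → x = 0) {g g' : C →+* D}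
    (h1 : ∀ c, g c - g' c ∈ J 1) (h2 : ∀ i, g (t i) = g' (t i)) : g = g' := by
  -- The maps agree on monomials in `t`; what remains of `c` consists of p-th powers and a multiple
  -- of `p`, and on both the agreement gains a degree.
  have key : ∀ n c, g c - g' c ∈ J (n + 1) := by
    intro n
    induction n with
    | zero => exact h1
    | succ n ih =>
      intro c
      obtain ⟨a, ha⟩ := hb.exists_eq (ρ c)
      choose s hs using hρ
      obtain ⟨c', hc'⟩ := hker (c - ∑ β ∈ a.support, mono t β.1 * s (a β) ^ p) (by
        rw [map_sub, ha, map_sum, frobSum, Finsupp.sum, sub_eq_zero]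
        refine Finset.sum_congr rfl fun β _ => ?_
        simp [map_mono, hs, ht])
      rw [sub_eq_iff_eq_add] at hc'
      have e : g c - g' c = p * (g c' - g' c') +
          ∑ β ∈ a.support, mono (fun i => g' (t i)) β.1 * (g (s (a β)) ^ p - g' (s (a β)) ^ p) := by
        rw [hc']
        simp only [map_add, map_mul, map_sum, map_natCast, map_pow, map_mono, h2, mul_sub,
          Finset.sum_sub_distrib]
        ring
      rw [e]
      exact add_mem (hJ.p_mul_mem (ih c')) (sum_mem fun β _ => Ideal.mul_mem_left _ _
        (hJ.pow_sub_pow_mem (ih _)))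
  ext c
  exact sub_eq_zero.1 (hJ0 _ fun n => hJ.anti (Nat.le_succ n) (key n c))

/-- A ring map from `k = C / p` to a quotient of a complete filtered ring lifts to `C`, with
prescribed values on a lift of a Frobenius basis. -/
theorem exists_ringHom_lift (hb : IsFrobBasis p b) (hpk : (p : k) = 0)
    (hρ : Function.Surjective ρ)
    (hker : ∀ c, ρ c = 0 → (p : C) ∣ c) (ht : ∀ i, ρ (t i) = b i) {J : ℕ → Ideal D}
    (hJ : IsCompleteFiltration p J) {q : D →+* S} (hq : Function.Surjective q)
    (hqJ : ∀ x, q x = 0 ↔ x ∈ J 1) (f : k →+* S) (d : ι → D) (hd : ∀ i, q (d i) = f (b i))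
    (hreg : (∀ c : C, (p : C) * c = 0 → c = 0) ∨ (p : D) = 0) :
    ∃ g : C →+* D, (∀ c, q (g c) = f (ρ c)) ∧ ∀ i, g (t i) = d i := by
  -- The graph of the lift must lie in this fibre product over `S`, where `τ = (t, d)` lifts the
  -- basis. It will be the intersection `Γ` of the tower of `E`.
  let E : Subring (C × D) :=
    ((f.comp ρ).comp (RingHom.fst C D)).eqLocus (q.comp (RingHom.snd C D))
  have memE : ∀ c x, (c, x) ∈ E ↔ f (ρ c) = q x := fun c x => Iff.rfl
  let πC : E →+* C := (RingHom.fst C D).comp E.subtype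
  let πD : E →+* D := (RingHom.snd C D).comp E.subtype
  let JE : ℕ → Ideal E := fun n => (Ideal.span {(p : C) ^ n}).comap πC ⊓ (J n).comap πD
  have memJE : ∀ n (e : E), e ∈ JE n ↔ (p : C) ^ n ∣ πC e ∧ πD e ∈ J n := fun n e => by
    simp only [JE, Ideal.mem_inf, Ideal.mem_comap, Ideal.mem_span_singleton]
  have hJE : IsFiltration p JE :=
    { anti := fun m n h e he => by
        rw [memJE] at he ⊢
        exact ⟨(pow_dvd_pow _ h).trans he.1, hJ.anti h he.2⟩
      mul_mem := fun {m n x y} hx hy => by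
        rw [memJE] at hx hy ⊢
        rw [map_mul, map_mul, pow_add]
        exact ⟨mul_dvd_mul hx.1 hy.1, hJ.mul_mem hx.2 hy.2⟩
      p_mem := by
        rw [memJE, map_natCast, map_natCast, pow_one]
        exact ⟨dvd_rfl, hJ.p_mem⟩ }
  let τ : ι → E := fun i => ⟨(t i, d i), by rw [memE, ht, hd]⟩
  let ρE : E →+* k := ρ.comp πC
  have hτ : ∀ i, ρE (τ i) = b i := ht
  have hρE : Function.Surjective ρE := fun x => by
    obtain ⟨c, rfl⟩ := hρ x
    obtain ⟨y, hy⟩ := hq (f (ρ c))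
    exact ⟨⟨(c, y), by rw [memE, hy]⟩, rfl⟩
  have hkerE : ∀ e, ρE e = 0 ↔ e ∈ JE 1 := fun e => by
    rw [memJE, pow_one]
    have he : f (ρ (πC e)) = q (πD e) := e.2
    constructor
    · intro h
      refine ⟨hker _ h, (hqJ _).1 ?_⟩
      rw [← he]
      exact (congrArg f h).trans (map_zero f)
    · rintro ⟨⟨c, hc⟩, -⟩
      change ρ (πC e) = 0
      rw [hc, map_mul, map_natCast, hpk, zero_mul]
  -- At level `n` the first component determines the second up to degree `n + 1`: an element over a
  -- multiple of `p` is `p * h` up to filtration, and `h` is handled at the previous level.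
  have hinj : ∀ n, ∀ e ∈ tower p JE τ n, (p : C) ^ (n + 1) ∣ πC e → πD e ∈ J (n + 1) := by
    intro n
    induction n with
    | zero =>
      intro e _ he
      have h1 : ρE e = 0 := by
        obtain ⟨c, hc⟩ := he
        change ρ (πC e) = 0
        rw [hc, zero_add, pow_one, map_mul, map_natCast, hpk, zero_mul]
      exact ((memJE _ _).1 ((hkerE e).1 h1)).2
    | succ n ih =>
      intro e hen he
      have h1 : ρE e = 0 := by
        obtain ⟨c, hc⟩ := he
        change ρ (πC e) = 0
        rw [hc, pow_succ', mul_assoc, map_mul, map_natCast, hpk, zero_mul]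
      obtain ⟨h, hh, hx⟩ := exists_eq_p_mul_of_mem_tower hJE hkerE hb hτ hen h1
      rw [memJE, map_sub, map_mul, map_natCast, map_sub, map_mul, map_natCast] at hx
      have e1 : πD e = (πD e - p * πD h) + p * πD h := by ring
      rw [e1]
      refine add_mem hx.2 ?_
      -- Passing from `p * h` to `h` in the first component requires `p` to be regular in `C`. If
      -- instead `p = 0` in `D`, then `p * h` has second component zero.
      rcases hreg with hreg | hreg
      · refine hJ.p_mul_mem (ih h hh ?_)
        have h2 := dvd_sub he hx.1
        rw [sub_sub_cancel, pow_succ'] at h2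
        obtain ⟨z, hz⟩ := h2
        exact ⟨z, sub_eq_zero.1 (hreg _ (by rw [mul_sub, hz]; ring))⟩
      · rw [hreg, zero_mul]; exact zero_mem _
  -- Elements of level `n` realise every residue, so they approximate `c` one p-adic digit at a
  -- time.
  have happrox : ∀ n c m, ∃ e ∈ tower p JE τ n, (p : C) ^ m ∣ c - πC e := by
    intro n c m
    induction m with
    | zero => exact ⟨0, zero_mem _, by simp⟩
    | succ m ih =>
      obtain ⟨e, he, c', hc'⟩ := ih
      obtain ⟨y, hy⟩ := hq (f (ρ c'))
      obtain ⟨e', he', h⟩ := exists_mem_tower hJE hρE (fun x => (hkerE x).1) hb hτ n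
        ⟨(c', y), by rw [memE, hy]⟩
      rw [memJE, map_sub, pow_one] at h
      obtain ⟨z, hz⟩ := h.1
      have hz' : c' - πC e' = p * z := hz
      refine ⟨e + p ^ m * e', add_mem he (mul_mem (pow_mem (natCast_mem _ _) _) he'), z, ?_⟩
      rw [map_add, map_mul, map_pow, map_natCast, pow_succ, mul_assoc, ← hz', mul_sub, ← hc']
      ring
  have hfull : ∀ c n, ∃ e ∈ tower p JE τ n, πC e = c := by
    intro c n
    obtain ⟨e, he, c', hc'⟩ := happrox n c (n + 1)
    -- The remaining error is removed exactly by this element, which has filtration degree `n + 1`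
    -- and so lies in level `n`. Thus completeness of `C` plays no role.
    have hz : (((p : C) ^ (n + 1) * c', (0 : D)) : C × D) ∈ E := by
      rw [memE, pow_succ', mul_assoc, map_mul, map_natCast, hpk, zero_mul, map_zero, map_zero]
    refine ⟨e + ⟨_, hz⟩, add_mem he (mem_tower_of_mem ((memJE _ _).2 ⟨⟨c', rfl⟩, zero_mem _⟩)), ?_⟩
    rw [map_add]
    change πC e + (p : C) ^ (n + 1) * c' = c
    rw [← hc']; ring
  let Γ : Subring E := ⨅ n, tower p JE τ n
  have memΓ : ∀ e, e ∈ Γ ↔ ∀ n, e ∈ tower p JE τ n := fun e => Subring.mem_iInf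
  have hbij : Function.Bijective (πC.comp Γ.subtype) := by
    constructor
    · rw [injective_iff_map_eq_zero]
      intro e he
      have he : πC e.1 = 0 := he
      refine Subtype.ext (Subtype.ext (Prod.ext he (hJ.eq_zero _ fun n => ?_)))
      exact hJ.anti (Nat.le_succ n) (hinj n e.1 ((memΓ _).1 e.2 n) (by rw [he]; exact dvd_zero _))
    · intro c
      choose e he hec using hfull c
      -- By `hinj`, elements over the same `c` in successive levels have second components that
      -- differ in high degree, so these converge while `c` stays fixed.
      obtain ⟨L, hL⟩ := hJ.exists_limit (fun n => πD (e n)) fun n => by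
        rw [← map_sub]
        refine hJ.anti (Nat.le_succ n) (hinj n _ (sub_mem (tower_succ_le hJE n (he _)) (he n)) ?_)
        rw [map_sub, hec, hec, sub_self]
        exact dvd_zero _
      have hLE : (c, L) ∈ E := by
        rw [memE, ← hec 1]
        have h1 : f (ρ (πC (e 1))) = q (πD (e 1)) := (e 1).2
        rw [h1, eq_comm, ← sub_eq_zero, ← map_sub]
        exact (hqJ _).2 (hL 1)
      refine ⟨⟨⟨(c, L), hLE⟩, (memΓ _).2 fun n => ?_⟩, rfl⟩
      have h1 : (⟨(c, L), hLE⟩ : E) - e (n + 1) ∈ JE (n + 1) := by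
        rw [memJE, map_sub, map_sub, hec]
        refine ⟨?_, hL (n + 1)⟩
        change _ ∣ c - c
        rw [sub_self]; exact dvd_zero _
      have h2 := add_mem (mem_tower_of_mem (p := p) (τ := τ) h1) (tower_succ_le hJE n (he (n + 1)))
      rwa [sub_add_cancel] at h2
  let φ := RingEquiv.ofBijective _ hbij
  refine ⟨(πD.comp Γ.subtype).comp φ.symm.toRingHom, fun c => ?_, fun i => ?_⟩
  · obtain ⟨e, rfl⟩ := φ.surjective c
    have h1 : f (ρ (φ e)) = q (πD e.1) := e.1.2
    simpa using h1.symm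
  · have h1 : φ ⟨τ i, (memΓ _).2 fun n => lift_mem_tower n i⟩ = t i := rfl
    rw [← h1]
    simp [πD, τ]

end Lifting

end

end ResidualPerfection

/-! ### Witt vectors, power series and lifts of perfect reductions -/

namespace ResidualPerfection

noncomputable section

/-! ### Perfect rings and their Witt vectors -/

section Witt

variable {p : ℕ} [Fact p.Prime] {S : Type*} [CommRing S]

theorem IsPerfect.charP [Nontrivial S] (hS : IsPerfect p S) : CharP S p := by
  rcases CharP.exists S with ⟨q, hq⟩
  have h1 : q ∣ p := (CharP.cast_eq_zero_iff S q p).1 hS.1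
  rcases (Nat.dvd_prime Fact.out).1 h1 with rfl | rfl
  · exact absurd rfl (CharP.char_ne_one S 1)
  · exact hq

theorem subsingleton_wittVector [Subsingleton S] : Subsingleton (WittVector p S) :=
  ⟨fun _ _ => WittVector.ext fun _ => Subsingleton.elim _ _⟩

/-- The zero ring is perfect in the sense of `IsPerfect` but does not have characteristic `p`, so it
is split off before the theory of Witt vectors over perfect rings is applied. -/
theorem IsPerfect.witt_eq_zero (hS : IsPerfect p S) {x : WittVector p S}
    (h : (p : WittVector p S) * x = 0) : x = 0 := by
  rcases subsingleton_or_nontrivial S with _ | _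
  · have := subsingleton_wittVector (p := p) (S := S)
    exact Subsingleton.elim _ _
  · have := hS.charP
    have : PerfectRing S p := ⟨hS.2⟩
    exact WittVector.eq_zero_of_p_mul_eq_zero x (by rwa [mul_comm])

theorem IsPerfect.witt_constantCoeff_eq_zero_iff (hS : IsPerfect p S) (x : WittVector p S) :
    WittVector.constantCoeff x = 0 ↔ (p : WittVector p S) ∣ x := by
  rcases subsingleton_or_nontrivial S with _ | _
  · have := subsingleton_wittVector (p := p) (S := S)
    exact ⟨fun _ => ⟨0, Subsingleton.elim _ _⟩, fun _ => Subsingleton.elim _ _⟩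
  · have := hS.charP
    have : PerfectRing S p := ⟨hS.2⟩
    rw [← Ideal.mem_span_singleton, WittVector.mem_span_p_iff_coeff_zero_eq_zero]
    rfl

theorem IsPerfect.witt_isAdicComplete (hS : IsPerfect p S) :
    IsAdicComplete (Ideal.span {(p : WittVector p S)}) (WittVector p S) := by
  rcases subsingleton_or_nontrivial S with _ | _
  · have := subsingleton_wittVector (p := p) (S := S)
    exact isAdicComplete_of_pow (fun _ _ => Subsingleton.elim _ _)
      (fun x _ => ⟨0, fun n => by rw [Subsingleton.elim (0 - x n) 0]; exact zero_mem _⟩)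
  · have := hS.charP
    have : PerfectRing S p := ⟨hS.2⟩
    infer_instance

theorem IsPerfect.witt_isCompleteFiltration (hS : IsPerfect p S) :
    IsCompleteFiltration p (fun n => Ideal.span {(p : WittVector p S)} ^ n) :=
  isCompleteFiltration_pow hS.witt_isAdicComplete (Ideal.mem_span_singleton_self _)

theorem IsPerfect.isCompleteFiltration_bot (hS : IsPerfect p S) :
    IsCompleteFiltration p (fun n => (⊥ : Ideal S) ^ n) :=
  isCompleteFiltration_pow inferInstance hS.1

end Witt

/-! ### Power series over a complete filtered ring -/

section Series

variable {p : ℕ} {W : Type*} [CommRing W]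

/-- The filtration of `W⟦X⟧` for which `X` has degree one and `W` carries the filtration `F`. -/
def seriesFiltration {F : ℕ → Ideal W} (hF : Antitone F) (n : ℕ) : Ideal (PowerSeries W) where
  carrier := {f | ∀ i, PowerSeries.coeff i f ∈ F (n - i)}
  add_mem' hf hg i := by rw [map_add]; exact add_mem (hf i) (hg i)
  zero_mem' i := by rw [map_zero]; exact zero_mem _
  smul_mem' g f hf i := by
    rw [smul_eq_mul, PowerSeries.coeff_mul]
    refine sum_mem fun x hx => Ideal.mul_mem_left _ _ (hF ?_ (hf x.2))
    rw [← Finset.HasAntidiagonal.mem_antidiagonal.1 hx]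
    omega

theorem mem_seriesFiltration {F : ℕ → Ideal W} {hF : Antitone F} {n : ℕ} {f : PowerSeries W} :
    f ∈ seriesFiltration hF n ↔ ∀ i, PowerSeries.coeff i f ∈ F (n - i) := Iff.rfl

theorem mem_seriesFiltration_one {F : ℕ → Ideal W} {hF : Antitone F} (h0 : F 0 = ⊤)
    {f : PowerSeries W} :
    f ∈ seriesFiltration hF 1 ↔ PowerSeries.constantCoeff f ∈ F 1 := by
  rw [mem_seriesFiltration, ← PowerSeries.coeff_zero_eq_constantCoeff_apply]
  refine ⟨fun h => h 0, fun h i => ?_⟩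
  cases i with
  | zero => exact h
  | succ i => rw [show 1 - (i + 1) = 0 by omega, h0]; trivial

theorem isCompleteFiltration_series {F : ℕ → Ideal W} (hF : IsCompleteFiltration p F)
    (h0 : F 0 = ⊤) : IsCompleteFiltration p (seriesFiltration hF.anti) where
  anti m n h f hf i := hF.anti (by omega) (hf i)
  mul_mem {m n f g} hf hg i := by
    rw [PowerSeries.coeff_mul]
    refine sum_mem fun x hx => hF.anti ?_ (hF.mul_mem (hf x.1) (hg x.2))
    rw [← Finset.HasAntidiagonal.mem_antidiagonal.1 hx]
    omega
  p_mem := by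
    rw [mem_seriesFiltration_one h0, map_natCast]
    exact hF.p_mem
  eq_zero f hf := by
    ext i
    refine hF.eq_zero _ fun n => ?_
    simpa using hf (n + i) i
  exists_limit f hf := by
    -- A condition in degree `m` controls the coefficient of index `i` only in degree `m - i`;
    -- shifting the sequence by `i` compensates for this.
    have h1 : ∀ i, ∃ L, ∀ n, L - PowerSeries.coeff i (f (n + i)) ∈ F n := fun i =>
      hF.exists_limit _ fun n => by
        have := hf (n + i) i
        rw [map_sub, Nat.add_sub_cancel] at this
        rwa [add_right_comm]
    choose L hL using h1
    refine ⟨PowerSeries.mk L, fun n i => ?_⟩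
    rcases le_total i n with h | h
    · have := hL i (n - i)
      rwa [Nat.sub_add_cancel h, ← PowerSeries.coeff_mk i L, ← map_sub] at this
    · rw [Nat.sub_eq_zero_of_le h, h0]; trivial

theorem mem_span_X_pow {n : ℕ} {f : PowerSeries W} :
    f ∈ Ideal.span {(PowerSeries.X : PowerSeries W)} ^ n ↔
      ∀ i < n, PowerSeries.coeff i f = 0 := by
  rw [Ideal.span_singleton_pow, Ideal.mem_span_singleton, PowerSeries.X_pow_dvd_iff]

/-- Coefficients of an X-adic Cauchy sequence are eventually constant, so `W` needs no topology. -/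
theorem isAdicComplete_X :
    IsAdicComplete (Ideal.span {(PowerSeries.X : PowerSeries W)}) (PowerSeries W) := by
  refine isAdicComplete_of_pow (fun f hf => ?_) fun f hf => ?_
  · ext i
    exact mem_span_X_pow.1 (hf (i + 1)) i (Nat.lt_succ_self i)
  · have h1 : ∀ i k, PowerSeries.coeff i (f (i + 1 + k)) = PowerSeries.coeff i (f (i + 1)) := by
      intro i k
      induction k with
      | zero => rfl
      | succ k ih =>
        have := mem_span_X_pow.1 (hf (i + 1 + k)) i (by omega)
        rw [map_sub, sub_eq_zero] at this
        rw [← ih, ← this]; rfl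
    refine ⟨PowerSeries.mk fun i => PowerSeries.coeff i (f (i + 1)), fun n => ?_⟩
    refine mem_span_X_pow.2 fun i hi => ?_
    obtain ⟨k, rfl⟩ := Nat.exists_eq_add_of_le hi
    rw [map_sub, PowerSeries.coeff_mk, h1, sub_self]

end Series

/-! ### Adic sums and evaluation of power series -/

section AdicSum

variable {B : Type*} [CommRing B] {I : Ideal B} {ϖ : B}

theorem IsAdicSum.unique [IsHausdorff I B] {c : ℕ → B} {x y : B} (hx : IsAdicSum I ϖ c x)
    (hy : IsAdicSum I ϖ c y) : x = y := by
  refine eq_of_forall_sub_mem I fun n => ?_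
  have := sub_mem (hx n) (hy n)
  rwa [sub_sub_sub_cancel_right] at this

theorem exists_isAdicSum (hI : IsAdicComplete I B) (hϖ : ϖ ∈ I) (c : ℕ → B) :
    ∃ x, IsAdicSum I ϖ c x := by
  refine IsPrecomplete.prec (I := I) (M := B) inferInstance
    (f := fun n => ∑ i ∈ Finset.range n, c i * ϖ ^ i) ?_ |>.imp fun x hx n => ?_
  · intro m n hmn
    refine SModEq.symm (SModEq.sub_mem.2 ?_)
    rw [← Finset.sum_range_add_sum_Ico _ hmn, add_sub_cancel_left]
    refine sum_mem fun i hi => ?_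
    rw [smul_eq_mul, Ideal.mul_top]
    exact Ideal.mul_mem_left _ _ (Ideal.pow_le_pow_right (Finset.mem_Ico.1 hi).1
      (Ideal.pow_mem_pow hϖ i))
  · have := SModEq.sub_mem.1 (hx n).symm
    simpa using this

/-- Evaluation of power series at a topologically nilpotent element. -/
theorem exists_seriesEval (hI : IsAdicComplete I B) (hϖ : ϖ ∈ I) {W : Type*} [CommRing W]
    (θ : W →+* B) : ∃ ev : PowerSeries W →+* B,
      ∀ f, IsAdicSum I ϖ (fun i => θ (PowerSeries.coeff i f)) (ev f) := by
  choose ev hev using fun f : PowerSeries W =>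
    exists_isAdicSum hI hϖ (fun i => θ (PowerSeries.coeff i f))
  have key : ∀ f n, ev f - (PowerSeries.trunc n f).eval₂ θ ϖ ∈ I ^ n := fun f n => by
    rw [PowerSeries.eval₂_trunc_eq_sum_range]; exact hev f n
  have ext : ∀ f x, (∀ n, x - (PowerSeries.trunc n f).eval₂ θ ϖ ∈ I ^ n) → ev f = x := by
    intro f x hx
    refine (hev f).unique fun n => ?_
    rw [← PowerSeries.eval₂_trunc_eq_sum_range]; exact hx n
  refine ⟨⟨⟨⟨ev, ?_⟩, fun f g => ?_⟩, ?_, fun f g => ?_⟩, hev⟩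
  · refine (hev 1).unique fun n => ?_
    cases n with
    | zero => simp
    | succ n => simp [PowerSeries.coeff_one]
  · refine ext _ _ fun n => ?_
    have e : ev f * ev g - (PowerSeries.trunc n (f * g)).eval₂ θ ϖ =
        ev g * (ev f - (PowerSeries.trunc n f).eval₂ θ ϖ) +
        (PowerSeries.trunc n f).eval₂ θ ϖ * (ev g - (PowerSeries.trunc n g).eval₂ θ ϖ) +
        (PowerSeries.trunc n f * PowerSeries.trunc n g - PowerSeries.trunc n (f * g)).eval₂ θ ϖ := by
      rw [Polynomial.eval₂_sub, Polynomial.eval₂_mul]; ring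
    rw [e]
    refine add_mem (add_mem (Ideal.mul_mem_left _ _ (key f n)) (Ideal.mul_mem_left _ _ (key g n))) ?_
    -- Truncating before or after multiplication gives the same coefficients below degree `n`; the
    -- discrepancy evaluates into `I ^ n`.
    have hd : (Polynomial.X : Polynomial W) ^ n ∣
        PowerSeries.trunc n f * PowerSeries.trunc n g - PowerSeries.trunc n (f * g) := by
      rw [Polynomial.X_pow_dvd_iff]
      intro d hd
      rw [Polynomial.coeff_sub, PowerSeries.coeff_trunc, if_pos hd,
        PowerSeries.coeff_mul_eq_coeff_trunc_mul_trunc f g hd, ← Polynomial.coe_mul,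
        Polynomial.coeff_coe, sub_self]
    obtain ⟨r, hr⟩ := hd
    rw [hr, Polynomial.eval₂_mul, Polynomial.eval₂_pow, Polynomial.eval₂_X]
    exact Ideal.mul_mem_right _ _ (Ideal.pow_mem_pow hϖ n)
  · exact ext _ _ fun n => by simp
  · refine ext _ _ fun n => ?_
    change ev f + ev g - _ ∈ _
    rw [map_add, Polynomial.eval₂_add]
    convert add_mem (key f n) (key g n) using 1
    ring

theorem IsAdicSum.eq_of_first {c : ℕ → B} {x : B} (h : IsAdicSum I ϖ c x) : x - c 0 ∈ I := by
  simpa using h 1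

theorem isAdicSum_X (hI : IsHausdorff I B) (hϖ : ϖ ∈ I) {W : Type*} [CommRing W]
    {θ : W →+* B} {x : B}
    (h : IsAdicSum I ϖ (fun i => θ (PowerSeries.coeff i (PowerSeries.X : PowerSeries W))) x) :
    x = ϖ := by
  refine h.unique fun n => ?_
  match n with
  | 0 => simp
  | 1 => simpa using hϖ
  | n + 2 =>
    rw [Finset.sum_eq_single 1 (fun i _ hi => by simp [PowerSeries.coeff_X, hi])
      (fun h => absurd (Finset.mem_range.2 (by omega)) h)]
    simp

theorem isAdicSum_C (hI : IsHausdorff I B) {W : Type*} [CommRing W]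
    {θ : W →+* B} {w : W} {x : B}
    (h : IsAdicSum I ϖ (fun i => θ (PowerSeries.coeff i (PowerSeries.C w))) x) :
    x = θ w := by
  refine h.unique fun n => ?_
  cases n with
  | zero => simp
  | succ n =>
    rw [Finset.sum_eq_single 0 (fun i _ hi => by simp [PowerSeries.coeff_C, hi])
      (fun h => absurd (Finset.mem_range.2 (by omega)) h)]
    simp

end AdicSum

/-! ### Lifts of perfect reductions -/

section PerfectLift

variable {p : ℕ} [Fact p.Prime] {B : Type*} [CommRing B] {I : Ideal B}

/-- The lifting principle with the empty p-basis of the perfect ring `B ⧸ I`, lifted by its Witt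
vectors, in which `p` is regular. -/
theorem existsUnique_wittLift (hI : IsAdicComplete I B) (hB : IsPerfect p (B ⧸ I)) :
    ∃! θ : WittVector p (B ⧸ I) →+* B,
      ∀ w, Ideal.Quotient.mk I (θ w) = WittVector.constantCoeff w := by
  have hp : (p : B) ∈ I := by
    rw [← Ideal.Quotient.eq_zero_iff_mem, map_natCast]; exact hB.1
  have hJ := isCompleteFiltration_pow hI hp
  refine existsUnique_of_exists_of_unique ?_ fun θ θ' h h' => ?_
  · obtain ⟨g, hg, -⟩ := exists_ringHom_lift hB.isFrobBasis hB.1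
      (WittVector.constantCoeff_surjective p)
      (fun c => (hB.witt_constantCoeff_eq_zero_iff c).1) (t := PEmpty.elim) (fun i => i.elim) hJ
      Ideal.Quotient.mk_surjective
      (fun x => by rw [pow_one, Ideal.Quotient.eq_zero_iff_mem]) (RingHom.id _) PEmpty.elim
      (fun i => i.elim) (Or.inl fun c => hB.witt_eq_zero)
    exact ⟨g, hg⟩
  · refine ringHom_ext_of_isFrobBasis hB.isFrobBasis (WittVector.constantCoeff_surjective p)
      (fun c => (hB.witt_constantCoeff_eq_zero_iff c).1) (t := PEmpty.elim) (fun i => i.elim)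
      hJ.toIsFiltration hJ.eq_zero (fun c => ?_) (fun i => i.elim)
    rw [pow_one, ← Ideal.Quotient.eq_zero_iff_mem, map_sub, h, h', sub_self]

/-- When `p = 0` in `B`, the perfect ring `B ⧸ I` can serve as its own lift in the lifting
principle. -/
theorem exists_ringSection (hI : IsAdicComplete I B) (hB : IsPerfect p (B ⧸ I))
    (hp : (p : B) = 0) :
    ∃ σ : (B ⧸ I) →+* B, ∀ x, Ideal.Quotient.mk I (σ x) = x := by
  have hJ := isCompleteFiltration_pow (p := p) hI (by rw [hp]; exact zero_mem I)
  obtain ⟨g, hg, -⟩ := exists_ringHom_lift hB.isFrobBasis hB.1 (ρ := RingHom.id (B ⧸ I))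
    Function.surjective_id
    (fun c hc => by change c = 0 at hc; rw [hc]; exact dvd_zero _) (t := PEmpty.elim)
    (fun i => i.elim) hJ
    Ideal.Quotient.mk_surjective
    (fun x => by rw [pow_one, Ideal.Quotient.eq_zero_iff_mem]) (RingHom.id _) PEmpty.elim
    (fun i => i.elim) (Or.inr hp)
  exact ⟨g, hg⟩

end PerfectLift

/-! ### Flatness over a discrete valuation ring -/

/-- Nonzero elements of `A` are units times powers of `π`, so regularity of `π` means
torsion-freeness, which is flatness over a discrete valuation ring. -/
theorem flat_of_uniformizer_regular {A : Type*} [CommRing A] [IsDomain A]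
    [IsDiscreteValuationRing A] {π : A} (hπ : Irreducible π) {B : Type*} [CommRing B]
    [Algebra A B] (h : ∀ x : B, algebraMap A B π * x = 0 → x = 0) : Module.Flat A B := by
  have : Module.IsTorsionFree A B := ⟨fun r hr => by
    obtain ⟨n, u, rfl⟩ := IsDiscreteValuationRing.eq_unit_mul_pow_irreducible hr.ne_zero hπ
    have h1 : ∀ (n : ℕ) (x : B), algebraMap A B π ^ n * x = 0 → x = 0 := by
      intro n
      induction n with
      | zero => intro x hx; simpa using hx
      | succ n ih => intro x hx; exact h x (ih _ (by rw [← mul_assoc, ← pow_succ, hx]))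
    intro x y hxy
    simp only [Algebra.smul_def, map_mul, map_pow] at hxy
    have h2 : IsUnit (algebraMap A B u) := u.isUnit.map _
    rw [mul_assoc, mul_assoc, h2.mul_right_inj] at hxy
    exact sub_eq_zero.1 (h1 n _ (by rw [mul_sub, hxy, sub_self]))⟩
  infer_instance

end

end ResidualPerfection

/-! ### Reduction of complete residual perfections and the formal adjunction -/

namespace ResidualPerfection

noncomputable section

/-! ### Morphisms of complete residual perfections and their reductions -/

section Reduction

variable {p : ℕ} [Fact p.Prime] {A : Type u} [CommRing A] [IsDomain A]
  [IsDiscreteValuationRing A] {π : A}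

theorem CRP.eq_of_coeff_eq (hπ : Irreducible π) {B : CRP p A} {x y : B.obj}
    (h : ∀ i, B.coeff hπ x i = B.coeff hπ y i) : x = y := by
  have := B.property.complete
  refine (B.isAdicSum_coeff hπ x).unique ?_
  simp only [h]
  exact B.isAdicSum_coeff hπ y

/-- An element is determined by its coefficients, and these are transported by the reduction of the
morphism. -/
theorem CRP.hom_ext {B C : CRP p A} {f g : B ⟶ C}
    (h : ∀ x, redMap (toAlgHom f) x = redMap (toAlgHom g) x) : f = g := by
  obtain ⟨π, hπ⟩ := IsDiscreteValuationRing.exists_irreducible A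
  refine ObjectProperty.hom_ext _ (CommAlgCat.hom_ext (AlgHom.ext fun x => ?_))
  refine CRP.eq_of_coeff_eq hπ fun i => ?_
  exact (CRP.redMap_coeff f hπ x i).symm.trans ((h _).trans (CRP.redMap_coeff g hπ x i))

/-- A preimage of `y` is obtained by summing the series whose coefficients are preimages of the
coefficients of `y`; injectivity is also read off from coefficients. -/
theorem CRP.isIso_of_bijective {B C : CRP p A} (f : B ⟶ C)
    (h : Function.Bijective (redMap (toAlgHom f))) : IsIso f := by
  obtain ⟨π, hπ⟩ := IsDiscreteValuationRing.exists_irreducible A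
  have hf : Function.Bijective (toAlgHom f) := by
    constructor
    · intro x y hxy
      refine CRP.eq_of_coeff_eq hπ fun i => h.1 ?_
      rw [CRP.redMap_coeff, CRP.redMap_coeff, hxy]
    · intro y
      choose r hr using h.2
      have hB := B.property.complete
      have hC := C.property.complete
      obtain ⟨x, hx⟩ := exists_isAdicSum hB (ϖ := algebraMap A B.obj π)
        (by rw [pIdeal_eq_span hπ]; exact Ideal.mem_span_singleton_self _)
        (fun i => B.sec (r (C.coeff hπ y i)))
      refine ⟨x, CRP.eq_of_coeff_eq hπ fun i => ?_⟩
      have hc : (fun i => r (C.coeff hπ y i)) = B.coeff hπ x :=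
        (B.existsUnique_coeff hπ x).unique hx (B.isAdicSum_coeff hπ x)
      rw [← CRP.redMap_coeff, ← hc, hr]
  have h1 : IsIso f.hom := by
    have : IsIso ((forget (CommAlgCat A)).map f.hom) := (isIso_iff_bijective _).2 hf
    exact isIso_of_reflects_iso f.hom (forget (CommAlgCat A))
  have h2 : IsIso ((isCRP p A).ι.map f) := h1
  exact isIso_of_reflects_iso f (isCRP p A).ι

end Reduction

theorem PAlg.isIso_of_bijective {p : ℕ} {R : Type u} [CommRing R] {S S' : PAlg p R} (f : S ⟶ S')
    (h : Function.Bijective f.hom.hom) : IsIso f := by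
  have h1 : IsIso f.hom := by
    have : IsIso ((forget (CommAlgCat R)).map f.hom) := (isIso_iff_bijective _).2 h
    exact isIso_of_reflects_iso f.hom (forget (CommAlgCat R))
  have h2 : IsIso ((isPerfectAlg p R).ι.map f) := h1
  exact isIso_of_reflects_iso f (isPerfectAlg p R).ι

/-- A ring map compatible with the structure maps, as a morphism of algebras. -/
def homToAlgOfRingHom {R S' : Type u} [CommRing R] [CommRing S'] (S : CommAlgCat.{u} R)
    {f : R →+* S'} (h : S →+* S') (hh : h.comp (algebraMap R S) = f) : S ⟶ algOfRingHom f :=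
  letI := f.toAlgebra
  CommAlgCat.ofHom (R := R) (X := S) (Y := S')
    { toRingHom := h, commutes' := fun r => RingHom.congr_fun hh r }

section Explicit

variable {p : ℕ} [Fact p.Prime] {A : Type u} [CommRing A] [IsDomain A]
  [IsDiscreteValuationRing A] [CharP (IsLocalRing.ResidueField A) p] {π : A}

/-! ### Universal and generic residual perfections from an adjoint equivalence -/

/-- `R_T^pf` is the initial perfect algebra over itself. -/
def isInitialRTpfObj (T : Set A) : Limits.IsInitial (RTpfObj p T) :=
  Limits.IsInitial.ofUniqueHom
    (fun S => ObjectProperty.homMk (CommAlgCat.ofHom (Algebra.ofId (RTpf p T) S.obj)))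
    (fun S _ => ObjectProperty.hom_ext _ (CommAlgCat.hom_ext
      (Subsingleton.elim (α := RTpf p T →ₐ[RTpf p T] S.obj) _ _)))

theorem isFractionRing_iff_comp {R R' K : Type*} [CommRing R] [CommRing R'] [CommRing K]
    (e : R →+* R') (he : Function.Bijective e) (g : R' →+* K) :
    @IsFractionRing R _ K _ (g.comp e).toAlgebra ↔ @IsFractionRing R' _ K _ g.toAlgebra := by
  let e' := RingEquiv.ofBijective e he
  let := (g.comp e).toAlgebra
  rw [IsFractionRing.isFractionRing_iff_of_base_ringEquiv (S := K) e']
  have h : (algebraMap R K).comp e'.symm.toRingHom = g := by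
    ext x
    obtain ⟨y, rfl⟩ := e'.surjective x
    change g (e (e'.symm (e' y))) = g (e y)
    rw [RingEquiv.symm_apply_apply]
  rw [h]

variable {hπ : Irreducible π} {T : Set A}

/-- `V` preserves the initial object, so the unit gives an algebra isomorphism from `R_T^pf` to the
reduction of `Au`. An algebra map out of `R_T^pf` can only be the structure map. -/
theorem structureMap_bijective_of_isInitial {V : PAlg p (RTpf p T) ⥤ CRP p A} (adj : V ⊣ U hπ T)
    [IsIso adj.unit] {Au : CRP p A} (hAu : Limits.IsInitial Au) :
    Function.Bijective (Au.structureMap hπ T) := by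
  have := adj.leftAdjoint_preservesColimits
  have h1 : Limits.IsInitial (V.obj (RTpfObj p T)) :=
    (isInitialRTpfObj T).isInitialObj V
  let i : RTpfObj p T ≅ (U hπ T).obj Au :=
    asIso (adj.unit.app (RTpfObj p T)) ≪≫ (U hπ T).mapIso (h1.uniqueUpToIso hAu)
  let e := CommAlgCat.algEquivOfIso ((isPerfectAlg p (RTpf p T)).ι.mapIso i)
  have h2 : ∀ x : RTpf p T, e x = Au.structureMap hπ T x := fun x => e.commutes x
  have h3 : ⇑(Au.structureMap hπ T) = e := funext fun x => (h2 x).symm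
  rw [h3]
  exact e.bijective

/-- Identifying the reduction of `Au` with `R_T^pf` turns genericity into a condition on the
structure map alone, independent of the choice of `Au`. -/
theorem isGenericPerfection_iff {V : PAlg p (RTpf p T) ⥤ CRP p A} (adj : V ⊣ U hπ T)
    [IsIso adj.unit] {Au : CRP p A} (hAu : Limits.IsInitial Au) (B : CRP p A) :
    IsGenericPerfection hAu B ↔
      @IsFractionRing (RTpf p T) _ (Red A B.obj) _ (B.structureMap hπ T).toAlgebra := by
  have hb := structureMap_bijective_of_isInitial adj hAu
  have hd : IsDomain (Red A Au.obj) :=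
    (RingEquiv.ofBijective _ hb).symm.toMulEquiv.isDomain (RTpf p T)
  rw [IsGenericPerfection, ← isFractionRing_iff_comp _ hb,
    CRP.redMap_comp_structureMap hπ T (hAu.to B)]
  exact and_iff_right hd

theorem describesUniversalAndGeneric {V : PAlg p (RTpf p T) ⥤ CRP p A} (adj : V ⊣ U hπ T)
    [IsIso adj.unit] [IsIso adj.counit] : DescribesUniversalAndGeneric T V := by
  have := adj.leftAdjoint_preservesColimits
  have h1 : Limits.IsInitial (V.obj (RTpfObj p T)) :=
    (isInitialRTpfObj T).isInitialObj V
  refine ⟨⟨_, ⟨h1⟩⟩, fun Au hAu => ⟨?_, ?_, fun Ag hAg => ?_⟩⟩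
  · exact (hAu.uniqueUpToIso h1).isIso_hom
  · rw [isGenericPerfection_iff adj]
    let i := asIso (adj.unit.app (FrRTpfObj p T))
    let e := CommAlgCat.algEquivOfIso ((isPerfectAlg p (RTpf p T)).ι.mapIso i)
    let : Algebra (RTpf p T) (Red A (V.obj (FrRTpfObj p T)).obj) :=
      (CRP.structureMap hπ T (V.obj (FrRTpfObj p T))).toAlgebra
    let e' : FractionRing (RTpf p T) ≃ₐ[RTpf p T] Red A (V.obj (FrRTpfObj p T)).obj := e
    exact IsLocalization.isLocalization_of_algEquiv (nonZeroDivisors (RTpf p T)) e'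
  · rw [isGenericPerfection_iff adj] at hAg
    let : Algebra (RTpf p T) (Red A Ag.obj) := (Ag.structureMap hπ T).toAlgebra
    have : IsFractionRing (RTpf p T) (Red A Ag.obj) := hAg
    let e : Red A Ag.obj ≃ₐ[RTpf p T] FractionRing (RTpf p T) :=
      IsLocalization.algEquiv (nonZeroDivisors (RTpf p T)) _ _
    let i : (U hπ T).obj Ag ≅ FrRTpfObj p T :=
      (isPerfectAlg p (RTpf p T)).isoMk (CommAlgCat.isoMk e)
    refine ⟨⟨⟨(asIso (adj.counit.app Ag)).symm ≪≫ V.mapIso i⟩, fun j => ?_⟩⟩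
    refine Iso.ext (CRP.hom_ext fun x => ?_)
    have h : ∀ j j' : Ag ⟶ V.obj (FrRTpfObj p T),
        redMap (CRP.toAlgHom j) = redMap (CRP.toAlgHom j') := by
      intro j j'
      -- Both reductions restrict to the structure map on `R_T^pf`, and the source is a localization
      -- of it.
      refine IsLocalization.ringHom_ext (nonZeroDivisors (RTpf p T)) ?_
      exact (CRP.redMap_comp_structureMap hπ T j).trans
        (CRP.redMap_comp_structureMap hπ T j').symm
    rw [h]

/-! ### The adjoint equivalence from multiplicative coefficient maps -/

/-- Multiplicative maps `S → V(S)` that reduce to ring isomorphisms and are compatible with the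
expansions of the elements of `T`. -/
structure IsCoefficientSystem (hπ : Irreducible π) {T : Set A}
    (V : PAlg p (RTpf p T) ⥤ CRP p A) (κ : ∀ S, S.obj →* (V.obj S).obj) : Prop where
  natural : ∀ {S S' : PAlg p (RTpf p T)} (f : S ⟶ S') (x : S.obj),
    CRP.toAlgHom (V.map f) (κ S x) = κ S' (f.hom.hom x)
  bijective : ∀ S, Function.Bijective
    (fun x => Ideal.Quotient.mk (pIdeal A (V.obj S).obj) (κ S x))
  map_add : ∀ S x y, κ S (x + y) - (κ S x + κ S y) ∈ pIdeal A (V.obj S).obj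
  residue : ∀ S (a : A), algebraMap A (V.obj S).obj a -
    κ S (algebraMap (RTpf p T) S.obj (resToRTpf p T (IsLocalRing.residue A a))) ∈
      pIdeal A (V.obj S).obj
  expansion : ∀ S (t : T), IsAdicSum (pIdeal A (V.obj S).obj) (algebraMap A (V.obj S).obj π)
    (fun j => κ S (algebraMap (RTpf p T) S.obj (uCoeff p T t j))) (algebraMap A (V.obj S).obj t)

variable {V : PAlg p (RTpf p T) ⥤ CRP p A} {κ : ∀ S, S.obj →* (V.obj S).obj}

namespace IsCoefficientSystem

/-- The reduction of a coefficient map, as a ring map. -/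
def red (h : IsCoefficientSystem hπ V κ) (S : PAlg p (RTpf p T)) :
    S.obj →+* Red A (V.obj S).obj :=
  RingHom.mk' ((Ideal.Quotient.mk (pIdeal A (V.obj S).obj) : _ →* _).comp (κ S)) fun x y =>
    Ideal.Quotient.eq.2 (h.map_add S x y)

/-- Multiplicative maps out of a perfect ring that agree modulo the ideal are equal. Hence series in
values of `κ` are the canonical expansions, and their coefficients can be read off. -/
theorem sec_red (h : IsCoefficientSystem hπ V κ) (S : PAlg p (RTpf p T)) (x : S.obj) :
    (V.obj S).sec (h.red S x) = κ S x := by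
  have := (V.obj S).property.complete
  refine DFunLike.congr_fun (multiplicative_ext (V.obj S).p_mem S.property
    (s := (V.obj S).sec.comp (h.red S : S.obj →* Red A (V.obj S).obj)) (s' := κ S) fun y => ?_) x
  rw [← Ideal.Quotient.eq_zero_iff_mem, map_sub, sub_eq_zero]
  exact (V.obj S).mk_sec _

theorem red_comp_algebraMap (h : IsCoefficientSystem hπ V κ) (S : PAlg p (RTpf p T)) :
    (h.red S).comp (algebraMap (RTpf p T) S.obj) = (V.obj S).structureMap hπ T := by
  refine perfectClosure_hom_ext p (V.obj S).property.perfect ?_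
  rw [CRP.structureMap, perfectLift_comp_of]
  refine MvPolynomial.ringHom_ext (fun r => ?_) (fun tj => ?_)
  · obtain ⟨a, rfl⟩ := IsLocalRing.residue_surjective r
    simp only [RingHom.comp_apply, MvPolynomial.coe_eval₂Hom, MvPolynomial.eval₂_C]
    exact (Ideal.Quotient.eq.2 (h.residue S a)).symm
  · obtain ⟨t, j⟩ := tj
    simp only [RingHom.comp_apply, MvPolynomial.coe_eval₂Hom, MvPolynomial.eval₂_X]
    have h1 : (fun j => h.red S (algebraMap (RTpf p T) S.obj (uCoeff p T t j))) =
        (V.obj S).coeff hπ (algebraMap A (V.obj S).obj t) := by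
      refine ((V.obj S).existsUnique_coeff hπ _).unique ?_ ((V.obj S).isAdicSum_coeff hπ _)
      simp only [sec_red]
      exact h.expansion S t
    rw [← h1]
    have h2 : uCoeff p T t j = PerfectClosure.of (RT T) p (MvPolynomial.X (t, j)) :=
      dif_pos j.2
    exact congrArg (fun y => h.red S (algebraMap (RTpf p T) S.obj y)) h2.symm

/-- The component `S → U(V(S))` of the unit. -/
def unitApp (h : IsCoefficientSystem hπ V κ) (S : PAlg p (RTpf p T)) :
    S ⟶ (U hπ T).obj (V.obj S) :=
  ObjectProperty.homMk (homToAlgOfRingHom S.obj (h.red S) (h.red_comp_algebraMap S))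

theorem unitApp_apply (h : IsCoefficientSystem hπ V κ) (S : PAlg p (RTpf p T)) (x : S.obj) :
    U.toRed hπ T _ ((h.unitApp S).hom.hom x) =
      Ideal.Quotient.mk (pIdeal A (V.obj S).obj) (κ S x) := rfl

/-- The values of `κ` represent the whole reduction of `V(S)`, so all identities between morphisms
out of `V(S)` can be tested on them, modulo the ideal. -/
theorem hom_ext (h : IsCoefficientSystem hπ V κ) {S : PAlg p (RTpf p T)} {B : CRP p A}
    {f g : V.obj S ⟶ B}
    (hfg : ∀ x, Ideal.Quotient.mk (pIdeal A B.obj) (CRP.toAlgHom f (κ S x)) =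
      Ideal.Quotient.mk (pIdeal A B.obj) (CRP.toAlgHom g (κ S x))) : f = g := by
  refine CRP.hom_ext fun y => ?_
  obtain ⟨x, rfl⟩ := (h.bijective S).2 y
  exact hfg x

variable {ε : ∀ B : CRP p A, V.obj ((U hπ T).obj B) ⟶ B}

/-- The adjunction whose unit is given by the coefficient maps. -/
def adjunction (h : IsCoefficientSystem hπ V κ)
    (hε : ∀ B x, Ideal.Quotient.mk (pIdeal A B.obj) (CRP.toAlgHom (ε B) (κ _ x)) =
      U.toRed hπ T B x) : V ⊣ U hπ T where
  unit :=
    { app := h.unitApp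
      naturality := fun S S' f => ObjectProperty.hom_ext _ (CommAlgCat.hom_ext
        (AlgHom.ext fun x => by
          change Ideal.Quotient.mk (pIdeal A (V.obj S').obj) (κ S' (f.hom.hom x)) =
            redMap (CRP.toAlgHom (V.map f)) (Ideal.Quotient.mk _ (κ S x))
          rw [redMap_mk, h.natural])) }
  counit :=
    { app := ε
      naturality := fun B B' f => h.hom_ext fun x => by
        change Ideal.Quotient.mk (pIdeal A B'.obj) (CRP.toAlgHom (ε B')
          (CRP.toAlgHom (V.map ((U hπ T).map f)) (κ _ x))) =
          Ideal.Quotient.mk (pIdeal A B'.obj) (CRP.toAlgHom f (CRP.toAlgHom (ε B) (κ _ x)))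
        rw [h.natural, hε, ← redMap_mk, hε]
        rfl }
  left_triangle_components S := h.hom_ext fun x => by
    change Ideal.Quotient.mk _ (CRP.toAlgHom (ε (V.obj S))
      (CRP.toAlgHom (V.map (h.unitApp S)) (κ _ x))) = Ideal.Quotient.mk _ (κ S x)
    rw [h.natural, hε, unitApp_apply]
  right_triangle_components B := ObjectProperty.hom_ext _ (CommAlgCat.hom_ext
    (AlgHom.ext fun x => by
      change redMap (CRP.toAlgHom (ε B)) (Ideal.Quotient.mk _ (κ _ x)) = U.toRed hπ T B x
      rw [redMap_mk, hε]))

theorem exists_adjunction (h : IsCoefficientSystem hπ V κ)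
    (hε : ∀ B x, Ideal.Quotient.mk (pIdeal A B.obj) (CRP.toAlgHom (ε B) (κ _ x)) =
      U.toRed hπ T B x) :
    ∃ adj : V ⊣ U hπ T, IsIso adj.unit ∧ IsIso adj.counit ∧
      (∀ S x, U.toRed hπ T _ ((adj.unit.app S).hom.hom x) =
        Ideal.Quotient.mk (pIdeal A (V.obj S).obj) (κ S x)) ∧
      (∀ B, adj.counit.app B = ε B) ∧ DescribesUniversalAndGeneric T V := by
  have h1 : IsIso (h.adjunction hε).unit := by
    rw [NatTrans.isIso_iff_isIso_app]
    exact fun S => PAlg.isIso_of_bijective _ (h.bijective S)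
  have h2 : IsIso (h.adjunction hε).counit := by
    rw [NatTrans.isIso_iff_isIso_app]
    refine fun B => CRP.isIso_of_bijective _ ?_
    -- After composition with the bijection given by `κ`, the reduction of the counit becomes the
    -- identity.
    refine (Function.Bijective.of_comp_iff _ (h.bijective _)).1 ?_
    have : (redMap (CRP.toAlgHom ((h.adjunction hε).counit.app B))) ∘
        (fun x => Ideal.Quotient.mk _ (κ ((U hπ T).obj B) x)) = U.toRed hπ T B :=
      funext fun x => hε B x
    exact (congrArg Function.Bijective this).mpr (U.toRed hπ T B).bijective
  exact ⟨h.adjunction hε, h1, h2, fun _ _ => rfl, fun _ => rfl,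
    describesUniversalAndGeneric (h.adjunction hε)⟩

end IsCoefficientSystem

end Explicit

end

end ResidualPerfection

/-! ### Values of the structure map; the equal characteristic case -/

namespace ResidualPerfection

noncomputable section

theorem IsPerfect.of_bijective {p : ℕ} {S S' : Type*} [CommRing S] [CommRing S']
    (hS : IsPerfect p S) (f : S →+* S') (hf : Function.Bijective f) : IsPerfect p S' := by
  refine ⟨by rw [← map_natCast f, hS.1, map_zero], fun x y hxy => ?_, fun y => ?_⟩
  · obtain ⟨x, rfl⟩ := hf.2 x
    obtain ⟨y, rfl⟩ := hf.2 y
    simp only [← map_pow] at hxy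
    rw [hS.2.1 (hf.1 hxy)]
  · obtain ⟨x, rfl⟩ := hf.2 y
    obtain ⟨z, rfl⟩ := hS.2.2 x
    exact ⟨f z, (map_pow f z p).symm⟩

section Explicit

variable {p : ℕ} [Fact p.Prime] {A : Type u} [CommRing A] [IsDomain A]
  [IsDiscreteValuationRing A] [CharP (IsLocalRing.ResidueField A) p] {π : A} {T : Set A}

/-! ### Values of the structure map -/

theorem structureMap_res (hπ : Irreducible π) (B : CRP p A) (r : IsLocalRing.ResidueField A) :
    B.structureMap hπ T (resToRTpf p T r) = resToRed A B.obj r := by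
  have h := RingHom.congr_fun (perfectLift_comp_of p B.property.perfect
    (MvPolynomial.eval₂Hom (resToRed A B.obj)
      (fun tj : T × ℕ+ => B.coeff hπ (algebraMap A B.obj tj.1) tj.2))) (MvPolynomial.C r)
  rw [MvPolynomial.coe_eval₂Hom, MvPolynomial.eval₂_C] at h
  exact h

theorem CRP.coeff_zero (hπ : Irreducible π) (B : CRP p A) (x : B.obj) :
    B.coeff hπ x 0 = Ideal.Quotient.mk (pIdeal A B.obj) x := by
  have h := (B.isAdicSum_coeff hπ x).eq_of_first
  rw [← Ideal.Quotient.eq, B.mk_sec] at h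
  exact h.symm

theorem structureMap_uCoeff (hπ : Irreducible π) (B : CRP p A) (t : T) (j : ℕ) :
    B.structureMap hπ T (uCoeff p T t j) = B.coeff hπ (algebraMap A B.obj t) j := by
  rcases Nat.eq_zero_or_pos j with rfl | hj
  · have h : uCoeff p T t 0 = resToRTpf p T (IsLocalRing.residue A t) := dif_neg (lt_irrefl 0)
    rw [h, structureMap_res, CRP.coeff_zero]
    rfl
  · have h1 : uCoeff p T t j = PerfectClosure.of (RT T) p (MvPolynomial.X (t, ⟨j, hj⟩)) :=
      dif_pos hj
    have h := RingHom.congr_fun (perfectLift_comp_of p B.property.perfect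
      (MvPolynomial.eval₂Hom (resToRed A B.obj)
        (fun tj : T × ℕ+ => B.coeff hπ (algebraMap A B.obj tj.1) tj.2)))
        (MvPolynomial.X (t, ⟨j, hj⟩))
    rw [MvPolynomial.coe_eval₂Hom, MvPolynomial.eval₂_X] at h
    rw [h1]
    exact h

theorem CRP.algebraMap_uniformizer_mem (hπ : Irreducible π) (B : CRP p A) :
    algebraMap A B.obj π ∈ pIdeal A B.obj := by
  rw [pIdeal_eq_span hπ]; exact Ideal.mem_span_singleton_self _

theorem CRP.isCompleteFiltration (B : CRP p A) :
    IsCompleteFiltration p (fun n => pIdeal A B.obj ^ n) :=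
  isCompleteFiltration_pow B.property.complete B.p_mem

theorem residue_eq_zero_iff_mem_pow_one (x : A) :
    IsLocalRing.residue A x = 0 ↔ x ∈ IsLocalRing.maximalIdeal A ^ 1 := by
  rw [pow_one]; exact IsLocalRing.residue_eq_zero_iff x

/-! ### The coefficient field in equal characteristic -/

section Equal

/-- The lifting principle for the residue field as its own lift, with `T` as the prescribed values
in `A`. -/
theorem exists_coefficientField [IsAdicComplete (IsLocalRing.maximalIdeal A) A] [CharP A p]
    (hT : IsPBasis p (fun t : T => IsLocalRing.residue A t)) :
    ∃ σ : IsLocalRing.ResidueField A →+* A, (∀ x, IsLocalRing.residue A (σ x) = x) ∧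
      ∀ t : T, σ (IsLocalRing.residue A t) = t := by
  have hp : (p : A) = 0 := CharP.cast_eq_zero A p
  obtain ⟨σ, h1, h2⟩ := exists_ringHom_lift
    (hT.isFrobBasis (Fact.out : p.Prime).ne_zero) (CharP.cast_eq_zero _ p)
    (ρ := RingHom.id (IsLocalRing.ResidueField A)) Function.surjective_id
    (fun c hc => by change c = 0 at hc; rw [hc]; exact dvd_zero _)
    (t := fun t : T => IsLocalRing.residue A t) (fun _ => rfl)
    (isCompleteFiltration_pow (p := p) (I := IsLocalRing.maximalIdeal A) inferInstance
      (by rw [hp]; exact zero_mem _)) (q := IsLocalRing.residue A) IsLocalRing.residue_surjective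
    residue_eq_zero_iff_mem_pow_one (RingHom.id _) (fun t : T => (t : A)) (fun _ => rfl) (Or.inr hp)
  exact ⟨σ, h1, h2⟩

theorem exists_eq_add_uniformizer_mul (hπ : Irreducible π) {x y : A}
    (h : IsLocalRing.residue A x = IsLocalRing.residue A y) : ∃ z, x = y + π * z := by
  have h1 : x - y ∈ IsLocalRing.maximalIdeal A := by
    rw [← IsLocalRing.residue_eq_zero_iff, map_sub, h, sub_self]
  rw [hπ.maximalIdeal_eq, Ideal.mem_span_singleton] at h1
  obtain ⟨z, hz⟩ := h1
  exact ⟨z, by rw [← hz]; ring⟩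

/-- Uniqueness of lifts settles the coefficient field. Writing `a = σ(ā) + π z` leaves the
difference at `z` multiplied by `φ' π`, which raises the degree. -/
theorem equal_ringHom_ext [IsAdicComplete (IsLocalRing.maximalIdeal A) A] [CharP A p]
    (hπ : Irreducible π) (hT : IsPBasis p (fun t : T => IsLocalRing.residue A t)) {D : Type*}
    [CommRing D] {J : ℕ → Ideal D} (hJ : IsCompleteFiltration p J) (hJ0 : J 0 = ⊤)
    {φ φ' : A →+* D}
    (h1 : ∀ a, φ a - φ' a ∈ J 1) (h2 : ∀ t : T, φ t = φ' t) (h3 : φ π = φ' π) (h4 : φ' π ∈ J 1) :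
    φ = φ' := by
  obtain ⟨σ, hσ, hσt⟩ := exists_coefficientField hT
  have h5 : φ.comp σ = φ'.comp σ := ringHom_ext_of_isFrobBasis
    (hT.isFrobBasis (Fact.out : p.Prime).ne_zero)
    (ρ := RingHom.id (IsLocalRing.ResidueField A)) Function.surjective_id
    (fun c hc => by change c = 0 at hc; rw [hc]; exact dvd_zero _)
    (t := fun t : T => IsLocalRing.residue A t) (fun _ => rfl)
    hJ.toIsFiltration hJ.eq_zero (fun c => h1 _) (fun t => by
      rw [RingHom.comp_apply, RingHom.comp_apply, hσt, h2])
  have key : ∀ n a, φ a - φ' a ∈ J n := by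
    intro n
    induction n with
    | zero => intro a; rw [hJ0]; trivial
    | succ n ih =>
      intro a
      obtain ⟨z, hz⟩ := exists_eq_add_uniformizer_mul hπ (hσ (IsLocalRing.residue A a)).symm
      have e : φ a - φ' a = φ' π * (φ z - φ' z) := by
        rw [hz, map_add, map_add, map_mul, map_mul, h3]
        linear_combination RingHom.congr_fun h5 (IsLocalRing.residue A a)
      rw [e, add_comm]
      exact hJ.mul_mem h4 (ih z)
  ext a
  exact sub_eq_zero.1 (hJ.eq_zero _ fun n => key n a)

theorem exists_equal_seriesEquiv [IsAdicComplete (IsLocalRing.maximalIdeal A) A]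
    (hπ : Irreducible π) {σ : IsLocalRing.ResidueField A →+* A}
    (hσ : ∀ x, IsLocalRing.residue A (σ x) = x) :
    ∃ e : PowerSeries (IsLocalRing.ResidueField A) ≃+* A,
      e PowerSeries.X = π ∧ (∀ x, e (PowerSeries.C x) = σ x) ∧
      ∀ f, IsLocalRing.residue A (e f) = PowerSeries.constantCoeff f := by
  have hI : IsAdicComplete (IsLocalRing.maximalIdeal A) A := inferInstance
  have hπm : π ∈ IsLocalRing.maximalIdeal A := by
    rw [hπ.maximalIdeal_eq]; exact Ideal.mem_span_singleton_self _
  obtain ⟨ev, hev⟩ := exists_seriesEval hI hπm σ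
  have hc := existsUnique_coeffs (B := A) hπ.maximalIdeal_eq
    (fun x y h => mul_left_cancel₀ hπ.ne_zero h) (s := σ) hσ
  have hbij : Function.Bijective ev := by
    constructor
    · intro f g hfg
      ext i
      exact congrFun ((hc (ev f)).unique (y₁ := fun i => PowerSeries.coeff i f)
        (y₂ := fun i => PowerSeries.coeff i g) (hev f) (by rw [hfg]; exact hev g)) i
    · intro a
      obtain ⟨c, hc⟩ : ∃ c : ℕ → IsLocalRing.ResidueField A,
        IsAdicSum (IsLocalRing.maximalIdeal A) π (fun i => σ (c i)) a := (hc a).exists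
      refine ⟨PowerSeries.mk c, (hev _).unique ?_⟩
      simpa only [PowerSeries.coeff_mk] using hc
  refine ⟨RingEquiv.ofBijective ev hbij, isAdicSum_X inferInstance hπm (hev _),
    fun x => isAdicSum_C inferInstance (hev _), fun f => ?_⟩
  have h1 := (hev f).eq_of_first
  change IsLocalRing.residue A (ev f) = _
  rw [← IsLocalRing.residue_eq_zero_iff, map_sub, hσ, sub_eq_zero] at h1
  rw [h1, PowerSeries.coeff_zero_eq_constantCoeff_apply]

theorem equalMapsExistUnique [IsAdicComplete (IsLocalRing.maximalIdeal A) A] [CharP A p]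
    (hπ : Irreducible π) (hT : IsPBasis p (fun t : T => IsLocalRing.residue A t)) :
    EqualMapsExistUnique p π T := by
  intro S
  have hS : IsPerfect p S.obj := S.property
  have hF := isCompleteFiltration_series hS.isCompleteFiltration_bot (by simp)
  have hq : ∀ f : PowerSeries S.obj, PowerSeries.constantCoeff f = 0 ↔
      f ∈ seriesFiltration hS.isCompleteFiltration_bot.anti 1 := fun f => by
    rw [mem_seriesFiltration_one (by simp), pow_one, Ideal.mem_bot]
  refine existsUnique_of_exists_of_unique ?_ fun φ φ' h h' => ?_
  · obtain ⟨σ, hσ, hσt⟩ := exists_coefficientField hT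
    obtain ⟨e, heX, heC, her⟩ := exists_equal_seriesEquiv hπ hσ
    have hpS : (p : PowerSeries S.obj) = 0 := by
      rw [← map_natCast (PowerSeries.C : S.obj →+* _), hS.1, map_zero]
    obtain ⟨g, hg, hgt⟩ := exists_ringHom_lift
      (hT.isFrobBasis (Fact.out : p.Prime).ne_zero) (CharP.cast_eq_zero _ p)
      (ρ := RingHom.id (IsLocalRing.ResidueField A)) Function.surjective_id
      (fun c hc => by change c = 0 at hc; rw [hc]; exact dvd_zero _)
      (t := fun t : T => IsLocalRing.residue A t)
      (fun _ => rfl) hF (q := PowerSeries.constantCoeff) PowerSeries.constantCoeff_surj hq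
      ((algebraMap (RTpf p T) S.obj).comp (resToRTpf p T))
      (fun t => PowerSeries.mk fun j => algebraMap (RTpf p T) S.obj (uCoeff p T t j))
      (fun t => by
        rw [← PowerSeries.coeff_zero_eq_constantCoeff_apply, PowerSeries.coeff_mk]
        exact congrArg _ (dif_neg (lt_irrefl 0)))
      (Or.inr hpS)
    -- The lift `g` of the coefficient field extends to `A`, viewed as a power series ring over that
    -- field, by sending the variable to `X`.
    obtain ⟨ev, hev⟩ := exists_seriesEval (isAdicComplete_X (W := S.obj))
      (Ideal.mem_span_singleton_self _) g
    have hH : IsHausdorff (Ideal.span {(PowerSeries.X : PowerSeries S.obj)})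
      (PowerSeries S.obj) := isAdicComplete_X.toIsHausdorff
    refine ⟨ev.comp e.symm.toRingHom, ?_, fun a => ?_, fun t => ?_⟩
    · rw [← heX]
      simpa using isAdicSum_X hH (Ideal.mem_span_singleton_self _) (hev PowerSeries.X)
    · obtain ⟨f, rfl⟩ := e.surjective a
      rw [her]
      have h1 := (hev f).eq_of_first
      rw [Ideal.mem_span_singleton, PowerSeries.X_dvd_iff, map_sub, sub_eq_zero, hg] at h1
      simpa using h1
    · rw [← hσt t, ← heC]
      have h1 := isAdicSum_C hH (hev (PowerSeries.C (IsLocalRing.residue A t)))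
      rw [hgt] at h1
      simpa using h1
  · refine equal_ringHom_ext hπ hT hF ?_ (fun a => ?_) (fun t => ?_) ?_ ?_
    · ext f; simp [mem_seriesFiltration]
    · rw [← hq, map_sub, h.reduction, h'.reduction, sub_self]
    · rw [h.map_lift, h'.map_lift]
    · rw [h.map_uniformizer, h'.map_uniformizer]
    · rw [h'.map_uniformizer, ← hq, PowerSeries.constantCoeff_X]

variable (hφ : EqualMapsExistUnique p π T) (S : PAlg p (RTpf p T))

theorem equalMap_spec : IsEqualMap p π T S.obj (equalMap hφ S) := (hφ S).choose_spec.1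

theorem VEqual.algebraMap_apply (a : A) :
    algebraMap A ((VEqual hφ).obj S) a = VEqual.ofSeries hφ S (equalMap hφ S a) := rfl

theorem VEqual.pIdeal_eq (hπ : Irreducible π) : pIdeal A ((VEqual hφ).obj S) =
    (Ideal.span {(PowerSeries.X : PowerSeries S.obj)} : Ideal (PowerSeries S.obj)) := by
  rw [pIdeal_eq_span hπ, VEqual.algebraMap_apply, (equalMap_spec hφ S).map_uniformizer]
  rfl

theorem VEqual.ofSeries_mem_pIdeal (hπ : Irreducible π) (f : PowerSeries S.obj) :
    VEqual.ofSeries hφ S f ∈ pIdeal A ((VEqual hφ).obj S) ↔ PowerSeries.constantCoeff f = 0 := by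
  rw [VEqual.pIdeal_eq hφ S hπ, ← PowerSeries.X_dvd_iff]
  exact Ideal.mem_span_singleton (α := PowerSeries S.obj)

theorem VEqual.mk_C_bijective (hπ : Irreducible π) : Function.Bijective
    ((Ideal.Quotient.mk (pIdeal A ((VEqual hφ).obj S))).comp
      ((VEqual.ofSeries hφ S).toRingHom.comp PowerSeries.C)) := by
  constructor
  · rw [injective_iff_map_eq_zero]
    intro x hx
    have hx : VEqual.ofSeries hφ S (PowerSeries.C x) ∈ pIdeal A ((VEqual hφ).obj S) :=
      Ideal.Quotient.eq_zero_iff_mem.1 hx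
    rw [VEqual.ofSeries_mem_pIdeal hφ S hπ] at hx
    simpa using hx
  · intro y
    obtain ⟨y, rfl⟩ := Ideal.Quotient.mk_surjective y
    obtain ⟨f, rfl⟩ := (VEqual.ofSeries hφ S).surjective y
    refine ⟨PowerSeries.constantCoeff f, Ideal.Quotient.eq.2 ?_⟩
    change VEqual.ofSeries hφ S (PowerSeries.C (PowerSeries.constantCoeff f)) -
      VEqual.ofSeries hφ S f ∈ _
    rw [← map_sub, VEqual.ofSeries_mem_pIdeal hφ S hπ]
    simp

theorem VEqual.isCRP (hπ : Irreducible π) : isCRP p A ((VEqual hφ).obj S) where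
  flat := by
    refine flat_of_uniformizer_regular hπ fun x hx => ?_
    rw [VEqual.algebraMap_apply, (equalMap_spec hφ S).map_uniformizer] at hx
    exact PowerSeries.X_mul_cancel (R := S.obj) (hx.trans (mul_zero _).symm)
  complete := by
    rw [VEqual.pIdeal_eq hφ S hπ]
    exact isAdicComplete_X (W := S.obj)
  perfect := IsPerfect.of_bijective S.property _ (VEqual.mk_C_bijective hφ S hπ)

/-- The constant series, as a multiplicative map `S → V(S)`. -/
def VEqual.const : S.obj →* (VEqual hφ).obj S :=
  ((VEqual.ofSeries hφ S).toRingHom.comp PowerSeries.C : S.obj →+* (VEqual hφ).obj S)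

theorem VEqual.isCoefficientSystem (hπ : Irreducible π) :
    IsCoefficientSystem hπ ((ResidualPerfection.isCRP p A).lift (VEqual hφ)
      (fun S => VEqual.isCRP hφ S hπ)) (VEqual.const hφ) where
  natural {S S'} f x := PowerSeries.map_C (R := S.obj) (S := S'.obj) f.hom.hom.toRingHom x
  bijective S := VEqual.mk_C_bijective hφ S hπ
  map_add S x y := by
    have : VEqual.const hφ S (x + y) = VEqual.const hφ S x + VEqual.const hφ S y :=
      map_add (PowerSeries.C : S.obj →+* _) x y
    change VEqual.const hφ S (x + y) - (VEqual.const hφ S x + VEqual.const hφ S y) ∈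
      pIdeal A ((VEqual hφ).obj S)
    rw [this, sub_self]
    exact zero_mem _
  residue S a := by
    change (equalMap hφ S a - PowerSeries.C (algebraMap (RTpf p T) S.obj (resToRTpf p T
      (IsLocalRing.residue A a))) : PowerSeries S.obj) ∈ pIdeal A ((VEqual hφ).obj S)
    rw [VEqual.pIdeal_eq hφ S hπ, ← (equalMap_spec hφ S).reduction]
    refine Ideal.mem_span_singleton.2 (PowerSeries.X_dvd_iff.2 ?_)
    simp
  expansion S t n := by
    change (equalMap hφ S t - ∑ i ∈ Finset.range n, PowerSeries.C (algebraMap (RTpf p T) S.obj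
      (uCoeff p T t i)) * equalMap hφ S π ^ i : PowerSeries S.obj) ∈
      pIdeal A ((VEqual hφ).obj S) ^ n
    rw [VEqual.pIdeal_eq hφ S hπ, (equalMap_spec hφ S).map_lift,
      (equalMap_spec hφ S).map_uniformizer]
    refine mem_span_X_pow.2 fun i hi => ?_
    rw [map_sub, map_sum, PowerSeries.coeff_mk, Finset.sum_eq_single i]
    · simp [PowerSeries.coeff_C_mul, PowerSeries.coeff_X_pow]
    · intro j _ hj
      simp [PowerSeries.coeff_C_mul, PowerSeries.coeff_X_pow, hj.symm]
    · intro h; exact absurd (Finset.mem_range.2 hi) h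

/-- As `p = 0` in `B`, uniqueness makes `s_B` a ring map, so the series can be evaluated by a ring
map. Its compatibility with `A` follows from `equal_ringHom_ext`, by comparing residues, expansions
of `T` and the uniformizer. -/
theorem CRP.exists_equal_counit [IsAdicComplete (IsLocalRing.maximalIdeal A) A] [CharP A p]
    (hπ : Irreducible π) (hT : IsPBasis p (fun t : T => IsLocalRing.residue A t)) (B : CRP p A) :
    ∃ ε : (VEqual hφ).obj ((U hπ T).obj B) ⟶ B.obj, ∀ f : PowerSeries ((U hπ T).obj B).obj,
      IsAdicSum (pIdeal A B.obj) (algebraMap A B.obj π)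
        (fun i => B.sec (U.toRed hπ T B (PowerSeries.coeff i f)))
        (ε.hom (VEqual.ofSeries hφ _ f)) := by
  have hB := B.property.complete
  have hpB : (p : B.obj) = 0 := by
    rw [← map_natCast (algebraMap A B.obj), CharP.cast_eq_zero A p, map_zero]
  obtain ⟨σ, hσ⟩ := exists_ringSection hB B.property.perfect hpB
  have hσs : (σ : Red A B.obj →* B.obj) = B.sec :=
    B.existsUnique_section.unique hσ B.mk_sec
  have hσs : ∀ x, B.sec x = σ x := fun x => (DFunLike.congr_fun hσs x).symm
  obtain ⟨ev, hev⟩ := exists_seriesEval hB (B.algebraMap_uniformizer_mem hπ)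
    (σ.comp (U.toRed hπ T B).toRingHom)
  let S := (U hπ T).obj B
  have hcomp : ev.comp (equalMap hφ S) = algebraMap A B.obj := by
    refine equal_ringHom_ext hπ hT B.isCompleteFiltration (by simp) (fun a => ?_) (fun t => ?_)
      ?_ ?_
    · rw [pow_one, ← Ideal.Quotient.eq, RingHom.comp_apply]
      have h1 := Ideal.Quotient.eq.2 (hev (equalMap hφ S a)).eq_of_first
      refine h1.trans ((hσ _).trans ?_)
      rw [PowerSeries.coeff_zero_eq_constantCoeff_apply, (equalMap_spec hφ S).reduction]
      exact structureMap_res hπ B _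
    · have h1 := hev (equalMap hφ S t)
      rw [(equalMap_spec hφ S).map_lift] at h1
      refine IsAdicSum.unique (I := pIdeal A B.obj) (ϖ := algebraMap A B.obj π)
        (c := fun i => B.sec (B.coeff hπ (algebraMap A B.obj t) i)) ?_ (B.isAdicSum_coeff hπ _)
      simp only [PowerSeries.coeff_mk] at h1
      simp only [← structureMap_uCoeff, hσs]
      rw [RingHom.comp_apply, (equalMap_spec hφ S).map_lift]
      exact h1
    · rw [RingHom.comp_apply, (equalMap_spec hφ S).map_uniformizer]
      exact isAdicSum_X inferInstance (B.algebraMap_uniformizer_mem hπ) (hev _)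
    · rw [pow_one]; exact B.algebraMap_uniformizer_mem hπ
  let ε : (VEqual hφ).obj S ⟶ B.obj :=
    letI := (equalMap hφ S).toAlgebra
    CommAlgCat.ofHom (X := PowerSeries S.obj)
      { toRingHom := ev, commutes' := fun a => RingHom.congr_fun hcomp a }
  refine ⟨ε, fun f => ?_⟩
  simp only [hσs]
  exact hev f

/-- In equal characteristic, `V` and `U` form an adjoint equivalence. -/
theorem exists_equal_adjunction [IsAdicComplete (IsLocalRing.maximalIdeal A) A] [CharP A p]
    (hπ : Irreducible π) (hT : IsPBasis p (fun t : T => IsLocalRing.residue A t)) :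
    ∃ (hφ : EqualMapsExistUnique p π T)
      (hV : ∀ S, isCRP p A ((VEqual hφ).obj S))
      (adj : (isCRP p A).lift (VEqual hφ) hV ⊣ U hπ T),
      IsIso adj.unit ∧ IsIso adj.counit ∧
      (∀ (S : PAlg p (RTpf p T)) (x : S.obj),
        U.toRed hπ T _ ((adj.unit.app S).hom.hom x) =
          Ideal.Quotient.mk (pIdeal A ((VEqual hφ).obj S))
            (VEqual.ofSeries hφ S (PowerSeries.C x))) ∧
      (∀ (B : CRP p A) (f : PowerSeries ((U hπ T).obj B).obj),
        IsAdicSum (pIdeal A B.obj) (algebraMap A B.obj π)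
          (fun i => B.sec (U.toRed hπ T B (PowerSeries.coeff i f)))
          ((adj.counit.app B).hom.hom (VEqual.ofSeries hφ _ f))) ∧
      DescribesUniversalAndGeneric T ((isCRP p A).lift (VEqual hφ) hV) := by
  have hφ := equalMapsExistUnique (p := p) hπ hT
  have hκ := VEqual.isCoefficientSystem hφ hπ
  choose ε hε using CRP.exists_equal_counit hφ hπ hT
  obtain ⟨adj, h1, h2, h3, h4, h5⟩ := hκ.exists_adjunction
    (ε := fun B => ObjectProperty.homMk (ε B)) (fun B x => by
      have h := Ideal.Quotient.eq.2 (hε B (PowerSeries.C x)).eq_of_first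
      rw [B.mk_sec, PowerSeries.coeff_zero_C] at h
      exact h)
  refine ⟨hφ, _, adj, h1, h2, h3, fun B f => ?_, h5⟩
  rw [h4]
  exact hε B f

end Equal

end Explicit

end

end ResidualPerfection

/-! ### The Cohen subring in mixed characteristic -/

namespace ResidualPerfection

noncomputable section

section Cohen

variable {p : ℕ} [Fact p.Prime] {A : Type u} [CommRing A] [IsDomain A]
  [IsDiscreteValuationRing A] [CharP (IsLocalRing.ResidueField A) p] {π : A} {T : Set A}

/-! ### Ramification of `p` -/

theorem natCast_p_mem_maximalIdeal : (p : A) ∈ IsLocalRing.maximalIdeal A := by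
  rw [← IsLocalRing.residue_eq_zero_iff, map_natCast, CharP.cast_eq_zero]

theorem exists_p_eq_unit_mul_pow [CharZero A] (hπ : Irreducible π) :
    ∃ (e : ℕ) (u : Aˣ), 0 < e ∧ (p : A) = u * π ^ e := by
  have hp : (p : A) ≠ 0 := Nat.cast_ne_zero.2 (Fact.out : p.Prime).ne_zero
  obtain ⟨e, u, h⟩ := IsDiscreteValuationRing.eq_unit_mul_pow_irreducible hp hπ
  refine ⟨e, u, Nat.pos_of_ne_zero fun he => ?_, h⟩
  subst he
  have h1 := natCast_p_mem_maximalIdeal (p := p) (A := A)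
  rw [h, pow_zero, mul_one] at h1
  exact h1 u.isUnit

theorem mem_maximalIdeal_pow (hπ : Irreducible π) {n : ℕ} {x : A} :
    x ∈ IsLocalRing.maximalIdeal A ^ n ↔ π ^ n ∣ x := by
  rw [hπ.maximalIdeal_eq, Ideal.span_singleton_pow, Ideal.mem_span_singleton]

theorem p_pow_dvd_of_pow_dvd {e n : ℕ} {u : Aˣ} (h : (p : A) = u * π ^ e) {x : A}
    (hx : π ^ (e * n) ∣ x) : (p : A) ^ n ∣ x := by
  rw [h, mul_pow, ← pow_mul]
  exact ((u.isUnit.pow n).mul_left_dvd).2 hx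

theorem pow_dvd_of_p_mul {e n : ℕ} {u : Aˣ} (hπ : Irreducible π) (h : (p : A) = u * π ^ e) {x : A}
    (hx : π ^ (n + e) ∣ p * x) : π ^ n ∣ x := by
  rw [h, mul_assoc, u.isUnit.dvd_mul_left, pow_add, mul_comm] at hx
  exact (mul_dvd_mul_iff_left (pow_ne_zero e hπ.ne_zero)).1 hx

/-! ### Subrings with maximal ideal generated by `p` -/

/-- Factors `p` are removed one at a time by `hdiv`, as `p` cancels in `A`. Thus divisibility by `p
^ n` means the same in `C` as in `A`, which links the p-adic topology of `C` with that of `A`. -/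
theorem mem_of_p_pow_mul_mem [CharZero A] {C : Subring A}
    (hdiv : ∀ x ∈ C, IsLocalRing.residue A x = 0 → ∃ y ∈ C, x = p * y) {n : ℕ} {x : A}
    (h : (p : A) ^ n * x ∈ C) : x ∈ C := by
  have hp : (p : A) ≠ 0 := Nat.cast_ne_zero.2 (Fact.out : p.Prime).ne_zero
  induction n with
  | zero => simpa using h
  | succ n ih =>
    obtain ⟨y, hy, hxy⟩ := hdiv _ h (by
      rw [map_mul, map_pow, map_natCast, CharP.cast_eq_zero, zero_pow (Nat.succ_ne_zero n),
        zero_mul])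
    rw [pow_succ', mul_assoc] at hxy
    rw [← mul_left_cancel₀ hp hxy] at hy
    exact ih hy

theorem irreducible_p_of_subring [CharZero A] {C : Subring A}
    (hdiv : ∀ x ∈ C, IsLocalRing.residue A x = 0 → ∃ y ∈ C, x = p * y)
    (hinv : ∀ x ∈ C, IsLocalRing.residue A x ≠ 0 → ∃ y ∈ C, x * y = 1) :
    Irreducible (p : C) := by
  have hp : (p : A) ≠ 0 := Nat.cast_ne_zero.2 (Fact.out : p.Prime).ne_zero
  have hr : IsLocalRing.residue A (p : A) = 0 := by rw [map_natCast, CharP.cast_eq_zero]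
  have hunit : ∀ x : C, IsLocalRing.residue A (x : A) ≠ 0 → IsUnit x := fun x hx => by
    obtain ⟨y, hy, hxy⟩ := hinv x x.2 hx
    exact IsUnit.of_mul_eq_one ⟨y, hy⟩ (Subtype.ext hxy)
  refine ⟨fun h => ?_, fun x y hxy => ?_⟩
  · have h1 : IsUnit (IsLocalRing.residue A ((p : C) : A)) :=
      h.map ((IsLocalRing.residue A).comp C.subtype)
    rw [Subring.coe_natCast, hr] at h1
    exact not_isUnit_zero h1
  · by_contra hcon
    rw [not_or] at hcon
    obtain ⟨x', -, hx'⟩ := hdiv x x.2 (not_not.1 (mt (hunit x) hcon.1))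
    obtain ⟨y', -, hy'⟩ := hdiv y y.2 (not_not.1 (mt (hunit y) hcon.2))
    have h1 : (p : A) = x * y := congrArg Subtype.val hxy
    have h2 : (1 : A) = p * (x' * y') := by
      apply mul_left_cancel₀ hp
      rw [hx', hy'] at h1
      linear_combination h1
    have h3 := congrArg (IsLocalRing.residue A) h2
    rw [map_one, map_mul, hr, zero_mul] at h3
    exact one_ne_zero h3

/-- Elements with nonzero residue are units and the others are divisible by `p`. Division stops
because each factor `p` lies in the maximal ideal of `A`, which is separated. -/
theorem isDiscreteValuationRing_of_subring [IsAdicComplete (IsLocalRing.maximalIdeal A) A]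
    [CharZero A] {C : Subring A}
    (hdiv : ∀ x ∈ C, IsLocalRing.residue A x = 0 → ∃ y ∈ C, x = p * y)
    (hinv : ∀ x ∈ C, IsLocalRing.residue A x ≠ 0 → ∃ y ∈ C, x * y = 1) :
    IsDiscreteValuationRing C := by
  refine IsDiscreteValuationRing.ofHasUnitMulPowIrreducibleFactorization
    ⟨(p : C), irreducible_p_of_subring hdiv hinv, fun {x} hx => ?_⟩
  obtain ⟨n, hn⟩ : ∃ n, (x : A) ∉ IsLocalRing.maximalIdeal A ^ n := by
    by_contra! h
    exact hx (Subtype.ext (eq_of_forall_sub_mem (IsLocalRing.maximalIdeal A)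
      (fun n => by simpa using h n)))
  induction n generalizing x with
  | zero => exact absurd (by simp) hn
  | succ n ih =>
    by_cases hr : IsLocalRing.residue A (x : A) = 0
    · obtain ⟨y, hy, hxy⟩ := hdiv x x.2 hr
      have hxy' : x = p * ⟨y, hy⟩ := Subtype.ext hxy
      obtain ⟨m, hm⟩ := ih (x := ⟨y, hy⟩) (fun h0 => hx (by rw [hxy', h0, mul_zero]))
        (fun h => hn (by
          rw [hxy, pow_succ']
          exact Ideal.mul_mem_mul natCast_p_mem_maximalIdeal h))
      refine ⟨m + 1, ?_⟩
      rw [hxy', pow_succ']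
      exact hm.mul_left _
    · obtain ⟨y, hy, hxy⟩ := hinv x x.2 hr
      refine ⟨0, ?_⟩
      rw [pow_zero]
      exact (associated_one_iff_isUnit.2
        (IsUnit.of_mul_eq_one ⟨y, hy⟩ (Subtype.ext hxy))).symm

theorem isAdicComplete_of_subring [IsAdicComplete (IsLocalRing.maximalIdeal A) A]
    [CharZero A] {C : Subring A}
    (hdiv : ∀ x ∈ C, IsLocalRing.residue A x = 0 → ∃ y ∈ C, x = p * y)
    (hclosed : ∀ x, (∀ n, ∃ y ∈ C, x - y ∈ IsLocalRing.maximalIdeal A ^ n) → x ∈ C) :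
    IsAdicComplete (Ideal.span {(p : C)}) C := by
  obtain ⟨π, hπ⟩ := IsDiscreteValuationRing.exists_irreducible A
  obtain ⟨e, u, he, hu⟩ := exists_p_eq_unit_mul_pow (p := p) hπ
  have hJ := isCompleteFiltration_pow (p := p) (I := IsLocalRing.maximalIdeal A)
    inferInstance natCast_p_mem_maximalIdeal
  have hsub : ∀ n (x : C), x ∈ Ideal.span {(p : C)} ^ n → ∃ z : A, (x : A) = p ^ n * z := by
    intro n x hx
    rw [Ideal.span_singleton_pow, Ideal.mem_span_singleton] at hx
    obtain ⟨z, rfl⟩ := hx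
    exact ⟨z, by push_cast; rfl⟩
  have hmem : ∀ n (x : C), x ∈ Ideal.span {(p : C)} ^ n →
      (x : A) ∈ IsLocalRing.maximalIdeal A ^ n := by
    intro n x hx
    obtain ⟨z, hz⟩ := hsub n x hx
    rw [hz]
    exact Ideal.mul_mem_right _ _ (Ideal.pow_mem_pow natCast_p_mem_maximalIdeal n)
  refine isAdicComplete_of_pow (fun x hx => Subtype.ext (hJ.eq_zero _ fun n => hmem n x (hx n)))
    fun x hx => ?_
  obtain ⟨L, hL⟩ := hJ.exists_limit (fun n => (x n : A)) fun n => hmem n _ (hx n)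
  have hLC : L ∈ C := hclosed L fun n => ⟨x n, (x n).2, hL n⟩
  have hx' : ∀ n k, x (n + k) - x n ∈ Ideal.span {(p : C)} ^ n := by
    intro n k
    induction k with
    | zero => simp
    | succ k ih =>
      have := add_mem (Ideal.pow_le_pow_right (Nat.le_add_right n k) (hx (n + k))) ih
      rwa [sub_add_sub_cancel] at this
  refine ⟨⟨L, hLC⟩, fun n => ?_⟩
  -- The limit is known only in the topology of `A`, where `p ^ n` has order `e * n`; going `e * n`
  -- terms further makes the error divisible by `p ^ n`.
  obtain ⟨z, hz⟩ := hsub n _ (hx' n (e * n))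
  have h1 := (mem_maximalIdeal_pow hπ).1 (Ideal.pow_le_pow_right (Nat.le_add_left (e * n) n)
    (hL (n + e * n)))
  obtain ⟨w, hw⟩ := p_pow_dvd_of_pow_dvd hu h1
  have h2 : L - x n = p ^ n * (z + w) := by
    push_cast at hz
    linear_combination hz + hw
  have h3 : z + w ∈ C := mem_of_p_pow_mul_mem hdiv (n := n) (by
    rw [← h2]; exact sub_mem hLC (x n).2)
  rw [Ideal.span_singleton_pow, Ideal.mem_span_singleton]
  exact ⟨⟨z + w, h3⟩, Subtype.ext (by push_cast; exact h2)⟩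

/-! ### Existence of the Cohen subring -/

theorem exists_isCohenSubring [IsAdicComplete (IsLocalRing.maximalIdeal A) A]
    [CharZero A] (hT : IsPBasis p (fun t : T => IsLocalRing.residue A t)) :
    ∃ C : Subring A, IsCohenSubring p T C := by
  obtain ⟨π, hπ⟩ := IsDiscreteValuationRing.exists_irreducible A
  obtain ⟨e, u, he, hu⟩ := exists_p_eq_unit_mul_pow (p := p) hπ
  have hp0 : (p : A) ≠ 0 := Nat.cast_ne_zero.2 (Fact.out : p.Prime).ne_zero
  let J : ℕ → Ideal A := fun n => IsLocalRing.maximalIdeal A ^ n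
  have hJ : IsCompleteFiltration p J := isCompleteFiltration_pow inferInstance
    natCast_p_mem_maximalIdeal
  have hb := hT.isFrobBasis (Fact.out : p.Prime).ne_zero
  let τ : T → A := fun t => t
  let G : Subring A := ⨅ n, tower p J τ n
  have memG : ∀ x, x ∈ G ↔ ∀ n, x ∈ tower p J τ n := fun x => Subring.mem_iInf
  have hclosed : ∀ x, (∀ n, ∃ y ∈ G, x - y ∈ J n) → x ∈ G := by
    intro x hx
    rw [memG]
    intro n
    obtain ⟨y, hy, hxy⟩ := hx (n + 1)
    have := add_mem (mem_tower_of_mem (p := p) (τ := τ) hxy) ((memG y).1 hy n)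
    rwa [sub_add_cancel] at this
  have hdiv : ∀ x ∈ G, IsLocalRing.residue A x = 0 → ∃ y ∈ G, x = p * y := by
    intro x hx hx0
    have h1 : ∀ n, ∃ y ∈ tower p J τ n, x - p * y ∈ J (n + 2) := fun n =>
      exists_eq_p_mul_of_mem_tower hJ.toIsFiltration (ρ := IsLocalRing.residue A)
        residue_eq_zero_iff_mem_pow_one hb (fun _ => rfl) ((memG x).1 hx (n + 1)) hx0
    choose y hy hxy using h1
    -- An approximation beyond order `e`, the order of `p`, suffices to divide `x` by `p` in `A`.
    have h2 : (p : A) ^ 1 ∣ x - p * y e := p_pow_dvd_of_pow_dvd hu (by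
      rw [mul_one]
      exact (pow_dvd_pow π (by omega)).trans ((mem_maximalIdeal_pow hπ).1 (hxy e)))
    obtain ⟨z, hz⟩ := h2
    rw [pow_one] at hz
    refine ⟨y e + z, (memG _).2 fun n => ?_, by linear_combination hz⟩
    -- Cancelling `p` costs `e` degrees, so the exact quotient is compared with the approximation of
    -- index `n + e`.
    have h3 : y e + z - y (n + e) ∈ J (n + 1) := by
      refine (mem_maximalIdeal_pow hπ).2 (pow_dvd_of_p_mul hπ hu ?_)
      have h4 := (mem_maximalIdeal_pow hπ).1 (hxy (n + e))
      refine (pow_dvd_pow π (by omega)).trans (h4.trans (dvd_of_eq ?_))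
      linear_combination hz
    have h5 := add_mem (mem_tower_of_mem (p := p) (τ := τ) h3)
      (tower_antitone hJ.toIsFiltration (Nat.le_add_right n e) (hy (n + e)))
    rwa [sub_add_cancel] at h5
  have hinv : ∀ x ∈ G, IsLocalRing.residue A x ≠ 0 → ∃ y ∈ G, x * y = 1 := by
    intro x hx hx0
    obtain ⟨y, hxy⟩ := (IsLocalRing.residue_ne_zero_iff_isUnit x).1 hx0 |>.exists_right_inv
    refine ⟨y, (memG y).2 fun n => ?_, hxy⟩
    have hpos : 0 < p ^ n := pow_pos (Fact.out : p.Prime).pos n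
    obtain ⟨m, hm⟩ := Nat.exists_eq_succ_of_ne_zero hpos.ne'
    -- With `m = p ^ n - 1`. The power `y ^ p ^ n` lies in level `n` for every `y` in `A`, so the
    -- inverse of `x` lies in every level.
    have e1 : y = x ^ m * y ^ p ^ n := by
      rw [hm, pow_succ, ← mul_assoc, ← mul_pow, hxy, one_pow, one_mul]
    rw [e1]
    exact mul_mem (pow_mem ((memG x).1 hx n) m) (pow_pow_mem_tower y n)
  have hres : ∀ x : A, ∃ g ∈ G, IsLocalRing.residue A g = IsLocalRing.residue A x := by
    intro x
    have hstep : ∀ n (y : tower p J τ n), ∃ z : tower p J τ (n + 1), (y : A) - z ∈ J (n + 1) :=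
      fun n y => by
        obtain ⟨z, hz, h⟩ := exists_mem_tower_succ hJ.toIsFiltration (ρ := IsLocalRing.residue A)
          IsLocalRing.residue_surjective (fun x => (residue_eq_zero_iff_mem_pow_one x).1) hb
          (fun _ => rfl) y.2
        exact ⟨⟨z, hz⟩, h⟩
    choose s hs using hstep
    -- Each term is moved one level down without changing its residue; the limit lies in every
    -- level.
    let y : ∀ n, tower p J τ n := fun n =>
      Nat.rec (motive := fun n => tower p J τ n) ⟨x, tower_zero x⟩ s n
    have hy : ∀ n, (y n).1 - (y (n + 1)).1 ∈ J (n + 1) := fun n => hs n (y n)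
    obtain ⟨L, hL⟩ := hJ.exists_limit (fun n => (y n : A)) fun n => by
      rw [← neg_sub]
      exact neg_mem (hJ.anti (Nat.le_succ n) (hy n))
    refine ⟨L, (memG L).2 fun n => ?_, ?_⟩
    · have := add_mem (mem_tower_of_mem (p := p) (τ := τ) (hL (n + 1)))
        (tower_succ_le hJ.toIsFiltration n (y (n + 1)).2)
      rwa [sub_add_cancel] at this
    · rw [← sub_eq_zero, ← map_sub, residue_eq_zero_iff_mem_pow_one]
      have h2 : (y 1).1 - x ∈ J 1 := by
        rw [← neg_sub]; exact neg_mem (hy 0)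
      have h3 := add_mem (hL 1) h2
      rwa [sub_add_sub_cancel] at h3
  have hDVR := isDiscreteValuationRing_of_subring hdiv hinv
  have hmax : IsLocalRing.maximalIdeal G = Ideal.span {(p : G)} :=
    (irreducible_p_of_subring hdiv hinv).maximalIdeal_eq
  refine ⟨G, fun t ht => (memG t).2 fun n => lift_mem_tower n (⟨t, ht⟩ : T), hmax, ?_, fun x => ?_⟩
  · rw [hmax]
    exact isAdicComplete_of_subring hdiv hclosed
  · obtain ⟨a, rfl⟩ := IsLocalRing.residue_surjective x
    obtain ⟨g, hg, h⟩ := hres a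
    exact ⟨⟨g, hg⟩, h⟩

/-! ### Lifting from the Cohen subring -/

variable {C : Subring A}

/-- The residue map of the Cohen subring, with values in the residue field of `A`. -/
def cohenResidue (C : Subring A) : C →+* IsLocalRing.ResidueField A :=
  (IsLocalRing.residue A).comp C.subtype

theorem IsCohenSubring.cohenResidue_eq_zero_iff (hC : IsCohenSubring p T C) (c : C) :
    cohenResidue C c = 0 ↔ (p : C) ∣ c := by
  have := hC.isDVR
  constructor
  · intro h
    rw [← Ideal.mem_span_singleton, ← hC.maximalIdeal_eq, IsLocalRing.mem_maximalIdeal]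
    intro hu
    exact (hu.map (cohenResidue C)).ne_zero h
  · rintro ⟨d, rfl⟩
    rw [map_mul, map_natCast, CharP.cast_eq_zero, zero_mul]

theorem IsCohenSubring.ringHom_ext (hC : IsCohenSubring p T C)
    (hT : IsPBasis p (fun t : T => IsLocalRing.residue A t)) {D : Type*} [CommRing D]
    {J : ℕ → Ideal D} (hJ : IsCompleteFiltration p J) {g g' : C →+* D}
    (h1 : ∀ c, g c - g' c ∈ J 1)
    (h2 : ∀ t : T, g ⟨t, hC.subset t.2⟩ = g' ⟨t, hC.subset t.2⟩) : g = g' :=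
  ringHom_ext_of_isFrobBasis (hT.isFrobBasis (Fact.out : p.Prime).ne_zero)
    (ρ := cohenResidue C) hC.residue_surjective (fun c => (hC.cohenResidue_eq_zero_iff c).1)
    (t := fun t : T => ⟨t, hC.subset t.2⟩) (fun _ => rfl) hJ.toIsFiltration hJ.eq_zero h1 h2

theorem IsCohenSubring.exists_lift [CharZero A] (hC : IsCohenSubring p T C)
    (hT : IsPBasis p (fun t : T => IsLocalRing.residue A t)) {D S : Type*} [CommRing D]
    [CommRing S] {J : ℕ → Ideal D} (hJ : IsCompleteFiltration p J) {q : D →+* S}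
    (hq : Function.Surjective q) (hqJ : ∀ x, q x = 0 ↔ x ∈ J 1)
    (f : IsLocalRing.ResidueField A →+* S) (d : T → D)
    (hd : ∀ t : T, q (d t) = f (IsLocalRing.residue A t)) :
    ∃ g : C →+* D, (∀ c : C, q (g c) = f (IsLocalRing.residue A c)) ∧
      ∀ t : T, g ⟨t, hC.subset t.2⟩ = d t :=
  exists_ringHom_lift (hT.isFrobBasis (Fact.out : p.Prime).ne_zero) (CharP.cast_eq_zero _ p)
    (ρ := cohenResidue C) hC.residue_surjective (fun c => (hC.cohenResidue_eq_zero_iff c).1)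
    (t := fun t : T => ⟨t, hC.subset t.2⟩) (fun _ => rfl) hJ hq hqJ f d hd
    (Or.inl fun c hc => by
      have hp0 : (p : C) ≠ 0 := fun h => (Nat.cast_ne_zero (R := A)).2
        (Fact.out : p.Prime).ne_zero (by simpa using congrArg Subtype.val h)
      exact (mul_eq_zero.1 hc).resolve_left hp0)

/-- The lifting principle maps `C` to `C'` compatibly with residues and with `T`. By uniqueness its
composite with `C' ⊆ A` is the inclusion of `C`. -/
theorem IsCohenSubring.le [IsAdicComplete (IsLocalRing.maximalIdeal A) A] [CharZero A]
    (hT : IsPBasis p (fun t : T => IsLocalRing.residue A t)) {C C' : Subring A}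
    (hC : IsCohenSubring p T C) (hC' : IsCohenSubring p T C') : C ≤ C' := by
  have := hC'.isDVR
  have hI := hC'.complete
  rw [hC'.maximalIdeal_eq] at hI
  obtain ⟨g, hg, hgt⟩ := hC.exists_lift hT (isCompleteFiltration_pow hI
    (Ideal.mem_span_singleton_self _)) (q := cohenResidue C') hC'.residue_surjective
    (fun x => by rw [pow_one, Ideal.mem_span_singleton, hC'.cohenResidue_eq_zero_iff])
    (RingHom.id _) (fun t => ⟨t, hC'.subset t.2⟩) (fun _ => rfl)
  have h : C'.subtype.comp g = C.subtype := by
    refine hC.ringHom_ext hT (isCompleteFiltration_pow (I := IsLocalRing.maximalIdeal A)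
      inferInstance natCast_p_mem_maximalIdeal) (fun c => ?_) (fun t => ?_)
    · rw [← residue_eq_zero_iff_mem_pow_one, map_sub, sub_eq_zero]
      exact hg c
    · rw [RingHom.comp_apply, hgt]; rfl
  intro c hc
  have h1 := RingHom.congr_fun h ⟨c, hc⟩
  rw [RingHom.comp_apply] at h1
  rw [← show ((g ⟨c, hc⟩ : C') : A) = c from h1]
  exact (g ⟨c, hc⟩).2

theorem existsUnique_isCohenSubring [IsAdicComplete (IsLocalRing.maximalIdeal A) A]
    [CharZero A] (hT : IsPBasis p (fun t : T => IsLocalRing.residue A t)) :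
    ∃! C : Subring A, IsCohenSubring p T C :=
  existsUnique_of_exists_of_unique (exists_isCohenSubring hT)
    fun _ _ h h' => le_antisymm (h.le hT h') (h'.le hT h)

end Cohen

end

end ResidualPerfection

/-! ### Presenting A and V(S) as quotients -/

namespace ResidualPerfection

noncomputable section

/-! ### Tensor products along a surjection -/

namespace TensorRing

variable {P A D : Type u} [CommRing P] [CommRing A] [CommRing D] {f : P →+* A} {g : P →+* D}

theorem inr_apply (x : P) : inr f g (g x) = algebraMap A (TensorRing f g) (f x) := by
  let := f.toAlgebra
  let := g.toAlgebra
  exact (Algebra.TensorProduct.includeRight : D →ₐ[P] TensorProduct P A D).commutes x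

/-- The map out of a tensor product given by compatible maps. -/
theorem exists_lift {E : Type u} [CommRing E] [Algebra A E] (k : D →+* E)
    (hk : k.comp g = (algebraMap A E).comp f) :
    ∃ h : TensorRing f g →ₐ[A] E, ∀ d, h (inr f g d) = k d := by
  let := f.toAlgebra
  let := g.toAlgebra
  let : Algebra P E := ((algebraMap A E).comp f).toAlgebra
  have : IsScalarTower P A E := IsScalarTower.of_algebraMap_eq fun _ => rfl
  let k' : D →ₐ[P] E := { toRingHom := k, commutes' := fun x => RingHom.congr_fun hk x }
  let h : TensorProduct P A D →ₐ[A] E :=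
    Algebra.TensorProduct.lift (Algebra.ofId A E) k' fun _ _ => Commute.all _ _
  refine ⟨h, fun d => ?_⟩
  change h (1 ⊗ₜ[P] d) = k d
  rw [Algebra.TensorProduct.lift_tmul, map_one, one_mul]
  rfl

theorem inr_surjective (hf : Function.Surjective f) : Function.Surjective (inr f g) := by
  intro x
  let := f.toAlgebra
  let := g.toAlgebra
  induction x using TensorProduct.induction_on with
  | zero => exact ⟨0, map_zero _⟩
  | tmul a d =>
    obtain ⟨y, rfl⟩ := hf a
    refine ⟨g y * d, ?_⟩
    rw [map_mul, inr_apply]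
    refine (Algebra.smul_def (f y) (inr f g d)).symm.trans ?_
    have h : f y • (1 ⊗ₜ[P] d : TensorProduct P A D) = f y ⊗ₜ[P] d := by
      rw [TensorProduct.smul_tmul', smul_eq_mul, mul_one]
    exact h
  | add x y hx hy =>
    obtain ⟨a, ha⟩ := hx
    obtain ⟨b, hb⟩ := hy
    exact ⟨a + b, by rw [map_add, ha, hb]; rfl⟩

/-- As `A` is `P` modulo `ker f`, the quotient of `D` by the ideal generated by `ker f` is an
`A`-algebra, and the quotient map factors through the tensor product. -/
theorem mem_map_ker_of_inr_eq_zero (hf : Function.Surjective f) {d : D} (h : inr f g d = 0) :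
    d ∈ (RingHom.ker f).map g := by
  let K := (RingHom.ker f).map g
  let m : {m : P →+* D ⧸ K // RingHom.ker f ≤ RingHom.ker m} :=
    ⟨(Ideal.Quotient.mk K).comp g, fun x hx => by
      rw [RingHom.mem_ker, RingHom.comp_apply, Ideal.Quotient.eq_zero_iff_mem]
      exact Ideal.mem_map_of_mem g hx⟩
  let := (f.liftOfSurjective hf m).toAlgebra
  obtain ⟨k, hk⟩ := exists_lift (f := f) (g := g) (E := D ⧸ K) (Ideal.Quotient.mk K)
    (f.liftOfRightInverse_comp _ (Function.rightInverse_surjInv hf) m).symm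
  rw [← Ideal.Quotient.eq_zero_iff_mem, ← hk, h, map_zero]

end TensorRing

/-! ### Quotients of adically complete rings by an element -/

section Quotient

variable {D V : Type*} [CommRing D] [CommRing V] {x ψ : D} {i : D →+* V}

/-- If `x` is regular and `ψ` is regular modulo `x`, then `ψ` is regular modulo every power of `x`.
-/
theorem pow_dvd_of_pow_dvd_mul (hreg : ∀ d, x * d = 0 → d = 0) (hψ : ∀ d, x ∣ ψ * d → x ∣ d)
    {n : ℕ} {d : D} (h : x ^ n ∣ ψ * d) : x ^ n ∣ d := by
  induction n generalizing d with
  | zero => simp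
  | succ n ih =>
    obtain ⟨y, rfl⟩ := hψ d ((dvd_pow_self x (Nat.succ_ne_zero n)).trans h)
    rw [pow_succ']
    refine mul_dvd_mul_left x (ih ?_)
    obtain ⟨z, hz⟩ := h
    exact ⟨z, sub_eq_zero.1 (hreg _ (by rw [mul_sub]; linear_combination hz))⟩

theorem quotient_regular (hi : Function.Surjective i) (hker : ∀ d, i d = 0 ↔ ψ ∣ d)
    (hreg : ∀ d, x * d = 0 → d = 0) (hψ : ∀ d, x ∣ ψ * d → x ∣ d) (v : V) (hv : i x * v = 0) :
    v = 0 := by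
  obtain ⟨d, rfl⟩ := hi v
  rw [← map_mul, hker] at hv
  obtain ⟨g, hg⟩ := hv
  obtain ⟨y, rfl⟩ := hψ g ⟨d, hg.symm⟩
  rw [hker]
  exact ⟨y, sub_eq_zero.1 (hreg _ (by rw [mul_sub]; linear_combination hg))⟩

theorem quotient_isAdicComplete (hD : IsAdicComplete (Ideal.span {x}) D)
    (hi : Function.Surjective i) (hker : ∀ d, i d = 0 ↔ ψ ∣ d)
    (hreg : ∀ d, x * d = 0 → d = 0) (hψ : ∀ d, x ∣ ψ * d → x ∣ d) :
    IsAdicComplete (Ideal.span {i x}) V := by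
  -- Only completeness is wanted; choosing `p = 0` makes membership of `p` in the ideal trivial.
  have hJ := isCompleteFiltration_pow (p := 0) hD (by simp)
  have memD : ∀ n d, d ∈ Ideal.span {x} ^ n ↔ x ^ n ∣ d := fun n d => by
    rw [Ideal.span_singleton_pow, Ideal.mem_span_singleton]
  have memV : ∀ n v, v ∈ Ideal.span {i x} ^ n ↔ ∃ y, v = i (x ^ n * y) := fun n v => by
    rw [Ideal.span_singleton_pow, Ideal.mem_span_singleton]
    constructor
    · rintro ⟨w, rfl⟩
      obtain ⟨y, rfl⟩ := hi w
      exact ⟨y, by rw [map_mul, map_pow]⟩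
    · rintro ⟨y, rfl⟩
      exact ⟨i y, by rw [map_mul, map_pow]⟩
  refine isAdicComplete_of_pow (fun v hv => ?_) fun v hv => ?_
  · obtain ⟨d, rfl⟩ := hi v
    have h1 : ∀ n, ∃ y g, d - x ^ n * y = ψ * g := fun n => by
      obtain ⟨y, hy⟩ := (memV n _).1 (hv n)
      rw [← sub_eq_zero, ← map_sub, hker] at hy
      obtain ⟨g, hg⟩ := hy
      exact ⟨y, g, hg⟩
    choose y g hg using h1
    -- From `d = x ^ n y_n + ψ g_n` for all `n`, `x ^ n` divides `ψ (g_{n+1} - g_n)`, so the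
    -- quotients `g_n` converge and `d = ψ L`. This shows that the ideal of `ψ` is closed.
    obtain ⟨L, hL⟩ := hJ.exists_limit g fun n => (memD _ _).2 (pow_dvd_of_pow_dvd_mul hreg hψ
      ⟨y n - x * y (n + 1), by linear_combination hg n - hg (n + 1)⟩)
    rw [hker]
    refine ⟨L, sub_eq_zero.1 (hJ.eq_zero _ fun n => ?_)⟩
    obtain ⟨z, hz⟩ := (memD n _).1 (hL n)
    exact (memD n _).2 ⟨y n - ψ * z, by linear_combination hg n - ψ * hz⟩
  · have h1 : ∀ n, ∃ y, v (n + 1) - v n = i (x ^ n * y) := fun n => (memV _ _).1 (hv n)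
    choose y hy using h1
    obtain ⟨d, hd⟩ := hi (v 0)
    let s : ℕ → D := fun n => d + ∑ m ∈ Finset.range n, x ^ m * y m
    have hs : ∀ n, i (s n) = v n := by
      intro n
      induction n with
      | zero => simp [s, hd]
      | succ n ih =>
        have : s (n + 1) = s n + x ^ n * y n := by simp [s, Finset.sum_range_succ, add_assoc]
        rw [this, map_add, ih, ← hy]; ring
    obtain ⟨L, hL⟩ := hJ.exists_limit s fun n => (memD _ _).2 ⟨y n, by
      simp [s, Finset.sum_range_succ]⟩
    refine ⟨i L, fun n => ?_⟩
    obtain ⟨z, hz⟩ := (memD n _).1 (hL n)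
    exact (memV n _).2 ⟨z, by rw [← hs, ← map_sub, hz]⟩

end Quotient

/-! ### The presentation of `A` over its Cohen subring -/

section Presentation

variable {p : ℕ} [Fact p.Prime] {A : Type u} [CommRing A] [IsDomain A]
  [IsDiscreteValuationRing A] [CharP (IsLocalRing.ResidueField A) p] {π : A} {T : Set A}
  {C : Subring A}

theorem polyToA_C (c : C) : polyToA π C (Polynomial.C c) = c := Polynomial.eval₂_C _ _

theorem polyToA_X : polyToA π C Polynomial.X = π := Polynomial.eval₂_X _ _

theorem IsCohenSubring.exists_digits (hC : IsCohenSubring p T C) (hπ : Irreducible π) (j : ℕ)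
    (x : A) : ∃ (c : ℕ → C) (y : A), x = ∑ i ∈ Finset.range j, (c i : A) * π ^ i + π ^ j * y := by
  induction j with
  | zero => exact ⟨0, x, by simp⟩
  | succ j ih =>
    obtain ⟨c, y, h⟩ := ih
    obtain ⟨d, hd⟩ := hC.residue_surjective (IsLocalRing.residue A y)
    obtain ⟨z, hz⟩ := exists_eq_add_uniformizer_mul hπ hd.symm
    refine ⟨Function.update c j d, z, ?_⟩
    have h1 : ∑ i ∈ Finset.range j, ((Function.update c j d i : C) : A) * π ^ i =
        ∑ i ∈ Finset.range j, (c i : A) * π ^ i := Finset.sum_congr rfl fun i hi => by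
      rw [Function.update_of_ne (Finset.mem_range.1 hi).ne]
    rw [Finset.sum_range_succ, h1, Function.update_self, h, hz]
    ring

theorem IsCohenSubring.polyToA_surjective [IsAdicComplete (IsLocalRing.maximalIdeal A) A]
    [CharZero A] (hC : IsCohenSubring p T C) (hπ : Irreducible π) :
    Function.Surjective (polyToA π C) := by
  intro a
  obtain ⟨e, u, he, hu⟩ := exists_p_eq_unit_mul_pow (p := p) hπ
  have hstep : ∀ x : A, ∃ (c : ℕ → C) (y : A),
      x = ∑ i ∈ Finset.range e, (c i : A) * π ^ i + p * y := fun x => by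
    obtain ⟨c, y, h⟩ := hC.exists_digits hπ e x
    refine ⟨c, u⁻¹ * y, ?_⟩
    rw [h, hu]
    linear_combination -(π ^ e * y) * u.mul_inv
  choose c r hr using hstep
  have := hC.isDVR
  have hI := hC.complete
  rw [hC.maximalIdeal_eq] at hI
  -- Iterating `hstep` expands `a` in powers of `p`; the contributions to each `π ^ i` with `i < e`
  -- are summed p-adically in `C`.
  have hsum : ∀ i, ∃ d : C, IsAdicSum (Ideal.span {(p : C)}) (p : C) (fun m => c (r^[m] a) i) d :=
    fun i => exists_isAdicSum hI (Ideal.mem_span_singleton_self _) _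
  choose d hd using hsum
  refine ⟨∑ i ∈ Finset.range e, Polynomial.C (d i) * Polynomial.X ^ i, ?_⟩
  rw [map_sum]
  simp only [map_mul, map_pow, polyToA_C, polyToA_X]
  symm
  refine eq_of_forall_sub_mem (IsLocalRing.maximalIdeal A) fun n => ?_
  have h1 : a = ∑ m ∈ Finset.range n, (p : A) ^ m *
      ∑ i ∈ Finset.range e, (c (r^[m] a) i : A) * π ^ i + p ^ n * r^[n] a := by
    clear hd
    induction n with
    | zero => simp
    | succ n ih =>
      rw [Finset.sum_range_succ, Function.iterate_succ_apply']
      linear_combination ih + (p : A) ^ n * hr (r^[n] a)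
  have h2 : ∀ i, ∃ z : A, (d i : A) - ∑ m ∈ Finset.range n, (c (r^[m] a) i : A) * p ^ m =
      p ^ n * z := fun i => by
    have h3 := hd i n
    rw [Ideal.span_singleton_pow, Ideal.mem_span_singleton] at h3
    obtain ⟨z, hz⟩ := h3
    have h4 := congrArg Subtype.val hz
    push_cast at h4
    exact ⟨z, h4⟩
  choose z hz using h2
  have h3 : a - ∑ i ∈ Finset.range e, (d i : A) * π ^ i =
      p ^ n * (r^[n] a - ∑ i ∈ Finset.range e, z i * π ^ i) := by
    have h4 : ∑ i ∈ Finset.range e, (d i : A) * π ^ i =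
        ∑ m ∈ Finset.range n, (p : A) ^ m * ∑ i ∈ Finset.range e, (c (r^[m] a) i : A) * π ^ i +
        p ^ n * ∑ i ∈ Finset.range e, z i * π ^ i := by
      simp only [Finset.mul_sum]
      rw [Finset.sum_comm, ← Finset.sum_add_distrib]
      refine Finset.sum_congr rfl fun i _ => ?_
      rw [sub_eq_iff_eq_add.1 (hz i), add_mul, Finset.sum_mul, add_comm]
      refine congrArg₂ (· + ·) (Finset.sum_congr rfl fun m _ => by ring) (by ring)
    rw [h4]
    linear_combination h1
  rw [h3]
  exact Ideal.mul_mem_right _ _ (Ideal.pow_mem_pow natCast_p_mem_maximalIdeal n)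

theorem IsCohenSubring.isUnit_of_residue_ne_zero (hC : IsCohenSubring p T C) (c : C)
    (hc : IsLocalRing.residue A c ≠ 0) : IsUnit c := by
  have := hC.isDVR
  by_contra h
  rw [← mem_nonunits_iff, ← IsLocalRing.mem_maximalIdeal, hC.maximalIdeal_eq,
    Ideal.mem_span_singleton, ← hC.cohenResidue_eq_zero_iff] at h
  exact hc h

/-- An Eisenstein relation satisfied by the uniformizer. -/
theorem IsCohenSubring.exists_eisenstein [IsAdicComplete (IsLocalRing.maximalIdeal A) A]
    [CharZero A] (hC : IsCohenSubring p T C) (hπ : Irreducible π) :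
    ∃ (P : Polynomial C) (c : C), polyToA π C P = 0 ∧ IsUnit c ∧ P.coeff 0 = p * c := by
  obtain ⟨e, u, he, hu⟩ := exists_p_eq_unit_mul_pow (p := p) hπ
  obtain ⟨Q, hQ⟩ := hC.polyToA_surjective hπ ((u⁻¹ : Aˣ) : A)
  -- Since `p = u π ^ e` and `Q` maps to the inverse of `u`, this polynomial vanishes at `π`. As `e
  -- > 0`, its constant term is `p` times that of `Q`, which is a unit because `Q` maps to a unit.
  refine ⟨Polynomial.C (p : C) * Q - Polynomial.X ^ e, Q.coeff 0, ?_, ?_, ?_⟩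
  · rw [map_sub, map_mul, hQ, polyToA_C, map_pow, polyToA_X]
    push_cast
    rw [hu]
    linear_combination π ^ e * u.mul_inv
  · refine hC.isUnit_of_residue_ne_zero _ ?_
    have h1 : Q = Polynomial.X * Q.divX + Polynomial.C (Q.coeff 0) :=
      (Polynomial.X_mul_divX_add Q).symm
    have h2 := congrArg (fun q => IsLocalRing.residue A (polyToA π C q)) h1
    simp only [map_add, map_mul, polyToA_C, polyToA_X, hQ] at h2
    rw [(IsLocalRing.residue_eq_zero_iff π).2 (by
      rw [hπ.maximalIdeal_eq]; exact Ideal.mem_span_singleton_self _), zero_mul, zero_add] at h2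
    rw [← h2]
    exact (IsLocalRing.residue_ne_zero_iff_isUnit _).2 (u⁻¹).isUnit
  · rw [Polynomial.coeff_sub, Polynomial.coeff_C_mul, Polynomial.coeff_X_pow, if_neg he.ne,
      sub_zero]

/-- The kernel of `C[X] → A` generates the same ideal as an Eisenstein relation in every ring in
which `X` is mapped to an element for which the ring is adically separated and complete. -/
theorem IsCohenSubring.map_ker_le (hC : IsCohenSubring p T C) (hπ : Irreducible π)
    {P : Polynomial C} {c : C} (hP : polyToA π C P = 0) (hc : IsUnit c) (hPc : P.coeff 0 = p * c)
    {D : Type*} [CommRing D] (χ : Polynomial C →+* D)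
    (hD : IsAdicComplete (Ideal.span {χ Polynomial.X}) D) {Q : Polynomial C}
    (hQ : polyToA π C Q = 0) : χ P ∣ χ Q := by
  -- The constant term of `Q` has zero residue, so it is a multiple of `p` and hence of the constant
  -- term of `P`. Subtracting that multiple of `P` leaves `X` times a polynomial that again vanishes
  -- at `π`; iteration produces the quotient as an adic series.
  have hstep : ∀ Q : RingHom.ker (polyToA π C), ∃ (a : C) (Q' : RingHom.ker (polyToA π C)),
      (Q : Polynomial C) = Polynomial.C a * P + Polynomial.X * (Q' : Polynomial C) := by
    rintro ⟨Q, hQ⟩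
    have hQ : polyToA π C Q = 0 := hQ
    have h0 : ∀ R : Polynomial C, R = Polynomial.X * R.divX + Polynomial.C (R.coeff 0) :=
      fun R => (Polynomial.X_mul_divX_add R).symm
    have h1 : cohenResidue C (Q.coeff 0) = 0 := by
      have h2 := congrArg (fun q => IsLocalRing.residue A (polyToA π C q)) (h0 Q)
      simp only [map_add, map_mul, polyToA_C, polyToA_X, hQ] at h2
      rw [(IsLocalRing.residue_eq_zero_iff π).2 (by
        rw [hπ.maximalIdeal_eq]; exact Ideal.mem_span_singleton_self _), zero_mul, zero_add,
        map_zero] at h2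
      exact h2.symm
    obtain ⟨b, hb⟩ := (hC.cohenResidue_eq_zero_iff _).1 h1
    obtain ⟨v, hv⟩ := hc.exists_right_inv
    have e1 : Q = Polynomial.C (b * v) * P +
        Polynomial.X * (Q.divX - Polynomial.C (b * v) * P.divX) := by
      have h3 : Polynomial.C (Q.coeff 0) = Polynomial.C (b * v) * Polynomial.C (P.coeff 0) := by
        rw [← map_mul, hb, hPc]
        congr 1
        linear_combination -(p : C) * b * hv
      linear_combination h0 Q - Polynomial.C (b * v) * h0 P + h3
    refine ⟨b * v, ⟨_, ?_⟩, e1⟩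
    have h4 := congrArg (polyToA π C) e1
    rw [map_add, map_mul, hP, hQ, mul_zero, zero_add, map_mul, polyToA_X] at h4
    exact (mul_eq_zero.1 h4.symm).resolve_left hπ.ne_zero
  choose a r hr using hstep
  let q : ℕ → RingHom.ker (polyToA π C) := fun n => r^[n] ⟨Q, hQ⟩
  obtain ⟨L, hL⟩ := exists_isAdicSum hD (Ideal.mem_span_singleton_self _)
    (fun n => χ (Polynomial.C (a (q n))))
  refine ⟨L, eq_of_forall_sub_mem (Ideal.span {χ Polynomial.X}) fun n => ?_⟩
  have h1 : χ Q = χ P * ∑ i ∈ Finset.range n, χ (Polynomial.C (a (q i))) * χ Polynomial.X ^ i +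
      χ Polynomial.X ^ n * χ (q n) := by
    induction n with
    | zero => simp [q]
    | succ n ih =>
      have h2 := congrArg χ (hr (q n))
      rw [map_add, map_mul, map_mul] at h2
      have h3 : q (n + 1) = r (q n) := Function.iterate_succ_apply' r n _
      rw [Finset.sum_range_succ, h3, ih, h2]
      ring
  have h2 : χ Q - χ P * L = χ Polynomial.X ^ n * χ (q n) - χ P * (L - ∑ i ∈ Finset.range n,
      χ (Polynomial.C (a (q i))) * χ Polynomial.X ^ i) := by
    linear_combination h1
  rw [h2]
  exact sub_mem (Ideal.mul_mem_right _ _ (Ideal.pow_mem_pow (Ideal.mem_span_singleton_self _) n))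
    (Ideal.mul_mem_left _ _ (hL n))

end Presentation

end

end ResidualPerfection

/-! ### The mixed characteristic case -/

namespace ResidualPerfection

noncomputable section

section Mixed

variable {p : ℕ} [Fact p.Prime] {A : Type u} [CommRing A] [IsDomain A]
  [IsDiscreteValuationRing A] [CharP (IsLocalRing.ResidueField A) p] {π : A} {T : Set A}
  {C : Subring A} {hC : IsCohenSubring p T C}

/-! ### The map from the Cohen subring to series over Witt vectors -/

/-- Reduction of series over Witt vectors modulo `(p, X)`. -/
def wittSeriesRed (p : ℕ) [Fact p.Prime] (S : Type*) [CommRing S] :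
    PowerSeries (WittVector p S) →+* S :=
  WittVector.constantCoeff.comp PowerSeries.constantCoeff

theorem wittSeriesRed_apply {S : Type*} [CommRing S] (f : PowerSeries (WittVector p S)) :
    wittSeriesRed p S f = WittVector.constantCoeff (PowerSeries.constantCoeff f) := rfl

theorem wittSeriesRed_teichmuller {S : Type*} [CommRing S] (x : S) :
    wittSeriesRed p S (PowerSeries.C (WittVector.teichmuller p x)) = x := by
  rw [wittSeriesRed_apply, PowerSeries.constantCoeff_C]
  exact WittVector.teichmuller_coeff_zero p x

theorem wittSeriesRed_surjective {S : Type*} [CommRing S] :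
    Function.Surjective (wittSeriesRed p S) := fun x => ⟨_, wittSeriesRed_teichmuller x⟩

/-- The lifting principle for `C`, with `W(S)⟦π̃⟧` filtered by total degree in `p` and `π̃`, whose
first quotient is `S`. The variable `X` is then free to go to `π̃`. -/
theorem mixedMapsExistUnique [CharZero A]
    (hT : IsPBasis p (fun t : T => IsLocalRing.residue A t)) : MixedMapsExistUnique hC := by
  intro S
  have hS : IsPerfect p S.obj := S.property
  have hF := isCompleteFiltration_series hS.witt_isCompleteFiltration (by simp)
  have hq : ∀ f : PowerSeries (WittVector p S.obj), wittSeriesRed p S.obj f = 0 ↔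
      f ∈ seriesFiltration hS.witt_isCompleteFiltration.anti 1 := fun f => by
    rw [mem_seriesFiltration_one (by simp), pow_one, Ideal.mem_span_singleton,
      ← hS.witt_constantCoeff_eq_zero_iff, wittSeriesRed_apply]
  refine existsUnique_of_exists_of_unique ?_ fun χ χ' h h' => ?_
  · obtain ⟨g, hg, hgt⟩ := hC.exists_lift hT hF (wittSeriesRed_surjective (p := p)) hq
      ((algebraMap (RTpf p T) S.obj).comp (resToRTpf p T))
      (fun t => PowerSeries.mk fun j =>
        WittVector.teichmuller p (algebraMap (RTpf p T) S.obj (uCoeff p T t j)))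
      (fun t => by
        rw [wittSeriesRed_apply, ← PowerSeries.coeff_zero_eq_constantCoeff_apply,
          PowerSeries.coeff_mk]
        refine (WittVector.teichmuller_coeff_zero p _).trans ?_
        exact congrArg _ (dif_neg (lt_irrefl 0)))
    refine ⟨Polynomial.eval₂RingHom g PowerSeries.X, ?_, fun c => ?_, fun t => ?_⟩
    · exact Polynomial.eval₂_X _ _
    · rw [Polynomial.coe_eval₂RingHom, Polynomial.eval₂_C]
      exact hg c
    · rw [Polynomial.coe_eval₂RingHom, Polynomial.eval₂_C, hgt]
  · have h1 : χ.comp Polynomial.C = χ'.comp Polynomial.C := by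
      refine hC.ringHom_ext hT hF (fun c => ?_) (fun t => ?_)
      · rw [← hq, map_sub, sub_eq_zero]
        exact (h.reduction c).trans (h'.reduction c).symm
      · exact (h.map_lift t).trans (h'.map_lift t).symm
    exact Polynomial.ringHom_ext (fun c => RingHom.congr_fun h1 c) (h.map_X.trans h'.map_X.symm)

/-! ### The ring `V(S)` in mixed characteristic -/

variable (hχ : MixedMapsExistUnique hC) (S : PAlg p (RTpf p T))

theorem mixedMap_spec : IsMixedMap p hC S.obj (mixedMap hχ S) := (hχ S).choose_spec.1

namespace VMixed

theorem algebraMap_polyToA (Q : Polynomial C) :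
    algebraMap A ((VMixed π hχ).obj S) (polyToA π C Q) = ofSeries π hχ S (mixedMap hχ S Q) :=
  (TensorRing.inr_apply Q).symm

theorem algebraMap_uniformizer :
    algebraMap A ((VMixed π hχ).obj S) π = ofSeries π hχ S PowerSeries.X := by
  rw [← (mixedMap_spec hχ S).map_X, ← algebraMap_polyToA, polyToA_X]

theorem algebraMap_cohen (c : C) :
    algebraMap A ((VMixed π hχ).obj S) c = ofSeries π hχ S (mixedMap hχ S (Polynomial.C c)) := by
  rw [← algebraMap_polyToA, polyToA_C]

theorem pIdeal_eq (hπ : Irreducible π) : pIdeal A ((VMixed π hχ).obj S) =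
    Ideal.span {ofSeries π hχ S PowerSeries.X} := by
  rw [pIdeal_eq_span hπ, algebraMap_uniformizer]

theorem ofSeries_mem_pow (hπ : Irreducible π) {n : ℕ} {f : PowerSeries (WittVector p S.obj)}
    (h : f ∈ Ideal.span {(PowerSeries.X : PowerSeries (WittVector p S.obj))} ^ n) :
    ofSeries π hχ S f ∈ pIdeal A ((VMixed π hχ).obj S) ^ n := by
  rw [Ideal.span_singleton_pow, Ideal.mem_span_singleton] at h
  obtain ⟨g, rfl⟩ := h
  rw [pIdeal_eq hχ S hπ, map_mul, map_pow]
  exact Ideal.mul_mem_right _ _ (Ideal.pow_mem_pow (Ideal.mem_span_singleton_self _) n)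

variable [IsAdicComplete (IsLocalRing.maximalIdeal A) A] [CharZero A]

theorem ofSeries_surjective (hπ : Irreducible π) :
    Function.Surjective (ofSeries π hχ S) :=
  TensorRing.inr_surjective (hC.polyToA_surjective hπ)

/-- `V(S)` is the quotient of `W(S)⟦π̃⟧` by an element whose constant coefficient is `p` times a
unit. -/
theorem exists_ker_eq (hπ : Irreducible π) : ∃ (ψ : PowerSeries (WittVector p S.obj))
    (w : WittVector p S.obj), IsUnit w ∧ PowerSeries.constantCoeff ψ = p * w ∧
      ∀ f, ofSeries π hχ S f = 0 ↔ ψ ∣ f := by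
  obtain ⟨P, c, hP, hc, hPc⟩ := hC.exists_eisenstein hπ
  have hX := (mixedMap_spec hχ S).map_X
  refine ⟨mixedMap hχ S P, PowerSeries.constantCoeff (mixedMap hχ S (Polynomial.C c)),
    hc.map ((PowerSeries.constantCoeff.comp (mixedMap hχ S)).comp Polynomial.C), ?_, fun f => ?_⟩
  · have h1 := congrArg (fun q => PowerSeries.constantCoeff (mixedMap hχ S q))
      (Polynomial.X_mul_divX_add P)
    simp only [map_add, map_mul, hX, PowerSeries.constantCoeff_X, zero_mul, zero_add, hPc,
      map_natCast] at h1
    exact h1.symm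
  · constructor
    · intro h
      have h1 : f ∈ (RingHom.ker (polyToA π C)).map (mixedMap hχ S) :=
        TensorRing.mem_map_ker_of_inr_eq_zero (hC.polyToA_surjective hπ) h
      rw [← Ideal.mem_span_singleton]
      refine (Ideal.map_le_iff_le_comap.2 fun Q hQ => ?_) h1
      rw [Ideal.mem_comap, Ideal.mem_span_singleton]
      refine hC.map_ker_le hπ hP hc hPc _ ?_ hQ
      rw [hX]
      exact isAdicComplete_X
    · rintro ⟨g, rfl⟩
      rw [map_mul, ← algebraMap_polyToA, hP, map_zero, zero_mul]

/-- Modulo `X` the series `ψ` becomes `p` times a unit, and `p` is regular in the Witt vectors of a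
perfect ring. -/
theorem X_dvd_of_X_dvd_mul {ψ : PowerSeries (WittVector p S.obj)}
    {w : WittVector p S.obj} (hw : IsUnit w) (hψ : PowerSeries.constantCoeff ψ = p * w)
    (g : PowerSeries (WittVector p S.obj)) (h : PowerSeries.X ∣ ψ * g) : PowerSeries.X ∣ g := by
  rw [PowerSeries.X_dvd_iff, map_mul, hψ, mul_assoc] at h
  rw [PowerSeries.X_dvd_iff]
  have h1 := IsPerfect.witt_eq_zero S.property h
  exact (hw.mul_right_eq_zero).1 h1

/-- Modulo `X` the relation `ψ` generates the same ideal as `p`, so dividing by `(X, ψ)` is dividing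
by `(X, p)`. -/
theorem mk_ofSeries_eq_zero_iff (hπ : Irreducible π) (f : PowerSeries (WittVector p S.obj)) :
    ofSeries π hχ S f ∈ pIdeal A ((VMixed π hχ).obj S) ↔ wittSeriesRed p S.obj f = 0 := by
  obtain ⟨ψ, w, hw, hψ, hker⟩ := exists_ker_eq (π := π) hχ S hπ
  rw [pIdeal_eq hχ S hπ, Ideal.mem_span_singleton, wittSeriesRed_apply,
    IsPerfect.witt_constantCoeff_eq_zero_iff S.property]
  constructor
  · rintro ⟨v, hv⟩
    obtain ⟨g, rfl⟩ := ofSeries_surjective hχ S hπ v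
    rw [← map_mul, ← sub_eq_zero, ← map_sub, hker] at hv
    obtain ⟨k, hk⟩ := hv
    have h1 := congrArg PowerSeries.constantCoeff hk
    rw [map_sub, map_mul, PowerSeries.constantCoeff_X, zero_mul, sub_zero, map_mul, hψ] at h1
    exact ⟨w * PowerSeries.constantCoeff k, by rw [h1, mul_assoc]⟩
  · rintro ⟨z, hz⟩
    obtain ⟨v, hv⟩ := hw.exists_right_inv
    have h1 : PowerSeries.X ∣ f - ψ * PowerSeries.C (v * z) := by
      rw [PowerSeries.X_dvd_iff, map_sub, map_mul, PowerSeries.constantCoeff_C, hψ, hz]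
      linear_combination -(p : WittVector p S.obj) * z * hv
    obtain ⟨g, hg⟩ := h1
    refine ⟨ofSeries π hχ S g, ?_⟩
    rw [← map_mul, ← hg, map_sub, (hker _).2 (dvd_mul_right _ _), sub_zero]

theorem exists_redEquiv (hπ : Irreducible π) :
    ∃ r : S.obj →+* Red A ((VMixed π hχ).obj S), Function.Bijective r ∧
      ∀ f, r (wittSeriesRed p S.obj f) =
        Ideal.Quotient.mk (pIdeal A ((VMixed π hχ).obj S)) (ofSeries π hχ S f) := by
  let q := wittSeriesRed p S.obj
  let m : {m : PowerSeries (WittVector p S.obj) →+* Red A ((VMixed π hχ).obj S) //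
      RingHom.ker q ≤ RingHom.ker m} :=
    ⟨(Ideal.Quotient.mk _).comp (ofSeries π hχ S), fun f hf => by
      rw [RingHom.mem_ker, RingHom.comp_apply, Ideal.Quotient.eq_zero_iff_mem,
        mk_ofSeries_eq_zero_iff hχ S hπ]
      exact hf⟩
  have hq : Function.Surjective q := wittSeriesRed_surjective
  have hr : ∀ f, q.liftOfSurjective hq m (q f) = m.1 f := fun f =>
    RingHom.congr_fun (q.liftOfRightInverse_comp _ (Function.rightInverse_surjInv hq) m) f
  refine ⟨q.liftOfSurjective hq m, ⟨?_, ?_⟩, hr⟩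
  · rw [injective_iff_map_eq_zero]
    intro x hx
    obtain ⟨f, rfl⟩ := hq x
    rw [hr] at hx
    exact (mk_ofSeries_eq_zero_iff hχ S hπ f).1 (Ideal.Quotient.eq_zero_iff_mem.1 hx)
  · intro y
    obtain ⟨v, rfl⟩ := Ideal.Quotient.mk_surjective y
    obtain ⟨f, rfl⟩ := ofSeries_surjective hχ S hπ v
    exact ⟨q f, hr f⟩

theorem isCRP (hπ : Irreducible π) : isCRP p A ((VMixed π hχ).obj S) := by
  obtain ⟨ψ, w, hw, hψ, hker⟩ := exists_ker_eq (π := π) hχ S hπ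
  have hreg : ∀ d : PowerSeries (WittVector p S.obj), PowerSeries.X * d = 0 → d = 0 :=
    fun d hd => PowerSeries.X_mul_cancel (hd.trans (mul_zero _).symm)
  obtain ⟨r, hr, -⟩ := exists_redEquiv (π := π) hχ S hπ
  refine ⟨flat_of_uniformizer_regular hπ ?_, ?_, IsPerfect.of_bijective S.property r hr⟩
  · rw [algebraMap_uniformizer]
    exact quotient_regular (ofSeries_surjective hχ S hπ) hker hreg (X_dvd_of_X_dvd_mul S hw hψ)
  · rw [pIdeal_eq hχ S hπ]
    exact quotient_isAdicComplete isAdicComplete_X (ofSeries_surjective hχ S hπ) hker hreg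
      (X_dvd_of_X_dvd_mul S hw hψ)

/-- The map `x ↦ 1 ⊗ s_W(x)`. -/
def teich (π : A) {hC : IsCohenSubring p T C} (hχ : MixedMapsExistUnique hC)
    (S : PAlg p (RTpf p T)) : S.obj →* (VMixed π hχ).obj S :=
  ((ofSeries π hχ S).comp PowerSeries.C : _ →* _).comp (WittVector.teichmuller p)

theorem teich_apply (x : S.obj) : teich π hχ S x =
    ofSeries π hχ S (PowerSeries.C (WittVector.teichmuller p x)) := rfl

theorem isCoefficientSystem (hπ : Irreducible π) :
    IsCoefficientSystem hπ ((ResidualPerfection.isCRP p A).lift (VMixed π hχ)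
      (fun S => VMixed.isCRP hχ S hπ)) (teich π hχ) where
  natural {S S'} f x := by
    refine (TensorRing.map_inr _ _ (map_comp_mixedMap hχ f) _).trans ?_
    rw [PowerSeries.map_C, WittVector.map_teichmuller]
    rfl
  bijective S := by
    obtain ⟨r, hr, h⟩ := exists_redEquiv (π := π) hχ S hπ
    have h1 : (fun x => Ideal.Quotient.mk (pIdeal A ((VMixed π hχ).obj S)) (teich π hχ S x)) = r :=
      funext fun x => by rw [teich_apply, ← h, wittSeriesRed_teichmuller]
    exact (congrArg Function.Bijective h1).mpr hr
  map_add S x y := by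
    change teich π hχ S (x + y) - (teich π hχ S x + teich π hχ S y) ∈
      pIdeal A ((VMixed π hχ).obj S)
    have e : teich π hχ S (x + y) - (teich π hχ S x + teich π hχ S y) =
        ofSeries π hχ S (PowerSeries.C (WittVector.teichmuller p (x + y)) -
          (PowerSeries.C (WittVector.teichmuller p x) +
            PowerSeries.C (WittVector.teichmuller p y))) := by
      rw [map_sub (ofSeries π hχ S), map_add (ofSeries π hχ S)]
      rfl
    rw [e, mk_ofSeries_eq_zero_iff hχ S hπ, map_sub (wittSeriesRed p S.obj),
      map_add (wittSeriesRed p S.obj), wittSeriesRed_teichmuller, wittSeriesRed_teichmuller,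
      wittSeriesRed_teichmuller, sub_self]
  residue S a := by
    change algebraMap A ((VMixed π hχ).obj S) a - teich π hχ S _ ∈
      pIdeal A ((VMixed π hχ).obj S)
    -- Modulo `π` the element `a` may be replaced by an element of `C`, for which the reduction is
    -- prescribed by `IsMixedMap`.
    obtain ⟨c, hc⟩ := hC.residue_surjective (IsLocalRing.residue A a)
    obtain ⟨z, hz⟩ := exists_eq_add_uniformizer_mul hπ hc.symm
    rw [← hc, hz, map_add, map_mul, add_sub_right_comm]
    refine add_mem ?_ (Ideal.mul_mem_right _ _ ?_)
    · rw [algebraMap_cohen, teich_apply, ← map_sub, mk_ofSeries_eq_zero_iff hχ S hπ, map_sub,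
        wittSeriesRed_teichmuller, wittSeriesRed_apply, (mixedMap_spec hχ S).reduction, sub_self]
    · rw [pIdeal_eq_span hπ]; exact Ideal.mem_span_singleton_self _
  expansion S t n := by
    change algebraMap A ((VMixed π hχ).obj S) t - ∑ i ∈ Finset.range n, teich π hχ S
      (algebraMap (RTpf p T) S.obj (uCoeff p T t i)) * algebraMap A ((VMixed π hχ).obj S) π ^ i ∈
      pIdeal A ((VMixed π hχ).obj S) ^ n
    rw [algebraMap_cohen hχ S ⟨t, hC.subset t.2⟩, algebraMap_uniformizer]
    simp only [teich_apply, ← map_pow, ← map_mul, ← map_sum, ← map_sub]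
    refine ofSeries_mem_pow hχ S hπ (mem_span_X_pow.2 fun i hi => ?_)
    rw [(mixedMap_spec hχ S).map_lift, map_sub, map_sum, PowerSeries.coeff_mk,
      Finset.sum_eq_single i]
    · simp [PowerSeries.coeff_C_mul, PowerSeries.coeff_X_pow]
    · intro j _ hj
      simp [PowerSeries.coeff_C_mul, PowerSeries.coeff_X_pow, hj.symm]
    · intro h; exact absurd (Finset.mem_range.2 hi) h

end VMixed

variable [IsAdicComplete (IsLocalRing.maximalIdeal A) A] [CharZero A]

/-- Evaluation of series through `θ` descends to the tensor product once it agrees on `C[X]` with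
the map through `A`. On `C` this is uniqueness of lifts, because `θ` carries Teichmüller expansions
of `T` to expansions in `B`. -/
theorem CRP.exists_mixed_counit (hπ : Irreducible π)
    (hT : IsPBasis p (fun t : T => IsLocalRing.residue A t)) (B : CRP p A)
    {θ : WittVector p (Red A B.obj) →+* B.obj} (hθ : IsWittLift B θ) :
    ∃ ε : (VMixed π hχ).obj ((U hπ T).obj B) ⟶ B.obj,
      ∀ f : PowerSeries (WittVector p ((U hπ T).obj B).obj),
        IsAdicSum (pIdeal A B.obj) (algebraMap A B.obj π)
          (fun i => θ (WittVector.map (U.toRed hπ T B).toRingHom (PowerSeries.coeff i f)))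
          (ε.hom (VMixed.ofSeries π hχ _ f)) := by
  have hB := B.property.complete
  let S := (U hπ T).obj B
  -- The composite of `θ` with the Teichmüller map is a multiplicative section, hence equal to
  -- `s_B`.
  have hsec : (θ : WittVector p (Red A B.obj) →* B.obj).comp (WittVector.teichmuller p) = B.sec :=
    B.existsUnique_section.unique (fun x => (hθ _).trans (WittVector.teichmuller_coeff_zero p x))
      B.mk_sec
  have hsec : ∀ x, B.sec x = θ (WittVector.teichmuller p x) :=
    fun x => (DFunLike.congr_fun hsec x).symm
  obtain ⟨ev, hev⟩ := exists_seriesEval hB (B.algebraMap_uniformizer_mem hπ)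
    (θ.comp (WittVector.map (U.toRed hπ T B).toRingHom))
  have hcomp : ev.comp (mixedMap hχ S) = (algebraMap A B.obj).comp (polyToA π C) := by
    have h1 : (ev.comp (mixedMap hχ S)).comp Polynomial.C =
        ((algebraMap A B.obj).comp (polyToA π C)).comp Polynomial.C := by
      refine hC.ringHom_ext hT B.isCompleteFiltration (fun c => ?_) (fun t => ?_)
      · rw [pow_one, ← Ideal.Quotient.eq]
        have h1 := Ideal.Quotient.eq.2 (hev (mixedMap hχ S (Polynomial.C c))).eq_of_first
        refine h1.trans ((hθ _).trans ?_)
        rw [PowerSeries.coeff_zero_eq_constantCoeff_apply]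
        refine (congrArg (U.toRed hπ T B) ((mixedMap_spec hχ S).reduction c)).trans ?_
        refine (structureMap_res hπ B _).trans ?_
        simp only [RingHom.comp_apply, polyToA_C]
        rfl
      · have h1 := hev (mixedMap hχ S (Polynomial.C ⟨t, hC.subset t.2⟩))
        simp only [RingHom.comp_apply, polyToA_C]
        refine IsAdicSum.unique (I := pIdeal A B.obj) (ϖ := algebraMap A B.obj π)
          (c := fun i => B.sec (B.coeff hπ (algebraMap A B.obj t) i)) ?_ (B.isAdicSum_coeff hπ _)
        rw [(mixedMap_spec hχ S).map_lift] at h1 ⊢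
        simp only [PowerSeries.coeff_mk, RingHom.comp_apply, WittVector.map_teichmuller] at h1
        simp only [← structureMap_uCoeff, hsec]
        exact h1
    refine Polynomial.ringHom_ext (fun c => RingHom.congr_fun h1 c) ?_
    rw [RingHom.comp_apply, RingHom.comp_apply, (mixedMap_spec hχ S).map_X, polyToA_X]
    exact isAdicSum_X inferInstance (B.algebraMap_uniformizer_mem hπ) (hev _)
  obtain ⟨ε, hε⟩ := TensorRing.exists_lift ev hcomp
  refine ⟨CommAlgCat.ofHom ε, fun f => ?_⟩
  have h1 : (CommAlgCat.ofHom ε).hom (VMixed.ofSeries π hχ S f) = ev f := hε f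
  refine Eq.mpr (congrArg (IsAdicSum _ _ _) h1) (hev f)

/-- In mixed characteristic, `V` and `U` form an adjoint equivalence. -/
theorem exists_mixed_adjunction (hC : IsCohenSubring p T C) (hπ : Irreducible π)
    (hT : IsPBasis p (fun t : T => IsLocalRing.residue A t)) :
    ∃ (hχ : MixedMapsExistUnique hC)
      (hV : ∀ S, isCRP p A ((VMixed π hχ).obj S))
      (adj : (isCRP p A).lift (VMixed π hχ) hV ⊣ U hπ T),
      IsIso adj.unit ∧ IsIso adj.counit ∧
      (∀ (S : PAlg p (RTpf p T)) (x : S.obj),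
        U.toRed hπ T _ ((adj.unit.app S).hom.hom x) =
          Ideal.Quotient.mk (pIdeal A ((VMixed π hχ).obj S))
            (VMixed.ofSeries π hχ S (PowerSeries.C (WittVector.teichmuller p x)))) ∧
      (∀ B : CRP p A,
        ∃ θ : WittVector p (Red A B.obj) →+* B.obj,
          IsWittLift B θ ∧ (∀ θ', IsWittLift B θ' → θ' = θ) ∧
          ∀ f : PowerSeries (WittVector p ((U hπ T).obj B).obj),
            IsAdicSum (pIdeal A B.obj) (algebraMap A B.obj π)
              (fun i => θ (WittVector.map (U.toRed hπ T B).toRingHom (PowerSeries.coeff i f)))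
              ((adj.counit.app B).hom.hom (VMixed.ofSeries π hχ _ f))) ∧
      DescribesUniversalAndGeneric T ((isCRP p A).lift (VMixed π hχ) hV) := by
  have hχ : MixedMapsExistUnique hC := mixedMapsExistUnique hT
  have hκ := VMixed.isCoefficientSystem hχ hπ
  choose θ hθ hθ' using fun B : CRP p A =>
    existsUnique_wittLift B.property.complete B.property.perfect
  choose ε hε using fun B => CRP.exists_mixed_counit hχ hπ hT B (hθ B)
  obtain ⟨adj, h1, h2, h3, h4, h5⟩ := hκ.exists_adjunction
    (ε := fun B => ObjectProperty.homMk (ε B)) (fun B x => by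
      have h := Ideal.Quotient.eq.2
        (hε B (PowerSeries.C (WittVector.teichmuller p x))).eq_of_first
      rw [hθ, PowerSeries.coeff_zero_C, WittVector.map_teichmuller] at h
      exact h.trans (WittVector.teichmuller_coeff_zero p _))
  refine ⟨hχ, _, adj, h1, h2, h3, fun B => ⟨θ B, hθ B, hθ' B, fun f => ?_⟩, h5⟩
  rw [h4]
  exact hε B f

end Mixed

end

end ResidualPerfection

theorem mainTheorem2 (p : ℕ) [Fact p.Prime] {A : Type u} [CommRing A] [IsDomain A]
    [IsDiscreteValuationRing A] [IsAdicComplete (IsLocalRing.maximalIdeal A) A]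
    [CharP (IsLocalRing.ResidueField A) p]
    (π : A) (hπ : Irreducible π)
    (T : Set A) (hT : IsPBasis p (fun t : T => IsLocalRing.residue A t)) :
    -- equal characteristic
    (CharP A p →
      ∃ (hφ : EqualMapsExistUnique p π T)
        (hV : ∀ S, isCRP p A ((VEqual hφ).obj S))
        (adj : (isCRP p A).lift (VEqual hφ) hV ⊣ U hπ T),
        IsIso adj.unit ∧ IsIso adj.counit ∧
        (∀ (S : PAlg p (RTpf p T)) (x : S.obj),
          U.toRed hπ T _ ((adj.unit.app S).hom.hom x) =
            Ideal.Quotient.mk (pIdeal A ((VEqual hφ).obj S))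
              (VEqual.ofSeries hφ S (PowerSeries.C x))) ∧
        (∀ (B : CRP p A) (f : PowerSeries ((U hπ T).obj B).obj),
          IsAdicSum (pIdeal A B.obj) (algebraMap A B.obj π)
            (fun i => B.sec (U.toRed hπ T B (PowerSeries.coeff i f)))
            ((adj.counit.app B).hom.hom (VEqual.ofSeries hφ _ f))) ∧
        DescribesUniversalAndGeneric T ((isCRP p A).lift (VEqual hφ) hV)) ∧
    -- mixed characteristic
    (CharZero A →
      (∃! C : Subring A, IsCohenSubring p T C) ∧
      ∀ (C : Subring A) (hC : IsCohenSubring p T C),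
      ∃ (hχ : MixedMapsExistUnique hC)
        (hV : ∀ S, isCRP p A ((VMixed π hχ).obj S))
        (adj : (isCRP p A).lift (VMixed π hχ) hV ⊣ U hπ T),
        IsIso adj.unit ∧ IsIso adj.counit ∧
        (∀ (S : PAlg p (RTpf p T)) (x : S.obj),
          U.toRed hπ T _ ((adj.unit.app S).hom.hom x) =
            Ideal.Quotient.mk (pIdeal A ((VMixed π hχ).obj S))
              (VMixed.ofSeries π hχ S (PowerSeries.C (WittVector.teichmuller p x)))) ∧
        (∀ B : CRP p A,
          ∃ θ : WittVector p (Red A B.obj) →+* B.obj,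
            IsWittLift B θ ∧ (∀ θ', IsWittLift B θ' → θ' = θ) ∧
            ∀ f : PowerSeries (WittVector p ((U hπ T).obj B).obj),
              IsAdicSum (pIdeal A B.obj) (algebraMap A B.obj π)
                (fun i => θ (WittVector.map (U.toRed hπ T B).toRingHom (PowerSeries.coeff i f)))
                ((adj.counit.app B).hom.hom (VMixed.ofSeries π hχ _ f))) ∧
        DescribesUniversalAndGeneric T ((isCRP p A).lift (VMixed π hχ) hV)) := by
  exact ⟨fun _ => exists_equal_adjunction hπ hT, fun _ => ⟨existsUnique_isCohenSubring hT,
    fun _ hC => exists_mixed_adjunction hC hπ hT⟩⟩
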